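/- Let $N \ge 1$ be an integer and let $m \ge 0$ be real. Let $L^2(m)$ be the Hilbert space of (classes of) measurable functions $f:\mathbb{R}^N\to\mathbb{C}$ with $$\|f\|_m = \Bigl(\int_{\mathbb{R}^N} (1+|\xi|^2)^m |f(\xi)|^2\,d\xi\Bigr)^{1/2} < \infty ,$$ and let $\mathcal{L} = \Delta + \tfrac12\,\xi\cdot\nabla + \tfrac N2$, considered as an unbounded operator in $L^2(m)$ on its maximal domain $\{f \in L^2(m) : \mathcal{L}f \in L^2(m)\}$, where $\mathcal{L}f$ is taken in the sense of distributions. Then the spectrum of $\mathcal{L}$ is $$\sigma(\mathcal{L}) = \Bigl\{\lambda\in\mathbb{C} : \operatorname{Re}\lambda \le \tfrac N4 - \tfrac m2\Bigr\} \cup \Bigl\{-\tfrac k2 : k = 0,1,2,\dots\Bigr\}.$$ Moreover, for every integer $k \ge 0$ with $k + \tfrac N2 < m$, the number $\lambda_k = -\tfrac k2$ is an isolated point of $\sigma(\mathcal{L})$ and an eigenvalue of $\mathcal{L}$, with multiplicity $\binom{N+k-1}{k}$, both geometric (the dimension of $\ker(\mathcal{L}-\lambda_k)$) and algebraic (the rank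 of the Riesz spectral projection $\frac{1}{2\pi i}\oint_{|\zeta-\lambda_k|=r}(\zeta-\mathcal{L})^{-1}\,d\zeta$ over any circle that encloses $\lambda_k$ with no other point of $\sigma(\mathcal{L})$ on or inside the circle). -/

import Mathlib

open MeasureTheory
open scoped ENNReal NNReal SchwartzMap LineDeriv Laplacian

noncomputable section

/-! ### Spectral theory of unbounded operators on a Banach space -/

namespace UnboundedOp

variable {X : Type*} [NormedAddCommGroup X] [NormedSpace ℂ X]

/-- `R` is a bounded everywhere defined two-sided inverse of `z - A : D(A) → X`. -/
def IsResolventAt (A : X →ₗ.[ℂ] X) (z : ℂ) (R : X →L[ℂ] X) : Prop :=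
  (∀ x : X, ∃ h : R x ∈ A.domain, z • R x - A ⟨R x, h⟩ = x) ∧
    ∀ x : A.domain, R (z • (x : X) - A x) = x

/-- The resolvent set of `A`. -/
def resolventSet (A : X →ₗ.[ℂ] X) : Set ℂ :=
  {z | ∃ R : X →L[ℂ] X, IsResolventAt A z R}

/-- The spectrum of `A`. -/
def spectrum (A : X →ₗ.[ℂ] X) : Set ℂ :=
  (resolventSet A)ᶜ

open Classical in
/-- The resolvent `(z - A)⁻¹` (with value `0` for `z` in the spectrum). -/
def resolvent (A : X →ₗ.[ℂ] X) (z : ℂ) : X →L[ℂ] X :=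
  if h : ∃ R : X →L[ℂ] X, IsResolventAt A z R then h.choose else 0

/-- The eigenspace `{x ∈ D(A) | A x = z x}`. -/
def eigenspace (A : X →ₗ.[ℂ] X) (z : ℂ) : Submodule ℂ X :=
  (LinearMap.ker (A.toFun - z • A.domain.subtype)).map A.domain.subtype

/-- `z` is an eigenvalue of `A`. -/
def IsEigenvalue (A : X →ₗ.[ℂ] X) (z : ℂ) : Prop :=
  eigenspace A z ≠ ⊥

/-- `z` is an isolated point of the spectrum of `A`. -/
def IsIsolatedInSpectrum (A : X →ₗ.[ℂ] X) (z : ℂ) : Prop :=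
  ∃ ε > 0, spectrum A ∩ Metric.ball z ε = {z}

/-- The Riesz spectral projection `(2πi)⁻¹ ∮_{|ζ - z| = r} (ζ - A)⁻¹ dζ`. -/
def rieszProjection (A : X →ₗ.[ℂ] X) (z : ℂ) (r : ℝ) : X →L[ℂ] X :=
  (2 * Real.pi * Complex.I : ℂ)⁻¹ • ∮ ζ in C(z, r), resolvent A ζ

/-- The isolated point `z` of the spectrum of `A` has algebraic multiplicity `d`: the Riesz
projection over any circle that separates `z` from the rest of the spectrum has rank `d`. -/
def HasAlgebraicMultiplicity (A : X →ₗ.[ℂ] X) (z : ℂ) (d : ℕ) : Prop :=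
  ∀ r > 0, spectrum A ∩ Metric.closedBall z r = {z} →
    Module.rank ℂ (LinearMap.range (rieszProjection A z r).toLinearMap) = d

end UnboundedOp

/-! ### The weighted space `L²(m)` and the operator `ℒ` -/

/-- The measure `(1 + |ξ|²)^m dξ` on `ℝ^N`. -/
def weightMeasure (N : ℕ) (m : ℝ≥0) : Measure (EuclideanSpace ℝ (Fin N)) :=
  volume.withDensity fun ξ => ENNReal.ofReal ((1 + ‖ξ‖ ^ 2) ^ (m : ℝ))

/-- The weighted space `L²(m)`, with norm `(∫ (1 + |ξ|²)^m |f(ξ)|² dξ)^{1/2}`. -/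
abbrev WeightedL2 (N : ℕ) (m : ℝ≥0) : Type :=
  Lp ℂ 2 (weightMeasure N m)

theorem volume_le_weightMeasure (N : ℕ) (m : ℝ≥0) :
    (volume : Measure (EuclideanSpace ℝ (Fin N))) ≤ weightMeasure N m := by
  calc (volume : Measure (EuclideanSpace ℝ (Fin N)))
      = volume.withDensity 1 := withDensity_one.symm
    _ ≤ weightMeasure N m := by
      refine withDensity_mono (Filter.Eventually.of_forall fun ξ => ?_)
      simp only [Pi.one_apply, ENNReal.one_le_ofReal]
      exact Real.one_le_rpow (by nlinarith [sq_nonneg ‖ξ‖]) m.coe_nonneg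

theorem weightMeasure_absolutelyContinuous (N : ℕ) (m : ℝ≥0) :
    weightMeasure N m ≪ (volume : Measure (EuclideanSpace ℝ (Fin N))) :=
  withDensity_absolutelyContinuous _ _

/-- The inclusion `L²(m) ⊆ L²(ℝ^N)`. -/
def WeightedL2.toL2 (N : ℕ) (m : ℝ≥0) :
    WeightedL2 N m →ₗ[ℂ] Lp ℂ 2 (volume : Measure (EuclideanSpace ℝ (Fin N))) where
  toFun f := ((Lp.memLp f).mono_measure (volume_le_weightMeasure N m)).toLp f
  map_add' f g := by
    rw [← MemLp.toLp_add, MemLp.toLp_eq_toLp_iff]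
    exact (volume_le_weightMeasure N m).absolutelyContinuous.ae_le (Lp.coeFn_add f g)
  map_smul' c f := by
    rw [RingHom.id_apply, ← MemLp.toLp_const_smul, MemLp.toLp_eq_toLp_iff]
    exact (volume_le_weightMeasure N m).absolutelyContinuous.ae_le (Lp.coeFn_smul c f)

theorem WeightedL2.toL2_injective (N : ℕ) (m : ℝ≥0) :
    Function.Injective (WeightedL2.toL2 N m) := by
  intro f g h
  have h' : f =ᵐ[volume] g := (MemLp.toLp_eq_toLp_iff
    ((Lp.memLp f).mono_measure (volume_le_weightMeasure N m))
    ((Lp.memLp g).mono_measure (volume_le_weightMeasure N m))).1 h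
  exact Lp.ext ((weightMeasure_absolutelyContinuous N m).ae_le h')

/-- The inclusion of `L²(m)` into the tempered distributions, `f ↦ (φ ↦ ∫ φ(ξ) f(ξ) dξ)`. -/
def WeightedL2.toDistribution (N : ℕ) (m : ℝ≥0) :
    WeightedL2 N m →ₗ[ℂ] 𝓢'(EuclideanSpace ℝ (Fin N), ℂ) :=
  (Lp.toTemperedDistributionCLM ℂ volume 2).toLinearMap ∘ₗ WeightedL2.toL2 N m

theorem WeightedL2.toDistribution_injective (N : ℕ) (m : ℝ≥0) :
    Function.Injective (WeightedL2.toDistribution N m) :=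
  (LinearMap.ker_eq_bot.1 Lp.ker_toTemperedDistributionCLM_eq_bot).comp
    (WeightedL2.toL2_injective N m)

/-- The differential operator `ℒ = Δ + ½ ξ·∇ + N/2` on tempered distributions. -/
def distL (N : ℕ) :
    𝓢'(EuclideanSpace ℝ (Fin N), ℂ) →ₗ[ℂ] 𝓢'(EuclideanSpace ℝ (Fin N), ℂ) where
  toFun T := Δ T
    + (1 / 2 : ℂ) • ∑ i : Fin N,
        TemperedDistribution.smulLeftCLM ℂ (fun ξ : EuclideanSpace ℝ (Fin N) => (ξ i : ℂ))
          (∂_{EuclideanSpace.single i (1 : ℝ)} T)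
    + (N / 2 : ℂ) • T
  map_add' S T := by
    simp only [LineDeriv.lineDerivOp_add, map_add, Finset.sum_add_distrib, smul_add,
      TemperedDistribution.laplacian_eq_sum (stdOrthonormalBasis ℝ _)]
    abel
  map_smul' c T := by
    simp only [LineDeriv.lineDerivOp_smul, map_smul, ← Finset.smul_sum, smul_add,
      RingHom.id_apply, TemperedDistribution.laplacian_eq_sum (stdOrthonormalBasis ℝ _),
      smul_comm c]

/-- The operator `ℒ` in `L²(m)` on its maximal domain `{f ∈ L²(m) | ℒ f ∈ L²(m)}`, where `ℒ f`
is taken in the sense of distributions. -/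
def opL (N : ℕ) (m : ℝ≥0) : WeightedL2 N m →ₗ.[ℂ] WeightedL2 N m where
  domain := (LinearMap.range (WeightedL2.toDistribution N m)).comap
    (distL N ∘ₗ WeightedL2.toDistribution N m)
  toFun :=
    (LinearEquiv.ofInjective _ (WeightedL2.toDistribution_injective N m)).symm.toLinearMap ∘ₗ
      (distL N ∘ₗ WeightedL2.toDistribution N m).restrict fun _ hf => hf

/-- On its domain, `opL` is given by the distribution `ℒ f`. -/
theorem toDistribution_opL (N : ℕ) (m : ℝ≥0) (f : (opL N m).domain) :
    WeightedL2.toDistribution N m (opL N m f) = distL N (WeightedL2.toDistribution N m f) :=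
  congrArg Subtype.val <|
    (LinearEquiv.ofInjective _ (WeightedL2.toDistribution_injective N m)).apply_symm_apply _

end

/-! Put s = e^{-t/2} and γ = m - N/2. The semigroup e^{tℒ} is an integral operator with the Gaussian
kernel `mehler`, and the right part of the spectrum is read off from its behaviour as s → 0, that is
t → ∞. The kernel is analytic in s near 0; its k-th Taylor coefficient is Gaussian in ξ and grows at
most like (1 + |y|)^k in y, so it acts boundedly on L²(m) when k < γ. This gives S(s) = ∑_{k<γ} s^k
P_k + O(s^β) for every β < γ (`exists_norm_semigroupL_sub_sum_le`).

Formally the resolvent is the Laplace transform 2 ∫₀¹ s^{2z-1} S(s) ds. The terms s^k P_k contribute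
(z + k/2)⁻¹ P_k, and the remainder has a Mellin transform holomorphic for Re z > -γ/2 = N/4 - m/2.
In that half-plane only the simple poles -k/2 are left, with residues P_k
(`IsExpandingSemigroup.isResolventAt`, `IsExpandingSemigroup.rieszProjection_eq`). Uniqueness of the
expansion identifies the range of P_k with the kernel of ℒ + k/2
(`IsExpandingSemigroup.eigenspace_eq_range`), so the two multiplicities agree.

For Re z < N/4 - m/2 there is a family v(s), s > 0, of Schwartz functions with S(r) v(s) = v(rs);
its Mellin transform at 2z is an eigenvector for z (`isEigenvalue_of_re_lt`). The boundary line
follows since limits of eigenvalues are spectral.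

The Fourier transform of an eigenvector for -k/2 with k < γ is a homogeneous polynomial of degree k
times a fixed Gaussian, which gives the dimension (`rank_eigenspace_opL`).

No strong continuity of the semigroup is used. All identities are tested against the functionals x ↦
∫ x 𝓕ψ, on which the transposes of ℒ and of the semigroup act by explicit formulas (`dualL`,
`dualS`). `IsExpandingSemigroup` isolates what the abstract argument needs; its factor -2/s reflects
d/dt = -(s/2) d/ds. -/

noncomputable section

/-! ### General facts on resolvents and eigenspaces -/

namespace UnboundedOp

open Filter Topology

variable {X : Type*} [NormedAddCommGroup X] [NormedSpace ℂ X] {A : X →ₗ.[ℂ] X}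

theorem mem_eigenspace_iff {z : ℂ} {u : X} :
    u ∈ eigenspace A z ↔ ∃ h : u ∈ A.domain, A ⟨u, h⟩ = z • u := by
  simp only [eigenspace, Submodule.mem_map, LinearMap.mem_ker, LinearMap.sub_apply,
    LinearMap.smul_apply, Submodule.subtype_apply, sub_eq_zero]
  constructor
  · rintro ⟨⟨v, hv⟩, h, rfl⟩
    exact ⟨hv, h⟩
  · rintro ⟨h, h'⟩
    exact ⟨⟨u, h⟩, h', rfl⟩

/-- Resolvent identity, from applying R to (z - A) T x = x + (z - w) T x. Both uniqueness and
continuity of the resolvent follow from it. -/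
theorem IsResolventAt.resolvent_sub {z w : ℂ} {R T : X →L[ℂ] X} (hR : IsResolventAt A z R)
    (hT : IsResolventAt A w T) (x : X) : T x - R x = (z - w) • R (T x) := by
  obtain ⟨h, hx⟩ := hT.1 x
  have h2 := hR.2 ⟨T x, h⟩
  have h3 : z • T x - A ⟨T x, h⟩ = x + (z - w) • T x := by
    rw [sub_eq_iff_eq_add] at hx
    rw [sub_smul]
    rw [hx]
    abel
  simp only [h3, map_add, map_smul] at h2
  rw [sub_eq_iff_eq_add', h2]

theorem IsResolventAt.unique {z : ℂ} {R T : X →L[ℂ] X} (hR : IsResolventAt A z R)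
    (hT : IsResolventAt A z T) : T = R := by
  ext x
  simpa [sub_eq_zero] using hR.resolvent_sub hT x

theorem isResolventAt_resolvent {z : ℂ} (hz : z ∈ resolventSet A) :
    IsResolventAt A z (resolvent A z) := by
  have h : ∃ R : X →L[ℂ] X, IsResolventAt A z R := hz
  rw [resolvent, dif_pos h]
  exact h.choose_spec

theorem IsResolventAt.resolvent_eq {z : ℂ} {R : X →L[ℂ] X} (hR : IsResolventAt A z R) :
    resolvent A z = R :=
  hR.unique (isResolventAt_resolvent ⟨R, hR⟩)

/-- Serves only to make the resolvent integrable over circles. For |w - z| ‖R‖ ≤ 1/2 the resolvent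
identity absorbs the unknown norm ‖T‖ into 2‖R‖. -/
theorem continuousOn_resolvent : ContinuousOn (resolvent A) (resolventSet A) := by
  intro z hz
  have hR := isResolventAt_resolvent hz
  set R := resolvent A z with hRdef
  have key : ∀ w ∈ resolventSet A, ‖w - z‖ * ‖R‖ ≤ 1 / 2 →
      ‖resolvent A w - R‖ ≤ 2 * ‖R‖ ^ 2 * ‖w - z‖ := by
    intro w hw hwz
    have hT := isResolventAt_resolvent hw
    set T := resolvent A w
    have h1 : T - R = (z - w) • (R.comp T) := by
      ext x
      simpa using hR.resolvent_sub hT x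
    have h2 : ‖T - R‖ ≤ ‖w - z‖ * (‖R‖ * ‖T‖) := by
      rw [h1, norm_smul, norm_sub_rev]
      gcongr
      exact ContinuousLinearMap.opNorm_comp_le _ _
    have h3 : ‖T‖ ≤ ‖R‖ + ‖T - R‖ := by
      simpa using norm_add_le R (T - R)
    have h4 : ‖T‖ ≤ 2 * ‖R‖ := by nlinarith [norm_nonneg T, norm_nonneg R, norm_nonneg (w - z)]
    calc ‖T - R‖ ≤ ‖w - z‖ * (‖R‖ * ‖T‖) := h2
      _ ≤ ‖w - z‖ * (‖R‖ * (2 * ‖R‖)) := by gcongr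
      _ = _ := by ring
  rw [ContinuousWithinAt, tendsto_iff_norm_sub_tendsto_zero]
  have hlim : Tendsto (fun w => ‖w - z‖) (𝓝[resolventSet A] z) (𝓝 0) := by
    have : Tendsto (fun w => ‖w - z‖) (𝓝 z) (𝓝 ‖z - z‖) := by
      apply Continuous.tendsto; fun_prop
    rw [sub_self, norm_zero] at this
    exact this.mono_left nhdsWithin_le_nhds
  have hev : ∀ᶠ w in 𝓝[resolventSet A] z, ‖w - z‖ * ‖R‖ ≤ 1 / 2 := by
    have := hlim.mul_const ‖R‖
    rw [zero_mul] at this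
    exact this.eventually (Iic_mem_nhds (by norm_num))
  refine squeeze_zero' (.of_forall fun _ => norm_nonneg _)
    (g := fun w => 2 * ‖R‖ ^ 2 * ‖w - z‖) ?_ ?_
  · filter_upwards [hev, self_mem_nhdsWithin] with w h1 h2 using key w h2 h1
  · simpa using hlim.const_mul (2 * ‖R‖ ^ 2)

/-- A limit of eigenvalues belongs to the spectrum. -/
theorem mem_spectrum_of_mem_closure_eigenvalues {z : ℂ}
    (hz : z ∈ closure {w | IsEigenvalue A w}) : z ∈ spectrum A := by
  rintro ⟨R, hR⟩
  -- An eigenvalue w with eigenvector u gives (z - w) R u = u, hence 1 ≤ |z - w| ‖R‖. This radius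
  -- contradicts that, also when R = 0.
  obtain ⟨w, hw, hzw⟩ := Metric.mem_closure_iff.1 hz (1 / (‖R‖ + 1)) (by positivity)
  obtain ⟨u, hu, hu0⟩ := Submodule.exists_mem_ne_zero_of_ne_bot hw
  obtain ⟨hd, hAu⟩ := mem_eigenspace_iff.1 hu
  have h := hR.2 ⟨u, hd⟩
  simp only [hAu, ← sub_smul, map_smul] at h
  have h2 : ‖u‖ ≤ dist z w * (‖R‖ * ‖u‖) := by
    conv_lhs => rw [← h]
    rw [norm_smul, dist_eq_norm]
    gcongr
    exact R.le_opNorm u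
  have hu0 : 0 < ‖u‖ := norm_pos_iff.2 hu0
  have h3 : 1 ≤ dist z w * ‖R‖ := by
    by_contra! hlt
    nlinarith
  rw [lt_div_iff₀ (by positivity)] at hzw
  nlinarith [dist_nonneg (x := z) (y := w)]

end UnboundedOp

/-! ### Spectral theory of a generator from an asymptotic expansion of its semigroup -/

section Expansion

open Filter Topology Set Asymptotics

/-- Uniqueness of asymptotic expansions: once the lower coefficients vanish, dividing by s^k and
letting s → 0 isolates c k. -/
theorem eq_zero_of_sum_pow_smul_isLittleO {E : Type*} [NormedAddCommGroup E] [NormedSpace ℂ E]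
    {M : ℕ} {c : ℕ → E}
    (h : ∀ k < M, (fun s : ℝ => ∑ j ∈ Finset.range M, (s : ℂ) ^ j • c j) =o[𝓝[>] 0]
      fun s : ℝ => s ^ k) :
    ∀ k < M, c k = 0 := by
  intro k
  induction k using Nat.strong_induction_on with
  | _ k ih =>
    intro hk
    -- The truncated exponent j - k is wrong only for j < k, where c j = 0 by induction.
    have h1 : Tendsto (fun s : ℝ => ∑ j ∈ Finset.range M, (s : ℂ) ^ (j - k) • c j) (𝓝[>] 0)
        (𝓝 (c k)) := by
      have : Continuous fun s : ℝ => ∑ j ∈ Finset.range M, (s : ℂ) ^ (j - k) • c j := by fun_prop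
      have h0 := this.tendsto 0
      have : ∑ j ∈ Finset.range M, ((0 : ℝ) : ℂ) ^ (j - k) • c j = c k := by
        rw [Finset.sum_eq_single k]
        · simp
        · intro j hj hjk
          rcases lt_or_gt_of_ne hjk with h' | h'
          · rw [ih j h' (by simpa using hj), smul_zero]
          · rw [Complex.ofReal_zero, zero_pow (by omega), zero_smul]
        · intro h'; simp at h'; omega
      rw [this] at h0
      exact h0.mono_left nhdsWithin_le_nhds
    have h2 : Tendsto (fun s : ℝ => ∑ j ∈ Finset.range M, (s : ℂ) ^ (j - k) • c j) (𝓝[>] 0)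
        (𝓝 0) := by
      have h3 := (h k hk).norm_norm.tendsto_div_nhds_zero
      refine tendsto_zero_iff_norm_tendsto_zero.2 (h3.congr' ?_)
      filter_upwards [self_mem_nhdsWithin] with s (hs : 0 < s)
      have : ∑ j ∈ Finset.range M, (s : ℂ) ^ j • c j =
          (s : ℂ) ^ k • ∑ j ∈ Finset.range M, (s : ℂ) ^ (j - k) • c j := by
        rw [Finset.smul_sum]
        refine Finset.sum_congr rfl fun j hj => ?_
        rcases lt_or_ge j k with h' | h'
        · rw [ih j h' (by simpa using hj)]; simp
        · rw [smul_smul, ← pow_add, Nat.add_sub_cancel' h']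
      rw [this, norm_smul]
      have hp : (0 : ℝ) < s ^ k := by positivity
      simp [abs_of_pos hs]
      field_simp
    exact tendsto_nhds_unique h1 h2

theorem eq_zero_of_norm_sum_pow_smul_le {E : Type*} [NormedAddCommGroup E] [NormedSpace ℂ E]
    {M : ℕ} {c : ℕ → E} {β C : ℝ} (hβ : ∀ k < M, (k : ℝ) < β)
    (h : ∀ s ∈ Ioo (0 : ℝ) 1, ‖∑ j ∈ Finset.range M, (s : ℂ) ^ j • c j‖ ≤ C * s ^ β) :
    ∀ k < M, c k = 0 := by
  refine eq_zero_of_sum_pow_smul_isLittleO fun k hk => ?_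
  have h1 : (fun s : ℝ => ∑ j ∈ Finset.range M, (s : ℂ) ^ j • c j) =O[𝓝[>] 0]
      fun s : ℝ => s ^ β := by
    refine IsBigO.of_bound C ?_
    filter_upwards [Ioo_mem_nhdsGT (zero_lt_one' ℝ)] with s hs
    rw [Real.norm_of_nonneg (Real.rpow_nonneg hs.1.le _)]
    exact h s hs
  refine h1.trans_isLittleO ?_
  have h2 : Tendsto (fun s : ℝ => s ^ (β - k)) (𝓝[>] 0) (𝓝 0) := by
    have := (Real.continuousAt_rpow_const 0 (β - k) (Or.inr (sub_pos.2 (hβ k hk)).le)).tendsto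
    rw [Real.zero_rpow (sub_pos.2 (hβ k hk)).ne'] at this
    exact this.mono_left nhdsWithin_le_nhds
  refine (isLittleO_iff_tendsto' ?_).2 (h2.congr' ?_)
  · filter_upwards [self_mem_nhdsWithin] with s (hs : 0 < s) h0
    exact absurd h0 (by positivity)
  · filter_upwards [self_mem_nhdsWithin] with s (hs : 0 < s)
    rw [Real.rpow_sub hs, Real.rpow_natCast]

/-- `S s = e^{tA}` with `s = e^{-t/2}`, tested weakly against the functionals `ℓ i` with
`ℓ i ∘ A = ℓ (D i)`, and `S s = ∑_{k < γ} s ^ k P k + O(s ^ β)` as `s → 0` for every `β < γ`. -/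
structure IsExpandingSemigroup {X ι : Type*} [NormedAddCommGroup X] [NormedSpace ℂ X]
    (A : X →ₗ.[ℂ] X) (S : ℝ → X →L[ℂ] X) (P : ℕ → X →L[ℂ] X) (γ : ℝ)
    (ℓ : ι → X →L[ℂ] ℂ) (D : ι → ι) : Prop where
  separating : ∀ x, (∀ i, ℓ i x = 0) → x = 0
  graph : ∀ x w, (∃ h : x ∈ A.domain, A ⟨x, h⟩ = w) ↔ ∀ i, ℓ (D i) x = ℓ i w
  hasDerivAt : ∀ x i, ∀ s ∈ Ioo (0 : ℝ) 1,
    HasDerivAt (fun r => ℓ i (S r x)) (-(2 / (s : ℂ)) * ℓ (D i) (S s x)) s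
  commute : ∀ x w, (∀ i, ℓ (D i) x = ℓ i w) → ∀ s ∈ Ioo (0 : ℝ) 1, ∀ i,
    ℓ (D i) (S s x) = ℓ i (S s w)
  tendsto_one : ∀ x i, Tendsto (fun s => ℓ i (S s x)) (𝓝[<] 1) (𝓝 (ℓ i x))
  comp : ∀ x, ∀ r ∈ Ioo (0 : ℝ) 1, ∀ s ∈ Ioo (0 : ℝ) 1, S r (S s x) = S (r * s) x
  measurable : ∀ x, AEStronglyMeasurable (fun s => S s x) (volume.restrict (Ioo 0 1))
  expansion : ∀ β < γ, ∃ C, ∀ s ∈ Ioo (0 : ℝ) 1, ∀ x,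
    ‖S s x - ∑ k ∈ Finset.range ⌈γ⌉₊, (s : ℂ) ^ k • P k x‖ ≤ C * s ^ β * ‖x‖

namespace IsExpandingSemigroup

variable {X ι : Type*} [NormedAddCommGroup X] [NormedSpace ℂ X]
  {A : X →ₗ.[ℂ] X} {S : ℝ → X →L[ℂ] X} {P : ℕ → X →L[ℂ] X} {γ : ℝ}
  {ℓ : ι → X →L[ℂ] ℂ} {D : ι → ι}

theorem eq_of_forall (h : IsExpandingSemigroup A S P γ ℓ D) {x y : X}
    (hxy : ∀ i, ℓ i x = ℓ i y) : x = y :=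
  sub_eq_zero.1 (h.separating _ fun i => by rw [map_sub, hxy, sub_self])

/-- The indices k < ⌈γ⌉₊ are exactly the naturals k < γ, so there is room for an exponent between
the largest of them and γ. There are none if γ ≤ 0. -/
theorem exists_exponent (a : ℝ) (ha : a < γ) :
    ∃ β < γ, a < β ∧ ∀ k < ⌈γ⌉₊, (k : ℝ) < β := by
  rcases Nat.eq_zero_or_pos ⌈γ⌉₊ with h0 | h0
  · obtain ⟨β, h1, h2⟩ := exists_between ha
    exact ⟨β, h2, h1, fun k hk => by omega⟩
  · have h1 : ((⌈γ⌉₊ - 1 : ℕ) : ℝ) < γ := Nat.lt_ceil.1 (by omega)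
    obtain ⟨β, h2, h3⟩ := exists_between (max_lt ha h1)
    refine ⟨β, h3, (le_max_left _ _).trans_lt h2, fun k hk => ?_⟩
    have : (k : ℝ) ≤ ((⌈γ⌉₊ - 1 : ℕ) : ℝ) := by exact_mod_cast (by omega)
    exact this.trans_lt ((le_max_right _ _).trans_lt h2)

/-- S(rs)x has two expansions in s: the one at rs, and S(r) applied to the one at s. Their
coefficients agree. -/
theorem S_P (h : IsExpandingSemigroup A S P γ ℓ D) {r : ℝ} (hr : r ∈ Ioo (0 : ℝ) 1)
    {k : ℕ} (hk : k < ⌈γ⌉₊) (x : X) : S r (P k x) = (r : ℂ) ^ k • P k x := by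
  obtain ⟨β, hβ, -, hβk⟩ := exists_exponent (γ - 1) (sub_one_lt γ)
  obtain ⟨C, hC⟩ := h.expansion β hβ
  have hC0 : 0 ≤ |C| := abs_nonneg C
  have := eq_zero_of_norm_sum_pow_smul_le (M := ⌈γ⌉₊) (β := β)
    (c := fun k => S r (P k x) - (r : ℂ) ^ k • P k x)
    (C := ‖S r‖ * (|C| * ‖x‖) + |C| * r ^ β * ‖x‖) hβk ?_ k hk
  · exact sub_eq_zero.1 this
  intro s hs
  have hrs : r * s ∈ Ioo (0 : ℝ) 1 := ⟨mul_pos hr.1 hs.1, by nlinarith [hr.1, hr.2, hs.1, hs.2]⟩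
  have e : ∑ j ∈ Finset.range ⌈γ⌉₊, (s : ℂ) ^ j • (S r (P j x) - (r : ℂ) ^ j • P j x) =
      (S (r * s) x - ∑ k ∈ Finset.range ⌈γ⌉₊, ((r * s : ℝ) : ℂ) ^ k • P k x) -
      S r (S s x - ∑ k ∈ Finset.range ⌈γ⌉₊, (s : ℂ) ^ k • P k x) := by
    rw [map_sub, h.comp x r hr s hs, map_sum, sub_sub_sub_cancel_left, ← Finset.sum_sub_distrib]
    refine Finset.sum_congr rfl fun j _ => ?_
    rw [map_smul, smul_sub, smul_smul, Complex.ofReal_mul, mul_pow, mul_comm]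
  rw [e]
  refine (norm_sub_le _ _).trans ?_
  have h1 := hC (r * s) hrs x
  have h2 := (S r).le_opNorm_of_le (hC s hs x)
  rw [Real.mul_rpow hr.1.le hs.1.le] at h1
  have hp : 0 ≤ s ^ β := Real.rpow_nonneg hs.1.le _
  have hp' : 0 ≤ r ^ β := Real.rpow_nonneg hr.1.le _
  calc _ ≤ C * (r ^ β * s ^ β) * ‖x‖ + ‖S r‖ * (C * s ^ β * ‖x‖) := add_le_add h1 h2
    _ ≤ |C| * (r ^ β * s ^ β) * ‖x‖ + ‖S r‖ * (|C| * s ^ β * ‖x‖) := by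
        gcongr <;> exact le_abs_self C
    _ = _ := by ring

/-- The same comparison, with S(sr)x expanded at sr and as S(s) acting on S(r)x. -/
theorem P_S (h : IsExpandingSemigroup A S P γ ℓ D) {r : ℝ} (hr : r ∈ Ioo (0 : ℝ) 1)
    {k : ℕ} (hk : k < ⌈γ⌉₊) (x : X) : P k (S r x) = (r : ℂ) ^ k • P k x := by
  obtain ⟨β, hβ, -, hβk⟩ := exists_exponent (γ - 1) (sub_one_lt γ)
  obtain ⟨C, hC⟩ := h.expansion β hβ
  have := eq_zero_of_norm_sum_pow_smul_le (M := ⌈γ⌉₊) (β := β)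
    (c := fun k => P k (S r x) - (r : ℂ) ^ k • P k x)
    (C := C * ‖S r x‖ + C * r ^ β * ‖x‖) hβk ?_ k hk
  · exact sub_eq_zero.1 this
  intro s hs
  have hrs : s * r ∈ Ioo (0 : ℝ) 1 := ⟨mul_pos hs.1 hr.1, by nlinarith [hr.1, hr.2, hs.1, hs.2]⟩
  have e : ∑ j ∈ Finset.range ⌈γ⌉₊, (s : ℂ) ^ j • (P j (S r x) - (r : ℂ) ^ j • P j x) =
      (S (s * r) x - ∑ k ∈ Finset.range ⌈γ⌉₊, ((s * r : ℝ) : ℂ) ^ k • P k x) -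
      (S s (S r x) - ∑ k ∈ Finset.range ⌈γ⌉₊, (s : ℂ) ^ k • P k (S r x)) := by
    rw [h.comp x s hs r hr, sub_sub_sub_cancel_left, ← Finset.sum_sub_distrib]
    refine Finset.sum_congr rfl fun j _ => ?_
    rw [smul_sub, smul_smul, Complex.ofReal_mul, mul_pow]
  rw [e]
  refine (norm_sub_le _ _).trans ?_
  have h1 := hC (s * r) hrs x
  have h2 := hC s hs (S r x)
  rw [Real.mul_rpow hs.1.le hr.1.le] at h1
  calc _ ≤ C * (s ^ β * r ^ β) * ‖x‖ + C * s ^ β * ‖S r x‖ := add_le_add h1 h2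
    _ = _ := by ring

/-- Eigenvectors of the generator are the eigenvectors of the semigroup. -/
theorem mem_eigenspace_iff (h : IsExpandingSemigroup A S P γ ℓ D) {z : ℂ} {u : X} :
    u ∈ UnboundedOp.eigenspace A z ↔
      ∀ s ∈ Ioo (0 : ℝ) 1, S s u = (s : ℂ) ^ (-2 * z) • u := by
  rw [UnboundedOp.mem_eigenspace_iff, h.graph]
  constructor
  · intro hu s hs
    have hcomm := h.commute u (z • u) hu
    refine h.eq_of_forall fun i => ?_
    -- For an eigenvector, r^{2z} ℓ(S r u) is constant on (0,1); the limit r → 1 identifies the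
    -- constant as ℓ u.
    have hder : ∀ r ∈ Ioo (0 : ℝ) 1,
        HasDerivAt (fun r : ℝ => (r : ℂ) ^ (2 * z) * ℓ i (S r u)) 0 r := by
      intro r hr
      have hr0 : (r : ℂ) ≠ 0 := by exact_mod_cast hr.1.ne'
      have h1 := (h.hasDerivAt u i r hr)
      have h2 : HasDerivAt (fun r : ℝ => (r : ℂ) ^ (2 * z)) (2 * z * (r : ℂ) ^ (2 * z - 1)) r := by
        have := (hasDerivAt_id (r : ℂ)).cpow_const (c := 2 * z) (Or.inl (by simpa using hr.1))
        simpa using this.comp_ofReal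
      convert! h2.mul h1 using 1
      rw [hcomm r hr i, map_smul, map_smul, Complex.cpow_sub _ _ hr0, Complex.cpow_one, smul_eq_mul]
      field_simp
      ring
    have hconst : ∀ r ∈ Ioo (0 : ℝ) 1, (r : ℂ) ^ (2 * z) * ℓ i (S r u) =
        (s : ℂ) ^ (2 * z) * ℓ i (S s u) := fun r hr =>
      isOpen_Ioo.is_const_of_deriv_eq_zero isPreconnected_Ioo
        (fun r hr => (hder r hr).differentiableAt.differentiableWithinAt)
        (fun r hr => (hder r hr).deriv) hr hs
    have hlim : Tendsto (fun r : ℝ => (r : ℂ) ^ (2 * z) * ℓ i (S r u)) (𝓝[<] 1) (𝓝 (ℓ i u)) := by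
      have h1 : ContinuousAt (fun r : ℝ => (r : ℂ) ^ (2 * z)) 1 := by
        refine ContinuousAt.cpow ?_ continuousAt_const (by simp)
        exact Complex.continuous_ofReal.continuousAt
      have h2 : Tendsto (fun r : ℝ => (r : ℂ) ^ (2 * z)) (𝓝[<] 1) (𝓝 1) := by
        simpa [ContinuousAt] using h1.tendsto.mono_left nhdsWithin_le_nhds
      simpa using h2.mul (h.tendsto_one u i)
    have hlim2 : Tendsto (fun r : ℝ => (r : ℂ) ^ (2 * z) * ℓ i (S r u)) (𝓝[<] 1)
        (𝓝 ((s : ℂ) ^ (2 * z) * ℓ i (S s u))) := by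
      refine tendsto_const_nhds.congr' ?_
      filter_upwards [Ioo_mem_nhdsLT (zero_lt_one' ℝ)] with r hr using (hconst r hr).symm
    have heq := tendsto_nhds_unique hlim hlim2
    have hs0 : (s : ℂ) ≠ 0 := by exact_mod_cast hs.1.ne'
    rw [map_smul, heq, neg_mul, Complex.cpow_neg, smul_eq_mul, inv_mul_cancel_left₀]
    simp [Complex.cpow_eq_zero_iff, hs0]
  · intro hu i
    -- Conversely, differentiating the power law and comparing with the evolution equation gives the
    -- eigenvalue equation at S s u; s → 1 gives it at u.
    have key : ∀ s ∈ Ioo (0 : ℝ) 1, ℓ (D i) (S s u) = z * ℓ i (S s u) := by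
      intro s hs
      have hs0 : (s : ℂ) ≠ 0 := by exact_mod_cast hs.1.ne'
      have h1 := h.hasDerivAt u i s hs
      have h2 : HasDerivAt (fun r : ℝ => (r : ℂ) ^ (-2 * z) * ℓ i u)
          (-2 * z * (s : ℂ) ^ (-2 * z - 1) * ℓ i u) s := by
        have := (hasDerivAt_id (s : ℂ)).cpow_const (c := -2 * z) (Or.inl (by simpa using hs.1))
        simpa using this.comp_ofReal.mul_const (ℓ i u)
      have h3 := h1.congr_of_eventuallyEq (f₁ := fun r : ℝ => (r : ℂ) ^ (-2 * z) * ℓ i u) (by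
        filter_upwards [isOpen_Ioo.mem_nhds hs] with r hr
        rw [hu r hr, map_smul, smul_eq_mul])
      have h4 := h3.unique h2
      rw [hu s hs, map_smul, map_smul, smul_eq_mul, smul_eq_mul]
      rw [hu s hs, map_smul, smul_eq_mul, Complex.cpow_sub _ _ hs0, Complex.cpow_one] at h4
      rw [neg_mul] at h4 ⊢
      field_simp at h4
      linear_combination (-1 : ℂ) * h4
    have h1 : Tendsto (fun s => ℓ (D i) (S s u)) (𝓝[<] 1) (𝓝 (z * ℓ i u)) := by
      refine ((h.tendsto_one u i).const_mul z).congr' ?_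
      filter_upwards [Ioo_mem_nhdsLT (zero_lt_one' ℝ)] with r hr using (key r hr).symm
    rw [tendsto_nhds_unique (h.tendsto_one u (D i)) h1, map_smul, smul_eq_mul]

/-! ### The remainder of the expansion, its Mellin transform and the resolvent -/

/-- The remainder `S s x - ∑_{k < γ} s ^ k P k x` of the expansion, cut off to `0 < s < 1`. -/
def remainder (S : ℝ → X →L[ℂ] X) (P : ℕ → X →L[ℂ] X) (γ : ℝ) (x : X) : ℝ → X :=
  indicator (Ioo 0 1) fun s => S s x - ∑ k ∈ Finset.range ⌈γ⌉₊, (s : ℂ) ^ k • P k x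

theorem aestronglyMeasurable_remainder (h : IsExpandingSemigroup A S P γ ℓ D) (x : X) :
    AEStronglyMeasurable (remainder S P γ x) := by
  unfold remainder
  rw [aestronglyMeasurable_indicator_iff measurableSet_Ioo]
  refine (h.measurable x).sub (Continuous.aestronglyMeasurable ?_)
  fun_prop

theorem norm_remainder_le (h : IsExpandingSemigroup A S P γ ℓ D) {β : ℝ} (hβ : β < γ) :
    ∃ C, 0 ≤ C ∧ ∀ x, ∀ s > 0, ‖remainder S P γ x s‖ ≤ C * s ^ β * ‖x‖ := by
  obtain ⟨C, hC⟩ := h.expansion β hβ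
  refine ⟨|C|, abs_nonneg C, fun x s hs => ?_⟩
  by_cases hs1 : s ∈ Ioo (0 : ℝ) 1
  · rw [remainder, indicator_of_mem hs1]
    have := hC s hs1 x
    have hp : 0 ≤ s ^ β := Real.rpow_nonneg hs.le _
    refine this.trans ?_
    gcongr
    exact le_abs_self C
  · rw [remainder, indicator_of_notMem hs1, norm_zero]
    positivity

theorem remainder_eq_zero {x : X} {s : ℝ} (hs : 1 ≤ s) : remainder S P γ x s = 0 :=
  indicator_of_notMem (fun h => absurd h.2 (not_lt.2 hs)) _

theorem locallyIntegrableOn_remainder (h : IsExpandingSemigroup A S P γ ℓ D) (x : X) :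
    LocallyIntegrableOn (remainder S P γ x) (Ioi 0) := by
  obtain ⟨C, -, hC⟩ := h.norm_remainder_le (sub_one_lt γ)
  have h1 : LocallyIntegrableOn (fun s : ℝ => C * s ^ (γ - 1) * ‖x‖) (Ioi 0) := by
    refine ContinuousOn.locallyIntegrableOn ?_ measurableSet_Ioi
    intro s hs
    have := (Real.continuousAt_rpow_const s (γ - 1) (Or.inl (ne_of_gt hs)))
    exact ((this.const_mul C).mul_const _).continuousWithinAt
  rw [locallyIntegrableOn_iff (isOpen_Ioi.isLocallyClosed)] at h1 ⊢
  intro k hk hkc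
  refine (h1 k hk hkc).mono' (h.aestronglyMeasurable_remainder x).restrict ?_
  rw [ae_restrict_iff' hkc.measurableSet]
  exact .of_forall fun s hs => hC x s (hk hs)

theorem isBigO_remainder_atTop (x : X) (a : ℝ) :
    remainder S P γ x =O[atTop] fun s : ℝ => s ^ (-a) := by
  refine IsBigO.of_bound 0 ?_
  filter_upwards [eventually_ge_atTop 1] with s hs
  rw [remainder_eq_zero hs]
  simp

theorem isBigO_remainder_zero (h : IsExpandingSemigroup A S P γ ℓ D) (x : X) {b : ℝ}
    (hb : -γ < b) : remainder S P γ x =O[𝓝[>] 0] fun s : ℝ => s ^ (-b) := by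
  obtain ⟨C, -, hC⟩ := h.norm_remainder_le (β := -b) (by linarith)
  refine IsBigO.of_bound (C * ‖x‖) ?_
  filter_upwards [self_mem_nhdsWithin] with s (hs : 0 < s)
  rw [Real.norm_of_nonneg (Real.rpow_nonneg hs.le _)]
  linarith [hC x s hs]

theorem mellinConvergent_remainder (h : IsExpandingSemigroup A S P γ ℓ D) (x : X) {z : ℂ}
    (hz : -γ < z.re) : MellinConvergent (remainder S P γ x) z := by
  obtain ⟨b, hb1, hb2⟩ := exists_between hz
  exact mellinConvergent_of_isBigO_rpow (h.locallyIntegrableOn_remainder x)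
    (isBigO_remainder_atTop x (z.re + 1)) (lt_add_one _) (h.isBigO_remainder_zero x hb1) hb2

theorem differentiableAt_mellin_remainder [CompleteSpace X]
    (h : IsExpandingSemigroup A S P γ ℓ D) (x : X) {z : ℂ}
    (hz : -γ < z.re) : DifferentiableAt ℂ (mellin (remainder S P γ x)) z := by
  obtain ⟨b, hb1, hb2⟩ := exists_between hz
  exact mellin_differentiableAt_of_isBigO_rpow (h.locallyIntegrableOn_remainder x)
    (isBigO_remainder_atTop x (z.re + 1)) (lt_add_one _) (h.isBigO_remainder_zero x hb1) hb2

/-- With -Re z < β < γ the integrand is dominated by a multiple of s^{Re z - 1 + β} ‖x‖, integrable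
on (0,1). Uniformity in x makes the Mellin transform a bounded operator. -/
theorem norm_mellin_remainder_le (h : IsExpandingSemigroup A S P γ ℓ D) {z : ℂ}
    (hz : -γ < z.re) : ∃ C, ∀ x, ‖mellin (remainder S P γ x) z‖ ≤ C * ‖x‖ := by
  obtain ⟨β, hβ1, hβ2⟩ := exists_between (neg_lt.1 hz)
  obtain ⟨C, hC0, hC⟩ := h.norm_remainder_le hβ2
  have hint : IntegrableOn (fun s : ℝ => s ^ (z.re - 1 + β)) (Ioo 0 1) :=
    (intervalIntegral.integrableOn_Ioo_rpow_iff zero_lt_one).2 (by linarith)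
  have hint' : Integrable ((Ioo (0 : ℝ) 1).indicator fun s : ℝ => s ^ (z.re - 1 + β)) :=
    (integrable_indicator_iff measurableSet_Ioo).2 hint
  refine ⟨C * ∫ s in Ioi 0, (Ioo (0 : ℝ) 1).indicator (fun s : ℝ => s ^ (z.re - 1 + β)) s,
    fun x => ?_⟩
  rw [mul_right_comm, ← integral_const_mul]
  refine norm_integral_le_of_norm_le (hint'.integrableOn.const_mul _) ?_
  rw [ae_restrict_iff' measurableSet_Ioi]
  refine .of_forall fun s (hs : 0 < s) => ?_
  rw [norm_smul, Complex.norm_cpow_eq_rpow_re_of_pos hs]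
  by_cases hs1 : s ∈ Ioo (0 : ℝ) 1
  · rw [indicator_of_mem hs1, Real.rpow_add hs]
    have := hC x s hs
    have hp : 0 ≤ s ^ (z.re - 1) := Real.rpow_nonneg hs.le _
    simp only [Complex.sub_re, Complex.one_re]
    nlinarith
  · rw [indicator_of_notMem hs1, remainder, indicator_of_notMem hs1]
    simp

/-- The part `2 ∫₀¹ s ^ (2z - 1) (S s - ∑_{k < γ} s ^ k P k) ds` of the resolvent that is
holomorphic for `Re z > -γ / 2`. -/
def regularPart (h : IsExpandingSemigroup A S P γ ℓ D) (z : ℂ) (hz : -γ < (2 * z).re) :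
    X →L[ℂ] X :=
  LinearMap.mkContinuousOfExistsBound
    { toFun := fun x => (2 : ℂ) • mellin (remainder S P γ x) (2 * z)
      map_add' := fun x y => by
        have : remainder S P γ (x + y) = fun s => remainder S P γ x s + remainder S P γ y s := by
          ext s
          by_cases hs : s ∈ Ioo (0 : ℝ) 1
          · simp only [remainder, indicator_of_mem hs, map_add, smul_add, Finset.sum_add_distrib]
            abel
          · simp [remainder, indicator_of_notMem hs]
        rw [← smul_add, this, mellin, mellin, mellin,
          ← integral_add (h.mellinConvergent_remainder x hz) (h.mellinConvergent_remainder y hz)]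
        simp only [smul_add]
      map_smul' := fun c x => by
        have : remainder S P γ (c • x) = fun s => c • remainder S P γ x s := by
          ext s
          by_cases hs : s ∈ Ioo (0 : ℝ) 1
          · simp only [remainder, indicator_of_mem hs, map_smul, smul_sub, Finset.smul_sum]
            congr 1
            exact Finset.sum_congr rfl fun _ _ => smul_comm _ _ _
          · simp [remainder, indicator_of_notMem hs]
        rw [this, mellin_const_smul, RingHom.id_apply, smul_comm] }
    (by
      obtain ⟨C, hC⟩ := h.norm_mellin_remainder_le hz
      refine ⟨2 * C, fun x => ?_⟩
      have := hC x
      simp only [LinearMap.coe_mk, AddHom.coe_mk, norm_smul, Complex.norm_ofNat]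
      linarith)

theorem regularPart_apply (h : IsExpandingSemigroup A S P γ ℓ D) (z : ℂ) (hz : -γ < (2 * z).re)
    (x : X) : h.regularPart z hz x = (2 : ℂ) • mellin (remainder S P γ x) (2 * z) := rfl

/-- By `S_P` the semigroup acts on P k x as s^k = s^{-2z} with z = -k/2. -/
theorem P_graph (h : IsExpandingSemigroup A S P γ ℓ D) {k : ℕ} (hk : k < ⌈γ⌉₊) (x : X) (i : ι) :
    ℓ (D i) (P k x) = -(k : ℂ) / 2 * ℓ i (P k x) := by
  have h1 : P k x ∈ UnboundedOp.eigenspace A (-(k : ℂ) / 2) := by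
    rw [h.mem_eigenspace_iff]
    intro s hs
    rw [h.S_P hs hk, show -2 * (-(k : ℂ) / 2) = k by ring, Complex.cpow_natCast]
  rw [UnboundedOp.mem_eigenspace_iff, h.graph] at h1
  simpa using h1 i

/-- Integrate the derivative of s^{2z} ℓ_i(r(s)) over (0,1), r being the remainder. It satisfies the
same evolution equation as the orbit, because each s^k P k x does. The boundary term at 0 vanishes,
and the one at 1 is the right-hand side. -/
theorem regularPart_graph [CompleteSpace X] (h : IsExpandingSemigroup A S P γ ℓ D) {z : ℂ}
    (hz : -γ < (2 * z).re) (x : X) (i : ι) :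
    z * ℓ i (h.regularPart z hz x) - ℓ (D i) (h.regularPart z hz x) =
      ℓ i (x - ∑ k ∈ Finset.range ⌈γ⌉₊, P k x) := by
  set r := remainder S P γ x with hr
  have hval : ∀ j, ℓ j (h.regularPart z hz x) =
      ∫ s in (0 : ℝ)..1, 2 * ((s : ℂ) ^ (2 * z - 1) * ℓ j (r s)) := by
    intro j
    have hc := h.mellinConvergent_remainder x hz
    rw [regularPart_apply, map_smul, mellin, ← ContinuousLinearMap.integral_comp_comm _ hc,
      intervalIntegral.integral_of_le zero_le_one, integral_const_mul, smul_eq_mul]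
    congr 1
    simp only [map_smul, smul_eq_mul]
    refine setIntegral_eq_of_subset_of_forall_sdiff_eq_zero measurableSet_Ioi
      (fun _ hs => hs.1) ?_
    · rintro s ⟨hs0, hs1⟩
      have : 1 ≤ s := by
        by_contra! hlt
        exact hs1 ⟨hs0, hlt.le⟩
      rw [remainder_eq_zero this, map_zero, mul_zero]
  have hint : ∀ j, IntervalIntegrable (fun s : ℝ => 2 * ((s : ℂ) ^ (2 * z - 1) * ℓ j (r s)))
      volume 0 1 := by
    intro j
    have hc : IntegrableOn (fun s : ℝ => (s : ℂ) ^ (2 * z - 1) • r s) (Ioi 0) :=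
      h.mellinConvergent_remainder x hz
    have := ((ℓ j).integrable_comp hc).const_mul 2
    simp only [map_smul, smul_eq_mul] at this
    rw [intervalIntegrable_iff_integrableOn_Ioc_of_le zero_le_one]
    exact IntegrableOn.mono_set this Ioc_subset_Ioi_self
  have hrs : ∀ s ∈ Ioo (0 : ℝ) 1, ∀ j, ℓ j (r s) =
      ℓ j (S s x) - ∑ k ∈ Finset.range ⌈γ⌉₊, (s : ℂ) ^ k * ℓ j (P k x) := by
    intro s hs j
    simp only [hr, remainder, indicator_of_mem hs, map_sub, map_sum, map_smul, smul_eq_mul]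
  have hder : ∀ s ∈ Ioo (0 : ℝ) 1, HasDerivAt (fun s : ℝ => (s : ℂ) ^ (2 * z) * ℓ i (r s))
      (z * (2 * ((s : ℂ) ^ (2 * z - 1) * ℓ i (r s))) -
        2 * ((s : ℂ) ^ (2 * z - 1) * ℓ (D i) (r s))) s := by
    intro s hs
    have hs0 : (s : ℂ) ≠ 0 := by exact_mod_cast hs.1.ne'
    have h2 : HasDerivAt (fun r : ℝ => (r : ℂ) ^ (2 * z)) (2 * z * (s : ℂ) ^ (2 * z - 1)) s := by
      have := (hasDerivAt_id (s : ℂ)).cpow_const (c := 2 * z) (Or.inl (by simpa using hs.1))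
      simpa using this.comp_ofReal
    have hp : ∀ k : ℕ, HasDerivAt (fun r : ℝ => (r : ℂ) ^ k * ℓ i (P k x))
        (k * (s : ℂ) ^ (k - 1) * ℓ i (P k x)) s := fun k =>
      ((hasDerivAt_pow k (s : ℂ)).comp_ofReal).mul_const _
    have h3 : HasDerivAt (fun s : ℝ => ℓ i (r s)) (-(2 / (s : ℂ)) * ℓ (D i) (r s)) s := by
      have h4 := (h.hasDerivAt x i s hs).sub
        (HasDerivAt.fun_sum (u := Finset.range ⌈γ⌉₊) fun k _ => hp k)
      have h5 := h4.congr_of_eventuallyEq (f₁ := fun s : ℝ => ℓ i (r s)) (by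
        filter_upwards [isOpen_Ioo.mem_nhds hs] with t ht
        rw [hrs t ht]
        rfl)
      convert! h5 using 1
      rw [hrs s hs, mul_sub, Finset.mul_sum]
      congr 1
      refine Finset.sum_congr rfl fun k hk => ?_
      rw [h.P_graph (Finset.mem_range.1 hk)]
      -- k = 0 is separate because s^(k - 1) then has a truncated exponent.
      rcases Nat.eq_zero_or_pos k with rfl | hk0
      · simp
      · obtain ⟨l, rfl⟩ : ∃ l, k = l + 1 := ⟨k - 1, by omega⟩
        rw [Nat.add_sub_cancel, pow_succ]
        field_simp
    convert! h2.mul h3 using 1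
    rw [Complex.cpow_sub _ _ hs0, Complex.cpow_one]
    field_simp
    ring
  have hone : Tendsto (fun s : ℝ => (s : ℂ) ^ (2 * z) * ℓ i (r s)) (𝓝[<] 1)
      (𝓝 (ℓ i (x - ∑ k ∈ Finset.range ⌈γ⌉₊, P k x))) := by
    have h1 : Tendsto (fun s : ℝ => (s : ℂ) ^ (2 * z)) (𝓝[<] 1) (𝓝 1) := by
      have h1 : ContinuousAt (fun r : ℝ => (r : ℂ) ^ (2 * z)) 1 := by
        refine ContinuousAt.cpow ?_ continuousAt_const (by simp)
        exact Complex.continuous_ofReal.continuousAt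
      simpa [ContinuousAt] using h1.tendsto.mono_left nhdsWithin_le_nhds
    have h2 : Tendsto (fun s : ℝ => ∑ k ∈ Finset.range ⌈γ⌉₊, (s : ℂ) ^ k * ℓ i (P k x)) (𝓝[<] 1)
        (𝓝 (∑ k ∈ Finset.range ⌈γ⌉₊, ℓ i (P k x))) := by
      have : Continuous fun s : ℝ => ∑ k ∈ Finset.range ⌈γ⌉₊, (s : ℂ) ^ k * ℓ i (P k x) := by
        fun_prop
      simpa using (this.tendsto 1).mono_left nhdsWithin_le_nhds
    have h3 := h1.mul ((h.tendsto_one x i).sub h2)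
    rw [one_mul, ← map_sum, ← map_sub] at h3
    refine h3.congr' ?_
    filter_upwards [Ioo_mem_nhdsLT (zero_lt_one' ℝ)] with t ht
    rw [hrs t ht]
  have hzero : Tendsto (fun s : ℝ => (s : ℂ) ^ (2 * z) * ℓ i (r s)) (𝓝[>] 0) (𝓝 0) := by
    -- An exponent β < γ with Re 2z + β > 0 makes s^{2z} times the remainder tend to 0.
    obtain ⟨β, hβ1, hβ2⟩ := exists_between (neg_lt.1 hz)
    obtain ⟨C, hC0, hC⟩ := h.norm_remainder_le hβ2
    have h2 : Tendsto (fun s : ℝ => ‖ℓ i‖ * (C * ‖x‖) * s ^ ((2 * z).re + β)) (𝓝[>] 0) (𝓝 0) := by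
      have hpos : 0 < (2 * z).re + β := by linarith
      have := (Real.continuousAt_rpow_const 0 _ (Or.inr hpos.le)).tendsto
      rw [Real.zero_rpow hpos.ne'] at this
      simpa using (this.mono_left nhdsWithin_le_nhds).const_mul (‖ℓ i‖ * (C * ‖x‖))
    refine squeeze_zero_norm' ?_ h2
    filter_upwards [self_mem_nhdsWithin] with s (hs : 0 < s)
    rw [norm_mul, Complex.norm_cpow_eq_rpow_re_of_pos hs, Real.rpow_add hs]
    have h3 := (ℓ i).le_opNorm_of_le (hC x s hs)
    calc _ ≤ s ^ (2 * z).re * (‖ℓ i‖ * (C * s ^ β * ‖x‖)) := by gcongr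
      _ = _ := by ring
  have hI := intervalIntegral.integral_eq_sub_of_hasDerivAt_of_tendsto zero_lt_one hder
    (((hint i).const_mul z).sub (hint (D i))) hzero hone
  rw [intervalIntegral.integral_sub ((hint i).const_mul z) (hint (D i)),
    intervalIntegral.integral_const_mul, sub_zero] at hI
  rw [hval i, hval (D i), hI]

/-- The generator has no eigenvector outside the ranges of the `P k` for `Re z > -γ / 2`. -/
theorem eq_sum_P_of_mem_eigenspace (h : IsExpandingSemigroup A S P γ ℓ D) {z : ℂ}
    (hz : -γ < (2 * z).re) {u : X} (hu : u ∈ UnboundedOp.eigenspace A z) (T : Finset ℕ)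
    (hT : T ⊆ Finset.range ⌈γ⌉₊) (hTz : ∀ k ∈ T, z = -(k : ℂ) / 2)
    (hT' : ∀ k ∈ Finset.range ⌈γ⌉₊, k ∉ T → z ≠ -(k : ℂ) / 2) : u = ∑ k ∈ T, P k u := by
  rw [h.mem_eigenspace_iff] at hu
  -- P k S(s) u equals s^{-2z} P k u by the eigenvalue equation and s^k P k u by `P_S`, so P k u = 0
  -- unless the exponents agree.
  have hP : ∀ k ∈ Finset.range ⌈γ⌉₊, k ∉ T → P k u = 0 := by
    intro k hk hkT
    by_contra hne
    have h1 : ∀ s ∈ Ioo (0 : ℝ) 1, (s : ℂ) ^ (-2 * z) = (s : ℂ) ^ (k : ℂ) := by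
      intro s hs
      have h2 := h.P_S hs (Finset.mem_range.1 hk) u
      rw [hu s hs, map_smul, ← Complex.cpow_natCast] at h2
      exact smul_left_injective ℂ hne h2
    -- Equal powers at one base would not determine complex exponents; equal logarithmic
    -- derivatives, here taken at 1/2, do.
    have h2 : HasDerivAt (fun s : ℝ => (s : ℂ) ^ (-2 * z))
        (-2 * z * ((1 / 2 : ℝ) : ℂ) ^ (-2 * z - 1)) (1 / 2 : ℝ) := by
      have := (hasDerivAt_id (((1 / 2 : ℝ)) : ℂ)).cpow_const (c := -2 * z)
        (Or.inl (by norm_num))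
      simpa using this.comp_ofReal
    have h3 : HasDerivAt (fun s : ℝ => (s : ℂ) ^ (k : ℂ))
        (k * ((1 / 2 : ℝ) : ℂ) ^ ((k : ℂ) - 1)) (1 / 2 : ℝ) := by
      have := (hasDerivAt_id (((1 / 2 : ℝ)) : ℂ)).cpow_const (c := (k : ℂ))
        (Or.inl (by norm_num))
      simpa using this.comp_ofReal
    have hmem : (1 / 2 : ℝ) ∈ Ioo (0 : ℝ) 1 := by norm_num
    have h4 := h2.unique (h3.congr_of_eventuallyEq (by
      filter_upwards [isOpen_Ioo.mem_nhds hmem] with t ht using h1 t ht))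
    have hne0 : (((1 / 2 : ℝ)) : ℂ) ≠ 0 := by norm_num
    rw [Complex.cpow_sub _ _ hne0, Complex.cpow_sub _ _ hne0, h1 _ hmem] at h4
    have hne1 : (((1 / 2 : ℝ)) : ℂ) ^ (k : ℂ) / (((1 / 2 : ℝ)) : ℂ) ^ (1 : ℂ) ≠ 0 := by
      simp
    have h5 := mul_right_cancel₀ hne1 h4
    refine hT' k hk hkT ?_
    linear_combination (-1 / 2 : ℂ) * h5
  obtain ⟨β, hβ1, hβ2⟩ := exists_between (neg_lt.1 hz)
  obtain ⟨C, hC⟩ := h.expansion β hβ2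
  -- Only terms with s^k = s^{-2z} survive, so the expansion of S(s)u = s^{-2z} u factors;
  -- multiplying by s^{2z} leaves an error O(s^{Re 2z + β}), which tends to 0.
  have key : ∀ s ∈ Ioo (0 : ℝ) 1, ‖u - ∑ k ∈ T, P k u‖ ≤ C * ‖u‖ * s ^ ((2 * z).re + β) := by
    intro s hs
    have h1 := hC s hs u
    have h2 : ∑ k ∈ Finset.range ⌈γ⌉₊, (s : ℂ) ^ k • P k u =
        (s : ℂ) ^ (-2 * z) • ∑ k ∈ T, P k u := by
      rw [Finset.smul_sum, ← Finset.sum_subset hT fun k hk hkT => by rw [hP k hk hkT, smul_zero]]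
      refine Finset.sum_congr rfl fun k hk => ?_
      rw [hTz k hk, show -2 * (-(k : ℂ) / 2) = k by ring, Complex.cpow_natCast]
    rw [h2, hu s hs, ← smul_sub, norm_smul, Complex.norm_cpow_eq_rpow_re_of_pos hs.1] at h1
    have h3 : (-2 * z).re = -(2 * z).re := by simp
    rw [h3, Real.rpow_neg hs.1.le, inv_mul_le_iff₀ (Real.rpow_pos_of_pos hs.1 _)] at h1
    rw [Real.rpow_add hs.1]
    linarith
  have hlim : Tendsto (fun s : ℝ => C * ‖u‖ * s ^ ((2 * z).re + β)) (𝓝[>] 0) (𝓝 0) := by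
    have hpos : 0 < (2 * z).re + β := by linarith
    have := (Real.continuousAt_rpow_const 0 _ (Or.inr hpos.le)).tendsto
    rw [Real.zero_rpow hpos.ne'] at this
    simpa using (this.mono_left nhdsWithin_le_nhds).const_mul (C * ‖u‖)
  have h0 : ‖u - ∑ k ∈ T, P k u‖ ≤ 0 := by
    refine ge_of_tendsto hlim ?_
    filter_upwards [Ioo_mem_nhdsGT (zero_lt_one' ℝ)] with s hs using key s hs
  exact sub_eq_zero.1 (norm_le_zero_iff.1 h0)

/-- The resolvent of the generator. -/
theorem isResolventAt [CompleteSpace X] (h : IsExpandingSemigroup A S P γ ℓ D) {z : ℂ}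
    (hz : -γ < (2 * z).re) (hzk : ∀ k < ⌈γ⌉₊, z ≠ -(k : ℂ) / 2) :
    UnboundedOp.IsResolventAt A z
      (∑ k ∈ Finset.range ⌈γ⌉₊, (z + k / 2)⁻¹ • P k + h.regularPart z hz) := by
  set R := ∑ k ∈ Finset.range ⌈γ⌉₊, (z + k / 2 : ℂ)⁻¹ • P k + h.regularPart z hz with hR
  have hRx : ∀ x, ∃ hx : R x ∈ A.domain, z • R x - A ⟨R x, hx⟩ = x := by
    intro x
    have h1 : ∀ i, ℓ (D i) (R x) = ℓ i (z • R x - x) := by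
      intro i
      have h2 := h.regularPart_graph hz x i
      simp only [hR, add_apply, sum_apply,
        smul_apply, map_add, map_sum, map_smul, map_sub, smul_eq_mul] at h2 ⊢
      have h3 : ∑ k ∈ Finset.range ⌈γ⌉₊, (z + k / 2)⁻¹ * ℓ (D i) (P k x) =
          z * ∑ k ∈ Finset.range ⌈γ⌉₊, (z + k / 2)⁻¹ * ℓ i (P k x) -
            ∑ k ∈ Finset.range ⌈γ⌉₊, ℓ i (P k x) := by
        rw [Finset.mul_sum, ← Finset.sum_sub_distrib]
        refine Finset.sum_congr rfl fun k hk => ?_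
        have hne : z + k / 2 ≠ 0 := fun h0 => hzk k (Finset.mem_range.1 hk)
          (by linear_combination h0)
        rw [h.P_graph (Finset.mem_range.1 hk)]
        rw [← mul_assoc, ← mul_assoc, ← sub_eq_zero]
        linear_combination (-ℓ i (P k x)) * (inv_mul_cancel₀ hne)
      rw [h3]
      linear_combination -h2
    obtain ⟨hd, hA⟩ := (h.graph _ _).2 h1
    exact ⟨hd, by rw [hA]; abel⟩
  refine ⟨hRx, fun x => ?_⟩
  obtain ⟨hd, hA⟩ := hRx (z • (x : X) - A x)
  set y := R (z • (x : X) - A x)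
  -- The left inverse property follows from the right one and injectivity: y - x is an eigenvector
  -- for z, and none is nonzero off the poles.
  have hmem : y - x ∈ UnboundedOp.eigenspace A z := by
    rw [UnboundedOp.mem_eigenspace_iff]
    refine ⟨A.domain.sub_mem hd x.2, ?_⟩
    have h1 : A ⟨y - x, A.domain.sub_mem hd x.2⟩ = A ⟨y, hd⟩ - A x := by
      rw [← LinearPMap.map_sub]
      rfl
    rw [h1, smul_sub]
    have h2 : A ⟨y, hd⟩ = z • y - (z • (x : X) - A x) := by rw [← hA]; abel
    rw [h2]
    abel
  have := h.eq_sum_P_of_mem_eigenspace hz hmem ∅ (by simp) (by simp)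
    fun k hk _ => hzk k (Finset.mem_range.1 hk)
  rw [Finset.sum_empty] at this
  exact sub_eq_zero.1 this

theorem eigenspace_eq_range (h : IsExpandingSemigroup A S P γ ℓ D) {k : ℕ} (hk : (k : ℝ) < γ) :
    UnboundedOp.eigenspace A (-(k : ℂ) / 2) = LinearMap.range (P k).toLinearMap := by
  have hk' : k < ⌈γ⌉₊ := Nat.lt_ceil.2 hk
  ext u
  constructor
  · intro hu
    have := h.eq_sum_P_of_mem_eigenspace (z := -(k : ℂ) / 2)
      (by rw [show 2 * (-(k : ℂ) / 2) = ((-k : ℝ) : ℂ) by push_cast; ring, Complex.ofReal_re]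
          linarith) hu {k} (by simpa using hk') (by simp)
      (fun j _ hj hjk => hj (by
        have : (k : ℂ) = j := by linear_combination (-2 : ℂ) * hjk
        simp [Nat.cast_injective this]))
    rw [Finset.sum_singleton] at this
    exact ⟨u, this.symm⟩
  · rintro ⟨x, rfl⟩
    rw [UnboundedOp.mem_eigenspace_iff, h.graph]
    intro i
    rw [map_smul, smul_eq_mul]
    exact h.P_graph hk' x i

/-- On the disc the resolvent is (ζ - c)⁻¹ P k plus a holomorphic part, so (ζ - c) times it extends
to a holomorphic G with G(c) = P k x, and Cauchy's formula applies. -/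
theorem rieszProjection_eq [CompleteSpace X] (h : IsExpandingSemigroup A S P γ ℓ D) {k : ℕ}
    (hk : (k : ℝ) < γ) {r : ℝ} (hr : 0 < r)
    (hre : ∀ z ∈ Metric.closedBall (-(k : ℂ) / 2) r, -γ < (2 * z).re)
    (hne : ∀ j < ⌈γ⌉₊, j ≠ k → -(j : ℂ) / 2 ∉ Metric.closedBall (-(k : ℂ) / 2) r) :
    UnboundedOp.rieszProjection A (-(k : ℂ) / 2) r = P k := by
  have hk' : k < ⌈γ⌉₊ := Nat.lt_ceil.2 hk
  set c : ℂ := -(k : ℂ) / 2 with hc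
  have hres : ∀ z ∈ Metric.sphere c r, ∀ j < ⌈γ⌉₊, z ≠ -(j : ℂ) / 2 := by
    rintro z hz j hj rfl
    by_cases hjk : j = k
    · subst hjk
      simp [hc] at hz
      linarith
    · exact hne j hj hjk (Metric.sphere_subset_closedBall hz)
  have hint : CircleIntegrable (UnboundedOp.resolvent A) c r := by
    refine ContinuousOn.circleIntegrable hr.le (UnboundedOp.continuousOn_resolvent.mono ?_)
    intro z hz
    exact ⟨_, h.isResolventAt (hre z (Metric.sphere_subset_closedBall hz)) (hres z hz)⟩
  ext x
  have happ : (∮ ζ in C(c, r), UnboundedOp.resolvent A ζ) x =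
      ∮ ζ in C(c, r), UnboundedOp.resolvent A ζ x := by
    rw [circleIntegral, circleIntegral, ContinuousLinearMap.intervalIntegral_apply hint.out]
    rfl
  set G : ℂ → X := fun ζ => P k x + (ζ - c) •
    (∑ j ∈ (Finset.range ⌈γ⌉₊).erase k, (ζ + j / 2)⁻¹ • P j x +
      (2 : ℂ) • mellin (remainder S P γ x) (2 * ζ)) with hG
  have hcong : (∮ ζ in C(c, r), UnboundedOp.resolvent A ζ x) =
      ∮ ζ in C(c, r), (ζ - c)⁻¹ • G ζ := by
    refine circleIntegral.integral_congr hr.le fun ζ hζ => ?_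
    have hζc : ζ - c ≠ 0 := sub_ne_zero.2 (hres ζ hζ k hk')
    rw [(h.isResolventAt (hre ζ (Metric.sphere_subset_closedBall hζ)) (hres ζ hζ)).resolvent_eq]
    simp only [hG, add_apply, sum_apply,
      smul_apply, regularPart_apply]
    rw [← Finset.add_sum_erase _ _ (Finset.mem_range.2 hk'), smul_add, smul_smul,
      inv_mul_cancel₀ hζc, one_smul, add_assoc, hc]
    congr 2
    ring
  have hGd : DifferentiableOn ℂ G (Metric.closedBall c r) := by
    intro ζ hζ
    refine DifferentiableAt.differentiableWithinAt ?_
    refine (differentiableAt_const _).add (DifferentiableAt.smul (by fun_prop)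
      (DifferentiableAt.add ?_ ?_))
    · refine DifferentiableAt.fun_sum fun j hj => ?_
      rw [Finset.mem_erase, Finset.mem_range] at hj
      have : ζ + j / 2 ≠ 0 := by
        intro h0
        refine hne j hj.2 hj.1 ?_
        rwa [show -(j : ℂ) / 2 = ζ by linear_combination -h0]
      have h1 : DifferentiableAt ℂ (fun ζ : ℂ => (ζ + j / 2)⁻¹) ζ :=
        ((differentiableAt_id (𝕜 := ℂ)).add_const _).inv this
      exact h1.smul_const _
    · refine DifferentiableAt.const_smul ?_ (2 : ℂ)
      exact (h.differentiableAt_mellin_remainder x (hre ζ hζ)).comp ζ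
        (f := fun ζ : ℂ => 2 * ζ) (by fun_prop)
  rw [UnboundedOp.rieszProjection, smul_apply, happ, hcong,
    hGd.circleIntegral_sub_inv_smul (Metric.mem_ball_self hr), smul_smul,
    inv_mul_cancel₀ (by simp [Real.pi_ne_zero]), one_smul]
  simp [hG]

end IsExpandingSemigroup

end Expansion


/-! ### The operator and its semigroup on the Fourier side, acting on Schwartz functions -/

section SchwartzSide

open Filter Topology Set FourierTransform SchwartzMap

/-- The Euclidean space `ℝ^N`. -/
abbrev Eucl (N : ℕ) : Type := EuclideanSpace ℝ (Fin N)

variable {N : ℕ}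

theorem one_add_pow_mul_exp_neg_mul_sq_le {a : ℝ} (ha : 0 < a) (k : ℕ) :
    ∃ C, ∀ t : ℝ, 0 ≤ t → (1 + t) ^ k * Real.exp (-(a * t ^ 2)) ≤ C := by
  -- Use (1 + t)^k ≤ k! e^{1+t}; the maximum of t - a t² is 1/(4a).
  refine ⟨k.factorial * Real.exp (1 + 1 / (4 * a)), fun t ht => ?_⟩
  have h1 : (1 + t) ^ k ≤ k.factorial * Real.exp (1 + t) := by
    have := Real.pow_div_factorial_le_exp (x := 1 + t) (by linarith) k
    rwa [div_le_iff₀' (by positivity)] at this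
  calc (1 + t) ^ k * Real.exp (-(a * t ^ 2))
      ≤ k.factorial * Real.exp (1 + t) * Real.exp (-(a * t ^ 2)) := by gcongr
    _ = k.factorial * Real.exp (1 + t - a * t ^ 2) := by rw [mul_assoc, ← Real.exp_add]; ring_nf
    _ ≤ _ := by
      gcongr
      have h2 : 0 ≤ a * (t - 1 / (2 * a)) ^ 2 := by positivity
      have h3 : a * (t - 1 / (2 * a)) ^ 2 = a * t ^ 2 - t + 1 / (4 * a) := by
        field_simp
        ring
      linarith

/-- The Gaussian `exp (-a |p|²)` as a Schwartz function. -/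
def gaussianSchwartz (N : ℕ) (a : ℝ) (ha : 0 < a) : 𝓢(Eucl N, ℂ) where
  toFun p := (Real.exp (-(a * ‖p‖ ^ 2)) : ℂ)
  smooth' := by
    refine Complex.ofRealCLM.contDiff.comp (Real.contDiff_exp.comp ?_)
    exact (contDiff_const.mul (contDiff_norm_sq ℝ)).neg
  decay' := by
    intro k n
    obtain ⟨k₁, C₁, hC₁, h₁⟩ :=
      (Function.hasTemperateGrowth_norm_sq (Eucl N)).norm_iteratedFDeriv_le_uniform n
    set C₂ : ℝ := (1 + C₁) with hC₂
    set B : ℝ := (1 + a) ^ n with hB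
    obtain ⟨C, hC⟩ := one_add_pow_mul_exp_neg_mul_sq_le ha (k + k₁ * n)
    refine ⟨n.factorial * B * C₂ ^ n * C, fun x => ?_⟩
    have hg : ContDiff ℝ n fun t : ℝ => Complex.exp (((-a : ℝ) : ℂ) * (t : ℂ)) := by
      exact Complex.contDiff_exp.comp (contDiff_const.mul Complex.ofRealCLM.contDiff)
    have hder : ∀ i, iteratedDeriv i (fun t : ℝ => Complex.exp (((-a : ℝ) : ℂ) * (t : ℂ))) =
        fun t : ℝ => ((-a : ℝ) : ℂ) ^ i * Complex.exp (((-a : ℝ) : ℂ) * (t : ℂ)) := by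
      intro i
      induction i with
      | zero => ext t; simp
      | succ i ih =>
        ext t
        rw [iteratedDeriv_succ, ih]
        have h1 : HasDerivAt (fun t : ℝ => ((-a : ℝ) : ℂ) ^ i *
            Complex.exp (((-a : ℝ) : ℂ) * (t : ℂ)))
            (((-a : ℝ) : ℂ) ^ i * (Complex.exp (((-a : ℝ) : ℂ) * (t : ℂ)) *
              (((-a : ℝ) : ℂ) * 1))) t := by
          have := ((((hasDerivAt_id (t : ℂ)).const_mul ((-a : ℝ) : ℂ)).cexp).const_mul
            (((-a : ℝ) : ℂ) ^ i))
          exact this.comp_ofReal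
        rw [h1.deriv]
        ring
    -- Chain rule bound for t ↦ e^{-at} composed with |x|²: each derivative costs at most a
    -- polynomial factor, which the Gaussian absorbs.
    have h2 := norm_iteratedFDeriv_comp_le (𝕜 := ℝ) (n := n) (N := n) hg
      ((contDiff_norm_sq ℝ (E := Eucl N)).of_le le_top) le_rfl x
      (C := B * Real.exp (-(a * ‖x‖ ^ 2))) (D := C₂ * (1 + ‖x‖) ^ k₁) ?_ ?_
    · have h3 : ((fun t : ℝ => Complex.exp (((-a : ℝ) : ℂ) * (t : ℂ))) ∘ fun x : Eucl N => ‖x‖ ^ 2)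
          = fun p : Eucl N => (Real.exp (-(a * ‖p‖ ^ 2)) : ℂ) := by
        ext p
        simp
      rw [h3] at h2
      have h4 := hC ‖x‖ (norm_nonneg x)
      have h5 : ‖x‖ ^ k ≤ (1 + ‖x‖) ^ k := by
        gcongr
        linarith
      calc _ ≤ (1 + ‖x‖) ^ k * (n.factorial * (B * Real.exp (-(a * ‖x‖ ^ 2))) *
            (C₂ * (1 + ‖x‖) ^ k₁) ^ n) := by gcongr
        _ = n.factorial * B * C₂ ^ n * ((1 + ‖x‖) ^ (k + k₁ * n) *
            Real.exp (-(a * ‖x‖ ^ 2))) := by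
          rw [mul_pow, ← pow_mul, pow_add]
          ring
        _ ≤ _ := by gcongr
    · intro i hi
      rw [norm_iteratedFDeriv_eq_norm_iteratedDeriv, hder, norm_mul, norm_pow, Complex.norm_real,
        ← Complex.ofReal_mul, Complex.norm_exp_ofReal, neg_mul]
      gcongr
      rw [Real.norm_eq_abs, abs_neg, abs_of_pos ha]
      calc a ^ i ≤ (1 + a) ^ i := by gcongr; linarith
        _ ≤ (1 + a) ^ n := by gcongr; linarith
    · intro i hi hin
      refine (h₁ i hin x).trans ?_
      have h6 : 1 ≤ (1 + ‖x‖) ^ k₁ := one_le_pow₀ (by linarith [norm_nonneg x])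
      have h7 : 1 ≤ C₂ * (1 + ‖x‖) ^ k₁ := by nlinarith
      calc C₁ * (1 + ‖x‖) ^ k₁ ≤ (C₂ * (1 + ‖x‖) ^ k₁) ^ 1 := by
            rw [pow_one]; gcongr; linarith
        _ ≤ _ := pow_le_pow_right₀ h7 hi

theorem gaussianSchwartz_apply {a : ℝ} (ha : 0 < a) (p : Eucl N) :
    gaussianSchwartz N a ha p = (Real.exp (-(a * ‖p‖ ^ 2)) : ℂ) := rfl

/-- The degenerate case a = 0 occurs in `dualS` at s = 1. -/
theorem hasTemperateGrowth_gaussian {a : ℝ} (ha : 0 ≤ a) :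
    Function.HasTemperateGrowth fun p : Eucl N => (Real.exp (-(a * ‖p‖ ^ 2)) : ℂ) := by
  rcases ha.eq_or_lt with rfl | ha
  · simp
  · exact (gaussianSchwartz N a ha).hasTemperateGrowth

theorem hasTemperateGrowth_coord (i : Fin N) :
    Function.HasTemperateGrowth fun p : Eucl N => (p i : ℂ) :=
  (Complex.ofRealCLM.comp (EuclideanSpace.proj i : Eucl N →L[ℝ] ℝ)).hasTemperateGrowth

theorem hasTemperateGrowth_ofReal_norm_sq :
    Function.HasTemperateGrowth fun p : Eucl N => ((‖p‖ ^ 2 : ℝ) : ℂ) :=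
  Function.HasTemperateGrowth.comp Function.Complex.hasTemperateGrowth_ofReal
    (Function.hasTemperateGrowth_norm_sq (Eucl N))

/-! ### The transposes of the generator and of the semigroup -/

/-- The transpose of `-4π²|p|² - ½ p·∇`, the Fourier transform of `ℒ`. -/
def dualL (ψ : 𝓢(Eucl N, ℂ)) : 𝓢(Eucl N, ℂ) :=
  (-(4 * Real.pi ^ 2) : ℂ) • smulLeftCLM ℂ (fun p : Eucl N => ((‖p‖ ^ 2 : ℝ) : ℂ)) ψ
    + (1 / 2 : ℂ) • ∑ i : Fin N,
        smulLeftCLM ℂ (fun p : Eucl N => (p i : ℂ)) (∂_{EuclideanSpace.single i (1 : ℝ)} ψ)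
    + (N / 2 : ℂ) • ψ

theorem sum_coord_mul_fderiv (ψ : 𝓢(Eucl N, ℂ)) (x p : Eucl N) :
    ∑ i : Fin N, (p i : ℂ) * fderiv ℝ ψ x (EuclideanSpace.single i (1 : ℝ)) =
      fderiv ℝ ψ x p := by
  conv_rhs => rw [← (EuclideanSpace.basisFun (Fin N) ℝ).sum_repr p, map_sum]
  simp

theorem dualL_apply (ψ : 𝓢(Eucl N, ℂ)) (p : Eucl N) :
    dualL ψ p = -(4 * Real.pi ^ 2) * ‖p‖ ^ 2 * ψ p + 1 / 2 * fderiv ℝ ψ p p + N / 2 * ψ p := by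
  simp only [dualL, add_apply, smul_apply, sum_apply, smul_eq_mul,
    smulLeftCLM_apply_apply hasTemperateGrowth_ofReal_norm_sq,
    smulLeftCLM_apply_apply (hasTemperateGrowth_coord _), lineDerivOp_apply_eq_fderiv,
    sum_coord_mul_fderiv]
  push_cast
  ring

/-- The transpose of ℒ is Δ - ½ ∑ ∂_i(ξ_i ·) + N/2. Conjugation by 𝓕 turns Δ into -4π²|p|² and
-∂_i(ξ_i ·) into p_i ∂_i, the factors 2πi cancelling. -/
theorem distL_fourier (T : 𝓢'(Eucl N, ℂ)) (ψ : 𝓢(Eucl N, ℂ)) :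
    distL N T (𝓕 ψ) = T (𝓕 (dualL ψ)) := by
  have hin : ∀ i : Fin N, (inner ℝ · (EuclideanSpace.single i (1 : ℝ)) : Eucl N → ℝ) =
      fun p => p i := by
    intro i; ext p; simp [EuclideanSpace.inner_single_right]
  have hreal : ∀ (i : Fin N) (φ : 𝓢(Eucl N, ℂ)), smulLeftCLM ℂ (fun p : Eucl N => p i) φ =
      smulLeftCLM ℂ (fun p : Eucl N => (p i : ℂ)) φ := by
    intro i φ
    exact (smulLeftCLM_ofReal ℂ
      (EuclideanSpace.proj i : Eucl N →L[ℝ] ℝ).hasTemperateGrowth φ).symm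
  have hpi : (2 * Real.pi * Complex.I : ℂ) ≠ 0 := by simp [Real.pi_ne_zero]
  have h1 : ∀ (i : Fin N) (χ : 𝓢(Eucl N, ℂ)), ∂_{EuclideanSpace.single i (1 : ℝ)} (𝓕 χ) =
      -(2 * Real.pi * Complex.I : ℂ) • 𝓕 (smulLeftCLM ℂ (fun p : Eucl N => (p i : ℂ)) χ) := by
    intro i χ
    rw [lineDerivOp_fourier_eq, hin, hreal, FourierTransform.fourier_smul]
  have h2 : ∀ (i : Fin N) (χ : 𝓢(Eucl N, ℂ)), smulLeftCLM ℂ (fun p : Eucl N => (p i : ℂ)) (𝓕 χ) =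
      (2 * Real.pi * Complex.I : ℂ)⁻¹ • 𝓕 (∂_{EuclideanSpace.single i (1 : ℝ)} χ) := by
    intro i χ
    rw [fourier_lineDerivOp_eq, hin, hreal, smul_smul, inv_mul_cancel₀ hpi, one_smul]
  have hlap : Δ (𝓕 ψ) = (-(4 * Real.pi ^ 2) : ℂ) •
      𝓕 (smulLeftCLM ℂ (fun p : Eucl N => ((‖p‖ ^ 2 : ℝ) : ℂ)) ψ) := by
    rw [SchwartzMap.laplacian_eq_sum (EuclideanSpace.basisFun (Fin N) ℝ)]
    simp only [EuclideanSpace.basisFun_apply, h1, LineDeriv.lineDerivOp_smul, smul_smul]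
    rw [← Finset.smul_sum, show -(2 * Real.pi * Complex.I : ℂ) * -(2 * Real.pi * Complex.I) =
      -(4 * Real.pi ^ 2) by ring_nf; simp]
    congr 1
    rw [← FourierTransform.fourierCLM_apply (R := ℂ)]
    simp only [← FourierTransform.fourierCLM_apply (R := ℂ), ← map_sum]
    congr 1
    ext p
    simp only [sum_apply, smulLeftCLM_apply_apply hasTemperateGrowth_ofReal_norm_sq,
      smulLeftCLM_apply_apply (hasTemperateGrowth_coord _), smul_eq_mul, ← mul_assoc,
      ← Finset.sum_mul]
    rw [EuclideanSpace.norm_sq_eq]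
    simp only [Real.norm_eq_abs, sq_abs]
    congr 1
    push_cast
    exact Finset.sum_congr rfl fun i _ => by ring
  have hdist : distL N T (𝓕 ψ) = T (Δ (𝓕 ψ)
      - (1 / 2 : ℂ) • ∑ i : Fin N, ∂_{EuclideanSpace.single i (1 : ℝ)}
        (smulLeftCLM ℂ (fun p : Eucl N => (p i : ℂ)) (𝓕 ψ)) + (N / 2 : ℂ) • 𝓕 ψ) := by
    rw [map_add, map_sub, map_smul, map_smul, map_sum]
    simp only [distL, LinearMap.coe_mk, AddHom.coe_mk]
    rw [← TemperedDistribution.laplacian_apply_apply]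
    change (Δ T) (𝓕 ψ) + (1 / 2 : ℂ) • (∑ i : Fin N,
        TemperedDistribution.smulLeftCLM ℂ (fun ξ : EuclideanSpace ℝ (Fin N) => (ξ i : ℂ))
          (∂_{EuclideanSpace.single i (1 : ℝ)} T)) (𝓕 ψ) + (N / 2 : ℂ) • T (𝓕 ψ) = _
    rw [sum_apply]
    simp only [TemperedDistribution.smulLeftCLM_apply_apply,
      TemperedDistribution.lineDerivOp_apply_apply, map_neg, Finset.sum_neg_distrib, smul_neg,
      sub_eq_add_neg]
  rw [hdist]
  congr 1
  have h3 : ∀ i : Fin N, ∂_{EuclideanSpace.single i (1 : ℝ)}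
        (smulLeftCLM ℂ (fun p : Eucl N => (p i : ℂ)) (𝓕 ψ)) =
      - 𝓕 (smulLeftCLM ℂ (fun p : Eucl N => (p i : ℂ))
        (∂_{EuclideanSpace.single i (1 : ℝ)} ψ)) := by
    intro i
    rw [h2, LineDeriv.lineDerivOp_smul, h1, smul_smul, mul_neg, inv_mul_cancel₀ hpi, neg_one_smul]
  simp only [hlap, h3, Finset.sum_neg_distrib, smul_neg, sub_neg_eq_add, dualL,
    FourierTransform.fourier_add, FourierTransform.fourier_smul]
  congr 3
  simp only [← FourierTransform.fourierCLM_apply (R := ℂ), ← map_sum]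

/-- The transpose of the Fourier transform of the semigroup:
`ψ ↦ s^{-N} exp (-4π² (s⁻² - 1)|q|²) ψ(q / s)`. -/
def dualS (s : ℝ) (ψ : 𝓢(Eucl N, ℂ)) : 𝓢(Eucl N, ℂ) :=
  if hs : s = 0 then 0 else
    ((s : ℂ) ^ N)⁻¹ •
      smulLeftCLM ℂ (fun q : Eucl N => (Real.exp (-(4 * Real.pi ^ 2 * (s⁻¹ ^ 2 - 1) * ‖q‖ ^ 2)) : ℂ))
        (compCLMOfContinuousLinearEquiv ℂ
          (ContinuousLinearEquiv.smulLeft (Units.mk0 s⁻¹ (inv_ne_zero hs)) : Eucl N ≃L[ℝ] Eucl N) ψ)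

theorem inv_sq_sub_one_nonneg {s : ℝ} (hs : s ∈ Ioc (0 : ℝ) 1) : 0 ≤ s⁻¹ ^ 2 - 1 := by
  have : 1 ≤ s⁻¹ := (one_le_inv₀ hs.1).2 hs.2
  nlinarith

theorem dualS_apply {s : ℝ} (hs : s ∈ Ioc (0 : ℝ) 1) (ψ : 𝓢(Eucl N, ℂ)) (q : Eucl N) :
    dualS s ψ q = ((s : ℂ) ^ N)⁻¹ *
      (Real.exp (-(4 * Real.pi ^ 2 * (s⁻¹ ^ 2 - 1) * ‖q‖ ^ 2)) * ψ (s⁻¹ • q)) := by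
  have h1 : 0 ≤ 4 * Real.pi ^ 2 * (s⁻¹ ^ 2 - 1) :=
    mul_nonneg (by positivity) (inv_sq_sub_one_nonneg hs)
  rw [dualS, dif_neg hs.1.ne', smul_apply,
    smulLeftCLM_apply_apply (hasTemperateGrowth_gaussian h1)]
  rfl

/-- The Gaussian exponents add: (rs)⁻² - 1 = (s⁻² - 1) + s⁻²(r⁻² - 1). -/
theorem dualS_dualS {r s : ℝ} (hr : r ∈ Ioc (0 : ℝ) 1) (hs : s ∈ Ioc (0 : ℝ) 1)
    (ψ : 𝓢(Eucl N, ℂ)) : dualS s (dualS r ψ) = dualS (r * s) ψ := by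
  have hrs : r * s ∈ Ioc (0 : ℝ) 1 := ⟨mul_pos hr.1 hs.1, mul_le_one₀ hr.2 hs.1.le hs.2⟩
  ext q
  have hr0 := hr.1.ne'
  have hs0 := hs.1.ne'
  rw [dualS_apply hs, dualS_apply hr, dualS_apply hrs, smul_smul, mul_inv, norm_smul,
    Real.norm_of_nonneg (inv_nonneg.2 hs.1.le)]
  have : Real.exp (-(4 * Real.pi ^ 2 * ((r⁻¹ * s⁻¹) ^ 2 - 1) * ‖q‖ ^ 2)) =
      Real.exp (-(4 * Real.pi ^ 2 * (s⁻¹ ^ 2 - 1) * ‖q‖ ^ 2)) *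
      Real.exp (-(4 * Real.pi ^ 2 * (r⁻¹ ^ 2 - 1) * (s⁻¹ * ‖q‖) ^ 2)) := by
    rw [← Real.exp_add]
    ring_nf
  rw [this]
  push_cast
  rw [mul_pow (r : ℂ), mul_inv]
  ring

/-- `dualL` involves only the radial derivative, so it suffices to differentiate along the ray t ↦
tq at t = 1. -/
theorem fderiv_dualS_self {s : ℝ} (hs : s ∈ Ioc (0 : ℝ) 1) (ψ : 𝓢(Eucl N, ℂ)) (q : Eucl N) :
    fderiv ℝ (dualS s ψ) q q = ((s : ℂ) ^ N)⁻¹ *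
      (Real.exp (-(4 * Real.pi ^ 2 * (s⁻¹ ^ 2 - 1) * ‖q‖ ^ 2)) *
        (-(8 * Real.pi ^ 2 * ((s : ℂ)⁻¹ ^ 2 - 1) * ‖q‖ ^ 2) * ψ (s⁻¹ • q) +
          fderiv ℝ ψ (s⁻¹ • q) (s⁻¹ • q))) := by
  have h1 : HasDerivAt (fun t : ℝ => dualS s ψ (t • q)) (fderiv ℝ (dualS s ψ) q q) 1 := by
    have h2 : HasDerivAt (fun t : ℝ => t • q) q 1 := by
      simpa using (hasDerivAt_id (1 : ℝ)).smul_const q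
    have h3 := (dualS s ψ).hasFDerivAt ((1 : ℝ) • q)
    have := h3.comp_hasDerivAt (1 : ℝ) h2
    rwa [one_smul] at this
  set a : ℝ := 4 * Real.pi ^ 2 * (s⁻¹ ^ 2 - 1) * ‖q‖ ^ 2 with ha
  have h4 : HasDerivAt (fun t : ℝ => ψ (t • s⁻¹ • q)) (fderiv ℝ ψ (s⁻¹ • q) (s⁻¹ • q)) 1 := by
    have h2 : HasDerivAt (fun t : ℝ => t • s⁻¹ • q) (s⁻¹ • q) 1 := by
      simpa using (hasDerivAt_id (1 : ℝ)).smul_const (s⁻¹ • q)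
    have h3 := ψ.hasFDerivAt ((1 : ℝ) • s⁻¹ • q)
    have := h3.comp_hasDerivAt (1 : ℝ) h2
    rwa [one_smul] at this
  have h5 : HasDerivAt (fun t : ℝ => ((Real.exp (-(a * t ^ 2)) : ℝ) : ℂ))
      ((Real.exp (-a) * (-(a * 2)) : ℝ) : ℂ) 1 := by
    have : HasDerivAt (fun t : ℝ => Real.exp (-(a * t ^ 2))) (Real.exp (-a) * (-(a * 2))) 1 := by
      have := ((((hasDerivAt_id (1 : ℝ)).pow 2).const_mul a).neg).exp
      simpa using this
    exact this.ofReal_comp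
  have h6 := (h5.mul h4).const_mul (((s : ℂ) ^ N)⁻¹)
  have h7 : (fun t : ℝ => dualS s ψ (t • q)) = fun t : ℝ => ((s : ℂ) ^ N)⁻¹ *
      (((fun t : ℝ => ((Real.exp (-(a * t ^ 2)) : ℝ) : ℂ)) *
        fun t : ℝ => ψ (t • s⁻¹ • q)) t) := by
    ext t
    rw [dualS_apply hs, norm_smul, Pi.mul_apply, smul_comm, ha, mul_pow, Real.norm_eq_abs, sq_abs]
    ring_nf
  rw [h7] at h1
  rw [h1.unique h6, ha]
  simp only [one_smul, one_pow, mul_one]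
  push_cast
  ring

theorem dualL_dualS {s : ℝ} (hs : s ∈ Ioc (0 : ℝ) 1) (ψ : 𝓢(Eucl N, ℂ)) :
    dualL (dualS s ψ) = dualS s (dualL ψ) := by
  ext q
  rw [dualL_apply, fderiv_dualS_self hs, dualS_apply hs, dualS_apply hs, dualL_apply, norm_smul,
    Real.norm_of_nonneg (inv_nonneg.2 hs.1.le)]
  push_cast
  ring

theorem hasDerivAt_dualS {s : ℝ} (hs : s ∈ Ioo (0 : ℝ) 1) (ψ : 𝓢(Eucl N, ℂ)) (q : Eucl N) :
    HasDerivAt (fun r : ℝ => dualS r ψ q) (-(2 / (s : ℂ)) * dualS s (dualL ψ) q) s := by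
  have hs' : s ∈ Ioc (0 : ℝ) 1 := ⟨hs.1, hs.2.le⟩
  have hs0 : (s : ℂ) ≠ 0 := by exact_mod_cast hs.1.ne'
  have hinv : HasDerivAt (fun r : ℝ => r⁻¹) (-(s ^ 2)⁻¹) s := hasDerivAt_inv hs.1.ne'
  have h1 : HasDerivAt (fun r : ℝ => ((r : ℂ) ^ N)⁻¹) (-(N * (s : ℂ) ^ (N - 1)) / ((s : ℂ) ^ N) ^ 2)
      s := by
    have := ((hasDerivAt_pow N (s : ℂ)).inv (pow_ne_zero _ hs0)).comp_ofReal
    exact this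
  have h2 : HasDerivAt (fun r : ℝ => ψ (r⁻¹ • q)) (fderiv ℝ ψ (s⁻¹ • q) (-(s ^ 2)⁻¹ • q)) s :=
    (ψ.hasFDerivAt (s⁻¹ • q)).comp_hasDerivAt s (hinv.smul_const q)
  have h3 : HasDerivAt
      (fun r : ℝ => ((Real.exp (-(4 * Real.pi ^ 2 * (r⁻¹ ^ 2 - 1) * ‖q‖ ^ 2)) : ℝ) : ℂ))
      ((Real.exp (-(4 * Real.pi ^ 2 * (s⁻¹ ^ 2 - 1) * ‖q‖ ^ 2)) *
        (-(4 * Real.pi ^ 2 * (2 * s⁻¹ * -(s ^ 2)⁻¹) * ‖q‖ ^ 2)) : ℝ) : ℂ) s := by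
    have h4 := ((((((hinv.pow 2).sub_const 1).const_mul (4 * Real.pi ^ 2)).mul_const
      (‖q‖ ^ 2)).neg).exp).ofReal_comp
    convert! h4 using 1
    norm_num
  have h5 := h1.mul (h3.mul h2)
  have h6 := h5.congr_of_eventuallyEq (f₁ := fun r : ℝ => dualS r ψ q) (by
    filter_upwards [isOpen_Ioo.mem_nhds hs] with r hr
    rw [dualS_apply ⟨hr.1, hr.2.le⟩]
    rfl)
  convert! h6 using 1
  rw [dualS_apply hs', dualL_apply, norm_smul, Real.norm_of_nonneg (inv_nonneg.2 hs.1.le)]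
  simp only [map_smul, Complex.real_smul, Pi.mul_apply]
  -- The derivative of s^N carries the truncated exponent N - 1.
  rcases Nat.eq_zero_or_pos N with h0 | h0
  · subst h0
    push_cast
    field_simp
    ring
  · obtain ⟨l, rfl⟩ : ∃ l, N = l + 1 := ⟨N - 1, by omega⟩
    rw [Nat.add_sub_cancel]
    push_cast
    rw [pow_succ]
    field_simp
    ring

theorem norm_le_mul_one_add_norm_pow (χ : 𝓢(Eucl N, ℂ)) (k : ℕ) :
    ∃ C, 0 ≤ C ∧ ∀ p, ‖χ p‖ ≤ C * ((1 + ‖p‖) ^ k)⁻¹ := by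
  refine ⟨2 ^ k * (Finset.Iic (k, 0)).sup
    (fun m : ℕ × ℕ => SchwartzMap.seminorm ℂ m.1 m.2) χ, by positivity, fun p => ?_⟩
  · have := one_add_le_sup_seminorm_apply (𝕜 := ℂ) (m := (k, 0)) (k := k) (n := 0) le_rfl le_rfl χ p
    rw [norm_iteratedFDeriv_zero] at this
    rw [← div_eq_mul_inv, le_div_iff₀' (by positivity)]
    exact this

/-- Since s⁻¹ ≥ 1 the dilation only improves decay, and the Gaussian is at most 1. The factor s^{-N}
is harmless away from 0, so these are dominating functions locally uniform in s. -/
theorem norm_dualS_le (χ : 𝓢(Eucl N, ℂ)) (k : ℕ) :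
    ∃ C, 0 ≤ C ∧ ∀ s ∈ Ioc (0 : ℝ) 1, ∀ q,
      ‖dualS s χ q‖ ≤ (s ^ N)⁻¹ * (C * ((1 + ‖q‖) ^ k)⁻¹) := by
  obtain ⟨C, hC0, hC⟩ := norm_le_mul_one_add_norm_pow χ k
  refine ⟨C, hC0, fun s hs q => ?_⟩
  have hs1 : 1 ≤ s⁻¹ := (one_le_inv₀ hs.1).2 hs.2
  rw [dualS_apply hs, norm_mul, norm_mul, norm_inv, norm_pow, Complex.norm_real, Complex.norm_real,
    Real.norm_of_nonneg hs.1.le, Real.norm_of_nonneg (Real.exp_pos _).le]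
  have h1 : Real.exp (-(4 * Real.pi ^ 2 * (s⁻¹ ^ 2 - 1) * ‖q‖ ^ 2)) ≤ 1 := by
    rw [Real.exp_le_one_iff, neg_nonpos]
    have := inv_sq_sub_one_nonneg hs
    positivity
  have h2 := hC (s⁻¹ • q)
  rw [norm_smul, Real.norm_of_nonneg (inv_nonneg.2 hs.1.le)] at h2
  have h3 : ((1 + s⁻¹ * ‖q‖) ^ k)⁻¹ ≤ ((1 + ‖q‖) ^ k)⁻¹ := by
    gcongr
    nlinarith [norm_nonneg q]
  have hp : 0 ≤ (s ^ N)⁻¹ := by have := hs.1; positivity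
  refine mul_le_mul_of_nonneg_left ?_ hp
  calc _ ≤ 1 * (C * ((1 + s⁻¹ * ‖q‖) ^ k)⁻¹) := by gcongr
    _ ≤ _ := by rw [one_mul]; gcongr

theorem memLp_two_one_add_norm_pow_inv :
    MemLp (fun q : Eucl N => ((1 + ‖q‖) ^ (N + 1))⁻¹) 2 volume := by
  have hc : Continuous fun q : Eucl N => ((1 + ‖q‖) ^ (N + 1))⁻¹ :=
    Continuous.inv₀ (by fun_prop) fun q => by positivity
  rw [memLp_two_iff_integrable_sq hc.aestronglyMeasurable]
  have h1 := integrable_one_add_norm (E := Eucl N) (μ := volume) (r := 2 * (N + 1))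
    (by rw [finrank_euclideanSpace_fin]; linarith [(Nat.cast_nonneg N : (0 : ℝ) ≤ N)])
  refine h1.congr (.of_forall fun q => ?_)
  have hpos : (0 : ℝ) < 1 + ‖q‖ := by positivity
  simp only
  rw [Real.rpow_neg hpos.le, inv_pow, ← pow_mul, ← Real.rpow_natCast]
  congr 2
  push_cast
  ring

theorem integrable_mul_one_add_norm_pow_inv (v : Lp ℂ 2 (volume : Measure (Eucl N))) (C : ℝ) :
    Integrable fun q : Eucl N => C * ((1 + ‖q‖) ^ (N + 1))⁻¹ * ‖v q‖ := by
  have := (memLp_two_one_add_norm_pow_inv (N := N)).integrable_mul (Lp.memLp v).norm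
  simpa [mul_assoc] using this.const_mul C

theorem hasDerivAt_integral_dualS (v : Lp ℂ 2 (volume : Measure (Eucl N))) (ψ : 𝓢(Eucl N, ℂ))
    {s : ℝ} (hs : s ∈ Ioo (0 : ℝ) 1) :
    HasDerivAt (fun r : ℝ => ∫ q, dualS r ψ q * v q)
      (-(2 / (s : ℂ)) * ∫ q, dualS s (dualL ψ) q * v q) s := by
  obtain ⟨C, hC0, hC⟩ := norm_dualS_le (dualL ψ) (N + 1)
  obtain ⟨C', hC0', hC'⟩ := norm_dualS_le ψ (N + 1)
  have hmeas : ∀ (χ : 𝓢(Eucl N, ℂ)), AEStronglyMeasurable (fun q => χ q * v q) volume :=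
    fun χ => χ.continuous.aestronglyMeasurable.mul (Lp.aestronglyMeasurable v)
  have h := hasDerivAt_integral_of_dominated_loc_of_deriv_le (μ := volume)
    (F := fun (r : ℝ) q => dualS r ψ q * v q)
    (F' := fun (r : ℝ) q => -(2 / (r : ℂ)) * dualS r (dualL ψ) q * v q)
    -- Keeping r above s/2 bounds both 2/r and r^{-N}. The decay (1 + |q|)^{-(N+1)} is square
    -- integrable, hence integrable against v ∈ L².
    (x₀ := s) (s := Ioo (s / 2) 1)
    (bound := fun q => (2 / (s / 2) * (((s / 2) ^ N)⁻¹ * C)) * ((1 + ‖q‖) ^ (N + 1))⁻¹ * ‖v q‖)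
    (Ioo_mem_nhds (by linarith [hs.1]) hs.2) (.of_forall fun r => hmeas _)
    ?_ ?_ ?_ (integrable_mul_one_add_norm_pow_inv v _) ?_
  · have h2 := h.2
    simp only [mul_assoc] at h2 ⊢
    rwa [integral_const_mul] at h2
  · refine (integrable_mul_one_add_norm_pow_inv v ((s ^ N)⁻¹ * C')).mono' (hmeas _)
      (.of_forall fun q => ?_)
    rw [norm_mul]
    have := hC' s ⟨hs.1, hs.2.le⟩ q
    rw [← mul_assoc] at this
    gcongr
  · simp only [mul_assoc]
    exact (hmeas _).const_mul _
  · refine .of_forall fun q r hr => ?_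
    have hr0 : 0 < r := by linarith [hs.1, hr.1]
    have hs2 : 0 < s / 2 := by linarith [hs.1]
    rw [norm_mul, norm_mul, norm_neg, norm_div, Complex.norm_real, Real.norm_of_nonneg hr0.le,
      Complex.norm_ofNat]
    have h1 := hC r ⟨hr0, hr.2.le⟩ q
    have h2 : (r ^ N)⁻¹ ≤ ((s / 2) ^ N)⁻¹ := by
      have := hr.1.le
      gcongr
    have h3 : 2 / r ≤ 2 / (s / 2) := by
      have := hr.1.le
      gcongr
    calc 2 / r * ‖dualS r (dualL ψ) q‖ * ‖v q‖
        ≤ 2 / (s / 2) * (((s / 2) ^ N)⁻¹ * (C * ((1 + ‖q‖) ^ (N + 1))⁻¹)) * ‖v q‖ := by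
          gcongr
          exact h1.trans (by gcongr)
      _ = _ := by ring
  · refine .of_forall fun q r hr => ?_
    exact (hasDerivAt_dualS ⟨by linarith [hs.1, hr.1], hr.2⟩ ψ q).mul_const _

theorem tendsto_integral_dualS_one (v : Lp ℂ 2 (volume : Measure (Eucl N))) (ψ : 𝓢(Eucl N, ℂ)) :
    Tendsto (fun r : ℝ => ∫ q, dualS r ψ q * v q) (𝓝[<] 1) (𝓝 (∫ q, ψ q * v q)) := by
  obtain ⟨C, hC0, hC⟩ := norm_dualS_le ψ (N + 1)
  refine tendsto_integral_filter_of_dominated_convergence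
    (fun q => (((1 / 2 : ℝ) ^ N)⁻¹ * C) * ((1 + ‖q‖) ^ (N + 1))⁻¹ * ‖v q‖)
    (.of_forall fun r => (dualS r ψ).continuous.aestronglyMeasurable.mul
      (Lp.aestronglyMeasurable v)) ?_ (integrable_mul_one_add_norm_pow_inv v _) ?_
  · filter_upwards [Ioo_mem_nhdsLT (show (1 / 2 : ℝ) < 1 by norm_num)] with r hr
    refine .of_forall fun q => ?_
    rw [norm_mul]
    have hr0 : 0 < r := by linarith [hr.1]
    have h2 : (r ^ N)⁻¹ ≤ ((1 / 2 : ℝ) ^ N)⁻¹ := by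
      have := hr.1.le
      gcongr
    rw [mul_assoc _ C]
    gcongr
    exact (hC r ⟨hr0, hr.2.le⟩ q).trans (by gcongr)
  · refine .of_forall fun q => ?_
    refine Tendsto.mul_const _ ?_
    have hcont : ContinuousAt (fun s : ℝ => ((s : ℂ) ^ N)⁻¹ *
      (Real.exp (-(4 * Real.pi ^ 2 * (s⁻¹ ^ 2 - 1) * ‖q‖ ^ 2)) * ψ (s⁻¹ • q))) 1 := by
      have h1 : ContinuousAt (fun s : ℝ => s⁻¹) 1 := continuousAt_inv₀ one_ne_zero
      refine ContinuousAt.mul (ContinuousAt.inv₀ (by fun_prop) (by simp)) (ContinuousAt.mul ?_ ?_)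
      · exact Complex.continuous_ofReal.continuousAt.comp (Real.continuous_exp.continuousAt.comp
          (((((h1.pow 2).sub continuousAt_const).const_mul _).mul_const _).neg))
      · exact ψ.continuous.continuousAt.comp (f := fun s : ℝ => s⁻¹ • q)
          (h1.smul continuousAt_const)
    have h3 := hcont.tendsto.mono_left (nhdsWithin_le_nhds (s := Iio 1))
    simp only [inv_one, one_mul, one_pow, sub_self, mul_zero, zero_mul, neg_zero, Real.exp_zero,
      Complex.ofReal_one, one_smul] at h3
    refine h3.congr' ?_
    filter_upwards [Ioo_mem_nhdsLT (zero_lt_one' ℝ)] with r hr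
    rw [dualS_apply ⟨hr.1, hr.2.le⟩]

end SchwartzSide


/-! ### Test functionals on the weighted space -/

section TestFunctionals

open Filter Topology Set FourierTransform SchwartzMap

variable {N : ℕ} {m : ℝ≥0}

theorem volume_absolutelyContinuous_weightMeasure :
    (volume : Measure (Eucl N)) ≪ weightMeasure N m :=
  (volume_le_weightMeasure N m).absolutelyContinuous

theorem WeightedL2.memLp_volume (x : WeightedL2 N m) : MemLp x 2 (volume : Measure (Eucl N)) :=
  (Lp.memLp x).mono_measure (volume_le_weightMeasure N m)

theorem WeightedL2.coeFn_toL2 (x : WeightedL2 N m) : WeightedL2.toL2 N m x =ᵐ[volume] x :=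
  MemLp.coeFn_toLp x.memLp_volume

theorem WeightedL2.norm_toL2_le (x : WeightedL2 N m) : ‖WeightedL2.toL2 N m x‖ ≤ ‖x‖ := by
  change ‖MemLp.toLp _ x.memLp_volume‖ ≤ ‖x‖
  rw [Lp.norm_toLp, Lp.norm_def]
  exact ENNReal.toReal_mono (Lp.eLpNorm_ne_top x)
    (eLpNorm_mono_measure _ (volume_le_weightMeasure N m))

theorem WeightedL2.toDistribution_apply (x : WeightedL2 N m) (φ : 𝓢(Eucl N, ℂ)) :
    WeightedL2.toDistribution N m x φ = ∫ y, φ y * x y := by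
  change Lp.toTemperedDistribution (WeightedL2.toL2 N m x) φ = _
  rw [Lp.toTemperedDistribution_apply]
  refine integral_congr_ae ?_
  filter_upwards [WeightedL2.coeFn_toL2 x] with y hy
  rw [hy, smul_eq_mul]

/-- The functional `x ↦ ∫ x 𝓕ψ`. -/
def testFunctional (m : ℝ≥0) (ψ : 𝓢(Eucl N, ℂ)) : WeightedL2 N m →L[ℂ] ℂ :=
  LinearMap.mkContinuous
    { toFun := fun x => WeightedL2.toDistribution N m x (𝓕 ψ)
      map_add' := fun x y => by rw [map_add]; rfl
      map_smul' := fun c x => by rw [map_smul]; rfl } ‖(𝓕 ψ).toLp 2 volume‖ fun x => by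
    have h1 : WeightedL2.toDistribution N m x (𝓕 ψ) =
        inner ℂ ((((𝓕 ψ).memLp 2 (volume : Measure (Eucl N))).star).toLp _)
          (WeightedL2.toL2 N m x) := by
      rw [WeightedL2.toDistribution_apply, L2.inner_def]
      refine integral_congr_ae ?_
      filter_upwards [WeightedL2.coeFn_toL2 x,
        MemLp.coeFn_toLp ((𝓕 ψ).memLp 2 (volume : Measure (Eucl N))).star] with y h1 h2
      rw [h1, h2]
      simp [mul_comm]
    have h2 : ‖(((𝓕 ψ).memLp 2 (volume : Measure (Eucl N))).star).toLp _‖ =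
        ‖(𝓕 ψ).toLp 2 (volume : Measure (Eucl N))‖ := by
      rw [Lp.norm_toLp, norm_toLp]
      congr 1
      exact eLpNorm_congr_norm_ae (.of_forall fun y => by simp)
    simp only [LinearMap.coe_mk, AddHom.coe_mk]
    rw [h1, ← h2]
    refine (norm_inner_le_norm _ _).trans ?_
    gcongr
    exact x.norm_toL2_le

theorem testFunctional_eq_toDistribution (ψ : 𝓢(Eucl N, ℂ)) (x : WeightedL2 N m) :
    testFunctional m ψ x = WeightedL2.toDistribution N m x (𝓕 ψ) := rfl

theorem testFunctional_apply (ψ : 𝓢(Eucl N, ℂ)) (x : WeightedL2 N m) :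
    testFunctional m ψ x = ∫ y, 𝓕 ψ y * x y := by
  rw [testFunctional_eq_toDistribution, WeightedL2.toDistribution_apply]

/-- Moving the Fourier transform onto x within L² works for every x, integrable or not. On this side
`dualS` acts pointwise and dominated convergence applies. -/
theorem testFunctional_eq_integral_fourier (ψ : 𝓢(Eucl N, ℂ)) (x : WeightedL2 N m) :
    testFunctional m ψ x = ∫ q, ψ q * (𝓕 (WeightedL2.toL2 N m x) : Lp ℂ 2 volume) q := by
  have h := Lp.fourier_toTemperedDistribution_eq (WeightedL2.toL2 N m x)
  have h2 : testFunctional m ψ x =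
      (𝓕 (Lp.toTemperedDistribution (WeightedL2.toL2 N m x)) : 𝓢'(Eucl N, ℂ)) ψ := rfl
  rw [h2, h, Lp.toTemperedDistribution_apply]
  rfl

theorem eq_zero_of_testFunctional (x : WeightedL2 N m) (h : ∀ ψ, testFunctional m ψ x = 0) :
    x = 0 := by
  apply WeightedL2.toDistribution_injective N m
  rw [map_zero]
  ext φ
  have := h (𝓕⁻ φ)
  rw [testFunctional_eq_toDistribution, FourierTransform.fourier_fourierInv_eq] at this
  exact this

/-- Since 𝓕 is onto the Schwartz space, testing on all 𝓕ψ is equality of distributions; the maximal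
domain imposes nothing else. -/
theorem opL_graph_iff (x w : WeightedL2 N m) :
    (∃ h : x ∈ (opL N m).domain, opL N m ⟨x, h⟩ = w) ↔
      ∀ ψ, testFunctional m (dualL ψ) x = testFunctional m ψ w := by
  have h1 : (∃ h : x ∈ (opL N m).domain, opL N m ⟨x, h⟩ = w) ↔
      distL N (WeightedL2.toDistribution N m x) = WeightedL2.toDistribution N m w := by
    constructor
    · rintro ⟨h, rfl⟩
      exact (toDistribution_opL N m ⟨x, h⟩).symm
    · intro h
      have hx : x ∈ (opL N m).domain := ⟨w, h.symm⟩
      refine ⟨hx, WeightedL2.toDistribution_injective N m ?_⟩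
      rw [toDistribution_opL, h]
  rw [h1]
  constructor
  · intro h ψ
    rw [testFunctional_eq_toDistribution, testFunctional_eq_toDistribution, ← h, distL_fourier]
  · intro h
    ext φ
    have := h (𝓕⁻ φ)
    rwa [testFunctional_eq_toDistribution, testFunctional_eq_toDistribution, ← distL_fourier,
      FourierTransform.fourier_fourierInv_eq] at this

end TestFunctionals

/-! ### Integral operators on the weighted space -/

section KernelOperators

open Filter Topology Set

theorem eLpNorm_two_sq {α : Type*} [MeasurableSpace α] {μ : Measure α} (f : α → ℂ) :
    eLpNorm f 2 μ ^ 2 = ∫⁻ x, ‖f x‖ₑ ^ 2 ∂μ := by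
  have := eLpNorm_nnreal_pow_eq_lintegral (μ := μ) (f := f) (p := 2) two_ne_zero
  simpa using this

theorem ENNReal.lintegral_mul_sq_le {α : Type*} [MeasurableSpace α] {μ : Measure α}
    {f g : α → ℝ≥0∞} (hf : Measurable f) (hg : Measurable g) :
    (∫⁻ x, f x * g x ∂μ) ^ 2 ≤ (∫⁻ x, f x ^ 2 ∂μ) * ∫⁻ x, g x ^ 2 ∂μ := by
  have h := ENNReal.lintegral_mul_le_Lp_mul_Lq μ Real.HolderConjugate.two_two hf.aemeasurable
    hg.aemeasurable
  calc (∫⁻ x, f x * g x ∂μ) ^ 2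
      ≤ ((∫⁻ x, f x ^ (2 : ℝ) ∂μ) ^ (1 / 2 : ℝ) * (∫⁻ x, g x ^ (2 : ℝ) ∂μ) ^ (1 / 2 : ℝ)) ^ 2 := by
        gcongr
        exact h
    _ = _ := by
        rw [mul_pow, ← ENNReal.rpow_natCast, ← ENNReal.rpow_natCast, ← ENNReal.rpow_mul,
          ← ENNReal.rpow_mul]
        norm_num

/-- Cauchy–Schwarz with k = k^{1/2} k^{1/2}, the first half of Schur's test. -/
theorem ENNReal.lintegral_mul_sq_le_mul_lintegral {α : Type*} [MeasurableSpace α] {μ : Measure α}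
    {k g : α → ℝ≥0∞} (hk : Measurable k) (hg : Measurable g) :
    (∫⁻ x, k x * g x ∂μ) ^ 2 ≤ (∫⁻ x, k x ∂μ) * ∫⁻ x, k x * g x ^ 2 ∂μ := by
  have h := ENNReal.lintegral_mul_sq_le (μ := μ) (f := fun x => k x ^ (1 / 2 : ℝ))
    (g := fun x => k x ^ (1 / 2 : ℝ) * g x) (hk.pow_const _) ((hk.pow_const _).mul hg)
  have h2 : ∀ x, (k x ^ (1 / 2 : ℝ)) ^ 2 = k x := fun x => by
    rw [← ENNReal.rpow_natCast, ← ENNReal.rpow_mul]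
    norm_num
  simpa only [mul_pow, h2, ← mul_assoc, ← sq] using h

theorem ENNReal.add_sq_le (a b : ℝ≥0∞) : (a + b) ^ 2 ≤ 2 * a ^ 2 + 2 * b ^ 2 := by
  have := ENNReal.rpow_add_le_mul_rpow_add_rpow a b (p := 2) one_le_two
  norm_num at this
  rwa [mul_add] at this

variable {N : ℕ} {m : ℝ≥0}

/-- The density of the weight measure. -/
def weight (N : ℕ) (m : ℝ≥0) (ξ : Eucl N) : ℝ≥0∞ :=
  ENNReal.ofReal ((1 + ‖ξ‖ ^ 2) ^ (m : ℝ))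

theorem measurable_weight : Measurable (weight N m) := by
  unfold weight
  fun_prop

theorem lintegral_weightMeasure {g : Eucl N → ℝ≥0∞} (hg : Measurable g) :
    ∫⁻ ξ, g ξ ∂weightMeasure N m = ∫⁻ ξ, weight N m ξ * g ξ :=
  lintegral_withDensity_eq_lintegral_mul _ measurable_weight hg

theorem weight_ne_top (ξ : Eucl N) : weight N m ξ ≠ ∞ := ENNReal.ofReal_ne_top

instance : SigmaFinite (weightMeasure N m) :=
  SigmaFinite.withDensity_ofReal _

/-- The kernel `κ` defines a bounded operator of norm at most `C`, even when replaced by its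
absolute value. -/
structure KernelBound (m : ℝ≥0) (κ : Eucl N → Eucl N → ℂ) (C : ℝ≥0) : Prop where
  measurable : Measurable (Function.uncurry κ)
  bound : ∀ g : Eucl N → ℝ≥0∞, Measurable g →
    ∫⁻ ξ, (∫⁻ y, ‖κ ξ y‖ₑ * g y) ^ 2 ∂weightMeasure N m ≤ C ^ 2 * ∫⁻ y, g y ^ 2 ∂weightMeasure N m

namespace KernelBound

variable {κ : Eucl N → Eucl N → ℂ} {C : ℝ≥0}

theorem measurable_right (h : KernelBound m κ C) (ξ : Eucl N) : Measurable (κ ξ) :=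
  h.measurable.comp measurable_prodMk_left

theorem measurable_lintegral (h : KernelBound m κ C) {g : Eucl N → ℝ≥0∞} (hg : Measurable g) :
    Measurable fun ξ => ∫⁻ y, ‖κ ξ y‖ₑ * g y := by
  refine Measurable.lintegral_prod_right' (f := fun p : Eucl N × Eucl N => ‖κ p.1 p.2‖ₑ * g p.2) ?_
  exact h.measurable.enorm.mul (hg.comp measurable_snd)

theorem lintegral_enorm_sq (x : WeightedL2 N m) :
    ∫⁻ y, ‖x y‖ₑ ^ 2 ∂weightMeasure N m = ‖x‖ₑ ^ 2 := by
  rw [Lp.enorm_def, eLpNorm_two_sq]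

theorem measurable_coe (x : WeightedL2 N m) : Measurable x :=
  (Lp.stronglyMeasurable x).measurable

theorem ae_integrable (h : KernelBound m κ C) (x : WeightedL2 N m) :
    ∀ᵐ ξ ∂weightMeasure N m, Integrable fun y => κ ξ y * x y := by
  have h1 := h.bound (fun y => ‖x y‖ₑ) (measurable_coe x).enorm
  rw [lintegral_enorm_sq] at h1
  have h2 : ∫⁻ ξ, (∫⁻ y, ‖κ ξ y‖ₑ * ‖x y‖ₑ) ^ 2 ∂weightMeasure N m ≠ ∞ := by
    refine (h1.trans_lt ?_).ne
    exact ENNReal.mul_lt_top (by simp) (by simp)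
  have h3 := ae_lt_top ((h.measurable_lintegral (measurable_coe x).enorm).pow_const 2) h2
  filter_upwards [h3] with ξ hξ
  refine ⟨((h.measurable_right ξ).mul (measurable_coe x)).aestronglyMeasurable, ?_⟩
  rw [hasFiniteIntegral_iff_enorm]
  simp only [enorm_mul]
  by_contra htop
  rw [not_lt, top_le_iff] at htop
  rw [htop] at hξ
  simp at hξ

theorem stronglyMeasurable_integral (h : KernelBound m κ C) (x : WeightedL2 N m) :
    StronglyMeasurable fun ξ => ∫ y, κ ξ y * x y := by
  refine StronglyMeasurable.integral_prod_right'
    (f := fun p : Eucl N × Eucl N => κ p.1 p.2 * x p.2) ?_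
  exact (h.measurable.mul ((measurable_coe x).comp measurable_snd)).stronglyMeasurable

theorem eLpNorm_integral_le (h : KernelBound m κ C) (x : WeightedL2 N m) :
    eLpNorm (fun ξ => ∫ y, κ ξ y * x y) 2 (weightMeasure N m) ≤ C * ‖x‖ₑ := by
  have h1 := h.bound (fun y => ‖x y‖ₑ) (measurable_coe x).enorm
  rw [lintegral_enorm_sq, ← mul_pow] at h1
  rw [← ENNReal.pow_le_pow_left_iff two_ne_zero, eLpNorm_two_sq]
  refine le_trans (lintegral_mono fun ξ => ?_) h1
  gcongr
  refine (enorm_integral_le_lintegral_enorm _).trans ?_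
  simp only [enorm_mul, le_refl]

theorem memLp_integral (h : KernelBound m κ C) (x : WeightedL2 N m) :
    MemLp (fun ξ => ∫ y, κ ξ y * x y) 2 (weightMeasure N m) :=
  ⟨(h.stronglyMeasurable_integral x).aestronglyMeasurable,
    (h.eLpNorm_integral_le x).trans_lt (ENNReal.mul_lt_top (by simp) (by simp))⟩

/-- The operator with kernel `κ`. -/
def toCLM (h : KernelBound m κ C) : WeightedL2 N m →L[ℂ] WeightedL2 N m :=
  LinearMap.mkContinuous
    { toFun := fun x => (h.memLp_integral x).toLp
      map_add' := fun x y => by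
        rw [← MemLp.toLp_add, MemLp.toLp_eq_toLp_iff]
        filter_upwards [h.ae_integrable x, h.ae_integrable y] with ξ h1 h2
        rw [Pi.add_apply, ← integral_add h1 h2]
        refine integral_congr_ae ?_
        filter_upwards [volume_absolutelyContinuous_weightMeasure.ae_le (Lp.coeFn_add x y)]
          with t ht
        rw [ht, Pi.add_apply, mul_add]
      map_smul' := fun c x => by
        rw [RingHom.id_apply, ← MemLp.toLp_const_smul, MemLp.toLp_eq_toLp_iff]
        refine .of_forall fun ξ => ?_
        rw [Pi.smul_apply, smul_eq_mul, ← integral_const_mul]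
        refine integral_congr_ae ?_
        filter_upwards [volume_absolutelyContinuous_weightMeasure.ae_le (Lp.coeFn_smul c x)]
          with t ht
        rw [ht, Pi.smul_apply, smul_eq_mul]
        ring } C fun x => by
    simp only [LinearMap.coe_mk, AddHom.coe_mk]
    rw [Lp.norm_toLp]
    have := ENNReal.toReal_mono (ENNReal.mul_lt_top (by simp) (by simp)).ne
      (h.eLpNorm_integral_le x)
    simpa using this

theorem coeFn_toCLM (h : KernelBound m κ C) (x : WeightedL2 N m) :
    h.toCLM x =ᵐ[weightMeasure N m] fun ξ => ∫ y, κ ξ y * x y :=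
  MemLp.coeFn_toLp (h.memLp_integral x)

theorem norm_toCLM_apply_le (h : KernelBound m κ C) (x : WeightedL2 N m) :
    ‖h.toCLM x‖ ≤ C * ‖x‖ := by
  have := (LinearMap.mkContinuous_norm_le _ C.coe_nonneg _ : ‖h.toCLM‖ ≤ C)
  exact h.toCLM.le_of_opNorm_le this x

end KernelBound

open Classical in
/-- The operator with kernel `κ` (zero if `κ` does not satisfy a bound). -/
def kernelOp (m : ℝ≥0) (κ : Eucl N → Eucl N → ℂ) : WeightedL2 N m →L[ℂ] WeightedL2 N m :=
  if h : ∃ C, KernelBound m κ C then h.choose_spec.toCLM else 0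

theorem KernelBound.kernelOp_eq {κ : Eucl N → Eucl N → ℂ} {C : ℝ≥0} (h : KernelBound m κ C) :
    kernelOp m κ = h.toCLM := by
  have h' : ∃ C, KernelBound m κ C := ⟨C, h⟩
  rw [kernelOp, dif_pos h']
  rfl

theorem KernelBound.coeFn_kernelOp {κ : Eucl N → Eucl N → ℂ} {C : ℝ≥0} (h : KernelBound m κ C)
    (x : WeightedL2 N m) : kernelOp m κ x =ᵐ[weightMeasure N m] fun ξ => ∫ y, κ ξ y * x y := by
  rw [h.kernelOp_eq]
  exact h.coeFn_toCLM x

theorem KernelBound.norm_kernelOp_apply_le {κ : Eucl N → Eucl N → ℂ} {C : ℝ≥0}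
    (h : KernelBound m κ C) (x : WeightedL2 N m) : ‖kernelOp m κ x‖ ≤ C * ‖x‖ := by
  rw [h.kernelOp_eq]
  exact h.norm_toCLM_apply_le x

/-- The difference kernel q carries its own bound, so the remainder operator is estimated from its
kernel and not by the triangle inequality. -/
theorem kernelOp_sub_sum {κ q : Eucl N → Eucl N → ℂ} {ι : Type*} {I : Finset ι}
    {a : ι → Eucl N → Eucl N → ℂ} {c : ι → ℂ} {C C' : ℝ≥0} (hκ : KernelBound m κ C)
    (hq : KernelBound m q C') (ha : ∀ i ∈ I, ∃ C, KernelBound m (a i) C)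
    (hqe : ∀ ξ y, q ξ y = κ ξ y - ∑ i ∈ I, c i * a i ξ y) (x : WeightedL2 N m) :
    kernelOp m q x = kernelOp m κ x - ∑ i ∈ I, c i • kernelOp m (a i) x := by
  have hcoe : ∀ J ⊆ I, (∑ i ∈ J, c i • kernelOp m (a i) x : WeightedL2 N m)
      =ᵐ[weightMeasure N m] fun ξ => ∑ i ∈ J, c i * ∫ y, a i ξ y * x y := by
    classical
    intro J
    induction J using Finset.induction_on with
    | empty =>
      intro _
      filter_upwards [Lp.coeFn_zero ℂ 2 (weightMeasure N m)] with ξ hξ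
      simpa using hξ
    | insert i J hi ih =>
      intro hJ
      obtain ⟨Ci, hCi⟩ := ha i (hJ (Finset.mem_insert_self i J))
      rw [Finset.sum_insert hi]
      filter_upwards [ih ((Finset.subset_insert i J).trans hJ), hCi.coeFn_kernelOp x,
        Lp.coeFn_add (c i • kernelOp m (a i) x) (∑ i ∈ J, c i • kernelOp m (a i) x),
        Lp.coeFn_smul (c i) (kernelOp m (a i) x)] with ξ h1 h2 h3 h4
      rw [h3, Pi.add_apply, h4, Pi.smul_apply, h2, h1, Finset.sum_insert hi, smul_eq_mul]
  apply Lp.ext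
  have hint : ∀ᵐ ξ ∂weightMeasure N m, ∀ i ∈ I, Integrable fun y => a i ξ y * x y := by
    rw [Finset.eventually_all]
    intro i hi
    obtain ⟨Ci, hCi⟩ := ha i hi
    exact hCi.ae_integrable x
  filter_upwards [hcoe I subset_rfl, hκ.coeFn_kernelOp x, hq.coeFn_kernelOp x,
    Lp.coeFn_sub (kernelOp m κ x) (∑ i ∈ I, c i • kernelOp m (a i) x), hint,
    hκ.ae_integrable x] with ξ h1 h2 h3 h4 h5 h6
  rw [h3, h4, Pi.sub_apply, h1, h2]
  simp only [hqe, sub_mul, Finset.sum_mul, mul_assoc]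
  rw [integral_sub h6 (integrable_finsetSum _ fun i hi => (h5 i hi).const_mul (c i)),
    integral_finsetSum _ fun i hi => (h5 i hi).const_mul (c i)]
  simp only [integral_const_mul]

end KernelOperators


/-! ### The semigroup of `ℒ` in the weighted space -/

section Semigroup

open Filter Topology Set FourierTransform SchwartzMap

variable {N : ℕ} {m : ℝ≥0}

/-- The kernel of the semigroup `e^{tℒ}`, with `s = e^{-t/2}`. -/
def mehler (s : ℝ) (ξ y : Eucl N) : ℝ :=
  (4 * Real.pi * (1 - s ^ 2)) ^ (-(N / 2 : ℝ)) * Real.exp (-(‖ξ - s • y‖ ^ 2 / (4 * (1 - s ^ 2))))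

theorem one_sub_sq_pos {s : ℝ} (hs : s ∈ Ioo (0 : ℝ) 1) : 0 < 1 - s ^ 2 := by
  nlinarith [hs.1, hs.2]

theorem mehler_nonneg {s : ℝ} (hs : s ∈ Ioo (0 : ℝ) 1) (ξ y : Eucl N) : 0 ≤ mehler s ξ y := by
  have := one_sub_sq_pos hs
  unfold mehler
  positivity

theorem integrable_exp_neg_mul_norm_sq {b : ℝ} (hb : 0 < b) :
    Integrable fun v : Eucl N => Real.exp (-(b * ‖v‖ ^ 2)) := by
  have := GaussianFourier.integrable_cexp_neg_mul_sq_norm_add (V := Eucl N) (b := (b : ℂ))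
    (by simpa using hb) 0 0
  refine this.re.congr (.of_forall fun v => ?_)
  have : (-(b : ℂ) * (‖v‖ : ℂ) ^ 2 + 0 * (inner ℝ (0 : Eucl N) v : ℝ)) =
      ((-(b * ‖v‖ ^ 2) : ℝ) : ℂ) := by
    push_cast
    ring
  simp only [this]
  exact Complex.exp_ofReal_re _

theorem lintegral_exp_neg_mul_norm_sub_sq {b : ℝ} (hb : 0 < b) (a : Eucl N) :
    ∫⁻ v : Eucl N, ENNReal.ofReal (Real.exp (-(b * ‖v - a‖ ^ 2))) =
      ENNReal.ofReal ((Real.pi / b) ^ (N / 2 : ℝ)) := by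
  rw [lintegral_sub_right_eq_self (fun v : Eucl N => ENNReal.ofReal (Real.exp (-(b * ‖v‖ ^ 2)))) a,
    ← ofReal_integral_eq_lintegral_ofReal (integrable_exp_neg_mul_norm_sq hb)
      (.of_forall fun v => (Real.exp_pos _).le)]
  have := GaussianFourier.integral_rexp_neg_mul_sq_norm (V := Eucl N) hb
  simp only [neg_mul] at this
  rw [this, finrank_euclideanSpace_fin]

/-- In y the kernel is a Gaussian centred at s⁻¹ξ and widened by s⁻¹, whence the mass s^{-N}. -/
theorem lintegral_mehler_right {s : ℝ} (hs : s ∈ Ioo (0 : ℝ) 1) (ξ : Eucl N) :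
    ∫⁻ y, ENNReal.ofReal (mehler s ξ y) = ENNReal.ofReal ((s ^ N)⁻¹) := by
  have hτ := one_sub_sq_pos hs
  have hs0 := hs.1
  have h1 : ∀ y : Eucl N, ENNReal.ofReal (mehler s ξ y) =
      ENNReal.ofReal ((4 * Real.pi * (1 - s ^ 2)) ^ (-(N / 2 : ℝ))) *
      ENNReal.ofReal (Real.exp (-(s ^ 2 / (4 * (1 - s ^ 2)) * ‖y - s⁻¹ • ξ‖ ^ 2))) := by
    intro y
    rw [← ENNReal.ofReal_mul (by positivity), mehler]
    congr 4
    have : ξ - s • y = (-s) • (y - s⁻¹ • ξ) := by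
      rw [smul_sub, smul_smul, neg_mul, mul_inv_cancel₀ hs0.ne']
      simp
      abel
    rw [this, norm_smul, norm_neg, mul_pow, Real.norm_eq_abs, sq_abs]
    ring
  simp only [h1]
  rw [lintegral_const_mul' _ _ ENNReal.ofReal_ne_top,
    lintegral_exp_neg_mul_norm_sub_sq (by positivity), ← ENNReal.ofReal_mul (by positivity)]
  congr 1
  have hT : 0 < 4 * Real.pi * (1 - s ^ 2) := by positivity
  rw [show Real.pi / (s ^ 2 / (4 * (1 - s ^ 2))) = (4 * Real.pi * (1 - s ^ 2)) * (s ^ 2)⁻¹ by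
    field_simp]
  set T := 4 * Real.pi * (1 - s ^ 2)
  rw [Real.mul_rpow hT.le (by positivity), ← mul_assoc,
    ← Real.rpow_add (by positivity), neg_add_cancel, Real.rpow_zero, one_mul,
    Real.inv_rpow (by positivity), ← Real.rpow_natCast s 2, ← Real.rpow_mul hs0.le,
    ← Real.rpow_natCast s N]
  congr 2
  push_cast
  ring

/-- Peetre's inequality: with z = sy the weight at ξ splits into a weight of the displacement ξ -
sy, which the Gaussian absorbs, and the weight at sy. -/
theorem one_add_norm_sq_le (ξ z : Eucl N) :
    1 + ‖ξ‖ ^ 2 ≤ 2 * (1 + ‖ξ - z‖ ^ 2) * (1 + ‖z‖ ^ 2) := by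
  have h1 : ‖ξ‖ ≤ ‖ξ - z‖ + ‖z‖ := by simpa using norm_add_le (ξ - z) z
  have h2 := norm_nonneg ξ
  nlinarith [sq_nonneg (‖ξ - z‖ - ‖z‖), mul_nonneg (sq_nonneg ‖ξ - z‖) (sq_nonneg ‖z‖),
    norm_nonneg (ξ - z), norm_nonneg z]

/-- The rate 1/8 is half of the rate 1/4 in the kernel; the other half remains for integration. -/
theorem exists_one_add_rpow_le_exp (m : ℝ≥0) :
    ∃ C : ℝ, 0 < C ∧ ∀ t : ℝ, 0 ≤ t → (1 + t) ^ (m : ℝ) ≤ C * Real.exp (t / 8) := by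
  set k := ⌈(m : ℝ)⌉₊
  refine ⟨8 ^ k * k.factorial * Real.exp (1 / 8), by positivity, fun t ht => ?_⟩
  have h1 := Real.pow_div_factorial_le_exp (x := (1 + t) / 8) (by positivity) k
  rw [div_pow, div_div, div_le_iff₀ (by positivity)] at h1
  calc (1 + t) ^ (m : ℝ) ≤ (1 + t) ^ (k : ℝ) :=
        Real.rpow_le_rpow_of_exponent_le (by linarith) (Nat.le_ceil _)
    _ = (1 + t) ^ k := Real.rpow_natCast _ _
    _ ≤ _ := h1
    _ = _ := by rw [add_div, Real.exp_add]; ring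

/-- The kernel concentrates at ξ = sy, so the weight is transferred to sy and not to y. This keeps
the gain as s → 0. Uniformity up to s = 1 uses 1 - s² ≤ 1; the factor 2^{N/2} is the price of
halving the Gaussian rate. -/
theorem exists_lintegral_weight_mul_mehler_le (N : ℕ) (m : ℝ≥0) :
    ∃ C : ℝ≥0, ∀ s ∈ Ioo (0 : ℝ) 1, ∀ y : Eucl N,
      ∫⁻ ξ, weight N m ξ * ENNReal.ofReal (mehler s ξ y) ≤
        C * ENNReal.ofReal ((1 + s ^ 2 * ‖y‖ ^ 2) ^ (m : ℝ)) := by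
  obtain ⟨C, hC0, hC⟩ := exists_one_add_rpow_le_exp m
  refine ⟨(2 ^ (m : ℝ) * C * 2 ^ (N / 2 : ℝ)).toNNReal, fun s hs y => ?_⟩
  have hτ := one_sub_sq_pos hs
  have hs0 := hs.1
  set A : ℝ := 2 ^ (m : ℝ) * C * (1 + s ^ 2 * ‖y‖ ^ 2) ^ (m : ℝ) *
    (4 * Real.pi * (1 - s ^ 2)) ^ (-(N / 2 : ℝ)) with hA
  have hA0 : 0 ≤ A := by positivity
  have h1 : ∀ ξ : Eucl N, weight N m ξ * ENNReal.ofReal (mehler s ξ y) ≤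
      ENNReal.ofReal A *
        ENNReal.ofReal (Real.exp (-(1 / (8 * (1 - s ^ 2)) * ‖ξ - s • y‖ ^ 2))) := by
    intro ξ
    rw [weight, ← ENNReal.ofReal_mul (by positivity), ← ENNReal.ofReal_mul hA0]
    refine ENNReal.ofReal_le_ofReal ?_
    have h2 : (1 + ‖ξ‖ ^ 2) ^ (m : ℝ) ≤ 2 ^ (m : ℝ) * (1 + ‖ξ - s • y‖ ^ 2) ^ (m : ℝ) *
        (1 + s ^ 2 * ‖y‖ ^ 2) ^ (m : ℝ) := by
      rw [← Real.mul_rpow (by positivity) (by positivity),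
        ← Real.mul_rpow (by positivity) (by positivity)]
      refine Real.rpow_le_rpow (by positivity) ?_ m.coe_nonneg
      have := one_add_norm_sq_le ξ (s • y)
      rwa [norm_smul s y, mul_pow, Real.norm_eq_abs, sq_abs] at this
    have h3 := hC (‖ξ - s • y‖ ^ 2) (by positivity)
    have h4 : Real.exp (‖ξ - s • y‖ ^ 2 / 8) ≤
        Real.exp (1 / (8 * (1 - s ^ 2)) * ‖ξ - s • y‖ ^ 2) := by
      refine Real.exp_le_exp.2 ?_
      rw [div_eq_inv_mul, one_div]
      gcongr
      nlinarith
    have h5 : Real.exp (-(‖ξ - s • y‖ ^ 2 / (4 * (1 - s ^ 2)))) =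
        Real.exp (-(1 / (8 * (1 - s ^ 2)) * ‖ξ - s • y‖ ^ 2)) *
        Real.exp (-(1 / (8 * (1 - s ^ 2)) * ‖ξ - s • y‖ ^ 2)) := by
      rw [← Real.exp_add]
      congr 1
      field_simp
      ring
    rw [mehler, h5]
    set e := Real.exp (-(1 / (8 * (1 - s ^ 2)) * ‖ξ - s • y‖ ^ 2)) with he
    have h6 : Real.exp (1 / (8 * (1 - s ^ 2)) * ‖ξ - s • y‖ ^ 2) * e = 1 := by
      rw [he, ← Real.exp_add]; simp
    have he0 : 0 < e := Real.exp_pos _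
    set K := (4 * Real.pi * (1 - s ^ 2)) ^ (-(N / 2 : ℝ))
    have hK : 0 ≤ K := by positivity
    set Y := (1 + s ^ 2 * ‖y‖ ^ 2) ^ (m : ℝ)
    have hY : 0 ≤ Y := by positivity
    calc (1 + ‖ξ‖ ^ 2) ^ (m : ℝ) * (K * (e * e))
        ≤ 2 ^ (m : ℝ) * (C * Real.exp (1 / (8 * (1 - s ^ 2)) * ‖ξ - s • y‖ ^ 2)) * Y *
          (K * (e * e)) := by
          refine mul_le_mul_of_nonneg_right (h2.trans ?_) (by positivity)
          gcongr
          exact h3.trans (by gcongr)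
      _ = A * e * (Real.exp (1 / (8 * (1 - s ^ 2)) * ‖ξ - s • y‖ ^ 2) * e) := by
          rw [hA]; ring
      _ = A * e := by rw [h6, mul_one]
  refine (lintegral_mono h1).trans ?_
  rw [lintegral_const_mul' _ _ ENNReal.ofReal_ne_top,
    lintegral_exp_neg_mul_norm_sub_sq (by positivity), ← ENNReal.ofReal_mul hA0]
  change _ ≤ ENNReal.ofReal _ * _
  rw [← ENNReal.ofReal_mul (by positivity)]
  refine ENNReal.ofReal_le_ofReal (le_of_eq ?_)
  have hT : 0 < 4 * Real.pi * (1 - s ^ 2) := by positivity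
  rw [hA, show Real.pi / (1 / (8 * (1 - s ^ 2))) = 2 * (4 * Real.pi * (1 - s ^ 2)) by
    field_simp; ring]
  set T := 4 * Real.pi * (1 - s ^ 2)
  rw [Real.mul_rpow zero_le_two hT.le, Real.rpow_neg hT.le]
  have : T ^ (N / 2 : ℝ) ≠ 0 := by positivity
  field_simp

/-- Schur's test: Cauchy–Schwarz against the y-mass s^{-N}, then Tonelli and the weighted
ξ-integral. -/
theorem exists_lintegral_mehler_sq_le (N : ℕ) (m : ℝ≥0) :
    ∃ C : ℝ≥0, ∀ s ∈ Ioo (0 : ℝ) 1, ∀ g : Eucl N → ℝ≥0∞, Measurable g →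
      ∫⁻ ξ, (∫⁻ y, ENNReal.ofReal (mehler s ξ y) * g y) ^ 2 ∂weightMeasure N m ≤
        C * ENNReal.ofReal ((s ^ N)⁻¹) *
          ∫⁻ y, ENNReal.ofReal ((1 + s ^ 2 * ‖y‖ ^ 2) ^ (m : ℝ)) * g y ^ 2 := by
  obtain ⟨C, hC⟩ := exists_lintegral_weight_mul_mehler_le N m
  refine ⟨C, fun s hs g hg => ?_⟩
  have hk : Measurable fun p : Eucl N × Eucl N => ENNReal.ofReal (mehler s p.1 p.2) :=
    by
    unfold mehler
    fun_prop
  have hkξ : ∀ ξ : Eucl N, Measurable fun y => ENNReal.ofReal (mehler s ξ y) := fun ξ => by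
    unfold mehler
    fun_prop
  have hin : Measurable fun ξ : Eucl N => ∫⁻ y, ENNReal.ofReal (mehler s ξ y) * g y :=
    Measurable.lintegral_prod_right'
      (f := fun p : Eucl N × Eucl N => ENNReal.ofReal (mehler s p.1 p.2) * g p.2)
      (hk.mul (hg.comp measurable_snd))
  rw [lintegral_weightMeasure (hin.pow_const 2)]
  calc ∫⁻ ξ, weight N m ξ * (∫⁻ y, ENNReal.ofReal (mehler s ξ y) * g y) ^ 2
      ≤ ∫⁻ ξ, weight N m ξ * (ENNReal.ofReal ((s ^ N)⁻¹) *
          ∫⁻ y, ENNReal.ofReal (mehler s ξ y) * g y ^ 2) := by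
        have h1 : ∀ ξ : Eucl N, (∫⁻ y, ENNReal.ofReal (mehler s ξ y) * g y) ^ 2 ≤
            ENNReal.ofReal ((s ^ N)⁻¹) * ∫⁻ y, ENNReal.ofReal (mehler s ξ y) * g y ^ 2 := by
          intro ξ
          rw [← lintegral_mehler_right hs ξ]
          exact ENNReal.lintegral_mul_sq_le_mul_lintegral (hkξ ξ) hg
        exact lintegral_mono fun ξ => mul_le_mul_right (h1 ξ) _
    _ = ENNReal.ofReal ((s ^ N)⁻¹) * ∫⁻ ξ, ∫⁻ y, weight N m ξ *
          (ENNReal.ofReal (mehler s ξ y) * g y ^ 2) := by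
        rw [← lintegral_const_mul' _ _ ENNReal.ofReal_ne_top]
        congr with ξ
        rw [lintegral_const_mul' _ _ (weight_ne_top ξ)]
        ring
    _ = ENNReal.ofReal ((s ^ N)⁻¹) * ∫⁻ y, ∫⁻ ξ, weight N m ξ *
          (ENNReal.ofReal (mehler s ξ y) * g y ^ 2) := by
        rw [lintegral_lintegral_swap]
        exact ((measurable_weight.comp measurable_fst).mul
          (hk.mul ((hg.comp measurable_snd).pow_const 2))).aemeasurable
    _ = ENNReal.ofReal ((s ^ N)⁻¹) * ∫⁻ y, (∫⁻ ξ, weight N m ξ *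
          ENNReal.ofReal (mehler s ξ y)) * g y ^ 2 := by
        congr 2 with y
        simp only [← mul_assoc]
        rw [lintegral_mul_const]
        refine measurable_weight.mul ?_
        unfold mehler
        fun_prop
    _ ≤ ENNReal.ofReal ((s ^ N)⁻¹) * ∫⁻ y, (C * ENNReal.ofReal ((1 + s ^ 2 * ‖y‖ ^ 2) ^ (m : ℝ)))
          * g y ^ 2 := by
        gcongr with y
        exact hC s hs y
    _ = _ := by
        simp only [mul_assoc]
        rw [lintegral_const_mul' _ _ ENNReal.coe_ne_top]
        ring

/-- The kernel of the semigroup as a complex-valued function. -/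
def mehlerC (s : ℝ) (ξ y : Eucl N) : ℂ := (mehler s ξ y : ℂ)

theorem enorm_mehlerC {s : ℝ} (hs : s ∈ Ioo (0 : ℝ) 1) (ξ y : Eucl N) :
    ‖mehlerC s ξ y‖ₑ = ENNReal.ofReal (mehler s ξ y) := by
  rw [mehlerC, ← ofReal_norm, Complex.norm_real, Real.norm_of_nonneg (mehler_nonneg hs ξ y)]

theorem measurable_uncurry_mehlerC (s : ℝ) :
    Measurable (Function.uncurry (mehlerC s : Eucl N → Eucl N → ℂ)) := by
  unfold mehlerC mehler Function.uncurry
  fun_prop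

theorem exists_kernelBound_mehlerC (m : ℝ≥0) {s : ℝ} (hs : s ∈ Ioo (0 : ℝ) 1) :
    ∃ C, KernelBound m (mehlerC s : Eucl N → Eucl N → ℂ) C := by
  obtain ⟨C, hC⟩ := exists_lintegral_mehler_sq_le N m
  have hs0 := hs.1
  refine ⟨NNReal.sqrt (C * ((s ^ N)⁻¹).toNNReal), measurable_uncurry_mehlerC s, fun g hg => ?_⟩
  simp only [enorm_mehlerC hs]
  refine (hC s hs g hg).trans ?_
  rw [lintegral_weightMeasure (hg.pow_const 2), ← ENNReal.coe_pow, NNReal.sq_sqrt, ENNReal.coe_mul]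
  refine mul_le_mul_right (lintegral_mono fun y => mul_le_mul_left (ENNReal.ofReal_le_ofReal ?_) _) _
  refine Real.rpow_le_rpow (by positivity) ?_ m.coe_nonneg
  have h2 := one_sub_sq_pos hs
  nlinarith [mul_nonneg h2.le (sq_nonneg ‖y‖)]

/-- The semigroup `e^{tℒ}`, with `s = e^{-t/2}`. -/
def semigroupL (m : ℝ≥0) (s : ℝ) : WeightedL2 N m →L[ℂ] WeightedL2 N m :=
  kernelOp m (mehlerC s)

theorem coeFn_semigroupL {s : ℝ} (hs : s ∈ Ioo (0 : ℝ) 1) (x : WeightedL2 N m) :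
    semigroupL m s x =ᵐ[weightMeasure N m] fun ξ => ∫ y, mehlerC s ξ y * x y := by
  obtain ⟨C, hC⟩ := exists_kernelBound_mehlerC (N := N) m hs
  exact hC.coeFn_kernelOp x

theorem KernelBound.integrable_mul_kernel {κ : Eucl N → Eucl N → ℂ} {C : ℝ≥0}
    (h : KernelBound m κ C) (φ : 𝓢(Eucl N, ℂ)) (x : WeightedL2 N m) :
    Integrable (fun p : Eucl N × Eucl N => φ p.1 * (κ p.1 p.2 * x p.2))
      (volume.prod volume) := by
  have hm : Measurable fun p : Eucl N × Eucl N => φ p.1 * (κ p.1 p.2 * x p.2) :=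
    (φ.continuous.measurable.comp measurable_fst).mul
      (h.measurable.mul ((measurable_coe x).comp measurable_snd))
  refine ⟨hm.aestronglyMeasurable, ?_⟩
  rw [hasFiniteIntegral_iff_enorm, lintegral_prod _ hm.enorm.aemeasurable]
  simp only [enorm_mul]
  have h1 : ∀ ξ, ∫⁻ y, ‖φ ξ‖ₑ * (‖κ ξ y‖ₑ * ‖x y‖ₑ) =
      ‖φ ξ‖ₑ * ∫⁻ y, ‖κ ξ y‖ₑ * ‖x y‖ₑ := fun ξ => lintegral_const_mul' _ _ enorm_ne_top
  simp only [h1]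
  have h2 := ENNReal.lintegral_mul_sq_le (μ := volume) (φ.continuous.measurable.enorm)
    (h.measurable_lintegral (measurable_coe x).enorm)
  have h3 : ∫⁻ ξ, ‖φ ξ‖ₑ ^ 2 < ∞ := by
    rw [← eLpNorm_two_sq]
    exact ENNReal.pow_lt_top (φ.memLp 2 volume).2
  have h4 : ∫⁻ ξ, (∫⁻ y, ‖κ ξ y‖ₑ * ‖x y‖ₑ) ^ 2 < ∞ := by
    refine (lintegral_mono' (volume_le_weightMeasure N m) le_rfl).trans_lt ?_
    refine (h.bound _ (measurable_coe x).enorm).trans_lt ?_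
    rw [lintegral_enorm_sq]
    exact ENNReal.mul_lt_top (by simp) (by simp)
  have h5 := h2.trans_lt (ENNReal.mul_lt_top h3 h4)
  by_contra htop
  rw [not_lt, top_le_iff] at htop
  rw [htop] at h5
  simp at h5

theorem fourier_mehlerC {s : ℝ} (hs : s ∈ Ioo (0 : ℝ) 1) (y p : Eucl N) :
    𝓕 (fun ξ : Eucl N => mehlerC s ξ y) p =
      Complex.exp (-(2 * Real.pi * s * inner ℝ p y) * Complex.I) *
        Real.exp (-(4 * Real.pi ^ 2 * (1 - s ^ 2) * ‖p‖ ^ 2)) := by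
  have hτ := one_sub_sq_pos hs
  rw [Real.fourier_eq', ← integral_add_right_eq_self _ (s • y)]
  have h1 : ∀ v : Eucl N, Complex.exp ((-2 * Real.pi * inner ℝ (v + s • y) p : ℝ) * Complex.I) •
      mehlerC s (v + s • y) y = Complex.exp (-(2 * Real.pi * s * inner ℝ p y) * Complex.I) *
        ((4 * Real.pi * (1 - s ^ 2)) ^ (-(N / 2 : ℝ)) : ℝ) *
        (Complex.exp ((-2 * Real.pi * inner ℝ v p : ℝ) * Complex.I) •
          Complex.exp (-((1 / (4 * (1 - s ^ 2)) : ℝ) : ℂ) * ‖v‖ ^ 2)) := by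
    intro v
    have h2 : ((-2 * Real.pi * inner ℝ (v + s • y) p : ℝ) : ℂ) * Complex.I =
        -(2 * Real.pi * s * inner ℝ p y) * Complex.I +
          ((-2 * Real.pi * inner ℝ v p : ℝ) : ℂ) * Complex.I := by
      rw [inner_add_left, inner_smul_left, real_inner_comm y p]
      simp
      ring
    have h3 : mehlerC s (v + s • y) y = ((4 * Real.pi * (1 - s ^ 2)) ^ (-(N / 2 : ℝ)) : ℝ) *
        Complex.exp (-((1 / (4 * (1 - s ^ 2)) : ℝ) : ℂ) * ‖v‖ ^ 2) := by
      rw [mehlerC, mehler, add_sub_cancel_right, Complex.ofReal_mul, Complex.ofReal_exp]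
      congr 2
      push_cast
      ring
    rw [h2, Complex.exp_add, h3, smul_eq_mul, smul_eq_mul]
    ring
  simp only [h1]
  rw [integral_const_mul, ← Real.fourier_eq',
    fourier_gaussian_innerProductSpace (by rw [Complex.ofReal_re]; positivity),
    finrank_euclideanSpace_fin, mul_assoc]
  congr 1
  have h4 : (Real.pi / ((1 / (4 * (1 - s ^ 2)) : ℝ) : ℂ)) ^ ((N : ℂ) / 2) =
      (((4 * Real.pi * (1 - s ^ 2)) ^ (N / 2 : ℝ) : ℝ) : ℂ) := by
    rw [Complex.ofReal_cpow (by positivity)]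
    congr 1
    · push_cast
      field_simp
    · push_cast
      ring
  rw [h4, ← mul_assoc, ← Complex.ofReal_mul, Real.rpow_neg (by positivity),
    inv_mul_cancel₀ (by positivity), Complex.ofReal_one, one_mul, Complex.ofReal_exp]
  congr 1
  have : ((1 - s ^ 2 : ℝ) : ℂ) ≠ 0 := by exact_mod_cast hτ.ne'
  push_cast at this ⊢
  field_simp

theorem integrable_mehlerC_left {s : ℝ} (hs : s ∈ Ioo (0 : ℝ) 1) (y : Eucl N) :
    Integrable fun ξ : Eucl N => mehlerC s ξ y := by
  have hτ := one_sub_sq_pos hs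
  have h1 := ((integrable_exp_neg_mul_norm_sq (N := N)
    (show 0 < 1 / (4 * (1 - s ^ 2)) by positivity)).comp_sub_right (s • y)).const_mul
      ((4 * Real.pi * (1 - s ^ 2)) ^ (-(N / 2 : ℝ)))
  refine h1.ofReal.congr (.of_forall fun ξ => ?_)
  simp only [mehlerC, mehler]
  congr 4
  ring

/-- The Fourier transform is moved from ψ to the kernel; the substitution q = sp then turns the
phase e^{-2πi s p·y} into that of a Fourier transform at y. -/
theorem integral_fourier_mul_mehlerC {s : ℝ} (hs : s ∈ Ioo (0 : ℝ) 1) (ψ : 𝓢(Eucl N, ℂ))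
    (y : Eucl N) : ∫ ξ, 𝓕 ψ ξ * mehlerC s ξ y = 𝓕 (dualS s ψ) y := by
  have hs' : s ∈ Ioc (0 : ℝ) 1 := ⟨hs.1, hs.2.le⟩
  have hs0 := hs.1
  have h1 : ∫ ξ, 𝓕 ψ ξ * mehlerC s ξ y = ∫ p, ψ p * 𝓕 (fun ξ : Eucl N => mehlerC s ξ y) p := by
    have := VectorFourier.integral_fourierIntegral_smul_eq_flip (L := innerₗ (Eucl N))
      (μ := volume) (ν := volume) Real.continuous_fourierChar
      (show Continuous fun p : Eucl N × Eucl N => innerₗ (Eucl N) p.1 p.2 from continuous_inner)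
      ψ.integrable (integrable_mehlerC_left hs y)
    simp only [flip_innerₗ] at this
    exact this
  rw [h1, fourier_coe, Real.fourier_eq']
  have h2 := Measure.integral_comp_smul (volume : Measure (Eucl N))
    (fun v : Eucl N => Complex.exp ((-2 * Real.pi * inner ℝ v y : ℝ) * Complex.I) • dualS s ψ v) s
  rw [finrank_euclideanSpace_fin, abs_of_pos (by positivity)] at h2
  have h3 : ∫ v : Eucl N, Complex.exp ((-2 * Real.pi * inner ℝ v y : ℝ) * Complex.I) • dualS s ψ v
      = (s ^ N : ℝ) • ∫ v : Eucl N,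
        Complex.exp ((-2 * Real.pi * inner ℝ (s • v) y : ℝ) * Complex.I) • dualS s ψ (s • v) := by
    rw [h2, smul_smul, mul_inv_cancel₀ (by positivity), one_smul]
  rw [h3, ← integral_smul]
  refine integral_congr_ae (.of_forall fun p => ?_)
  simp only
  have h4 : (Real.exp (-(4 * Real.pi ^ 2 * (s⁻¹ ^ 2 - 1) * (s * ‖p‖) ^ 2))) =
      Real.exp (-(4 * Real.pi ^ 2 * (1 - s ^ 2) * ‖p‖ ^ 2)) := by
    congr 1
    field_simp
  have h5 : ((-2 * Real.pi * inner ℝ (s • p) y : ℝ) : ℂ) * Complex.I =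
      -(2 * Real.pi * s * inner ℝ p y) * Complex.I := by
    rw [inner_smul_left]
    simp
    ring
  have hsN : ((s : ℂ) ^ N) ≠ 0 := pow_ne_zero _ (by exact_mod_cast hs0.ne')
  rw [fourier_mehlerC hs, dualS_apply hs', smul_smul, inv_mul_cancel₀ hs0.ne', one_smul, norm_smul,
    Real.norm_of_nonneg hs0.le, h4, h5, smul_eq_mul, Complex.real_smul, Complex.ofReal_pow]
  field_simp

/-- The semigroup on the Fourier side. -/
theorem testFunctional_semigroupL {s : ℝ} (hs : s ∈ Ioo (0 : ℝ) 1) (ψ : 𝓢(Eucl N, ℂ))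
    (x : WeightedL2 N m) :
    testFunctional m ψ (semigroupL m s x) = testFunctional m (dualS s ψ) x := by
  obtain ⟨C, hC⟩ := exists_kernelBound_mehlerC (N := N) m hs
  rw [testFunctional_apply, testFunctional_apply]
  have h1 : ∫ ξ, 𝓕 ψ ξ * semigroupL m s x ξ =
      ∫ ξ, ∫ y, 𝓕 ψ ξ * (mehlerC s ξ y * x y) := by
    refine integral_congr_ae ?_
    filter_upwards [volume_absolutelyContinuous_weightMeasure.ae_le (coeFn_semigroupL hs x)]
      with ξ hξ
    rw [hξ, integral_const_mul]
  rw [h1, integral_integral_swap (hC.integrable_mul_kernel (𝓕 ψ) x)]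
  refine integral_congr_ae (.of_forall fun y => ?_)
  simp only [← mul_assoc]
  rw [integral_mul_const, integral_fourier_mul_mehlerC hs]

end Semigroup


/-! ### Taylor expansion of the kernel -/

/-- The `k`-th Taylor coefficient at `0`, as a Cauchy integral. -/
def circleCoeff (f : ℂ → ℂ) (ρ : ℝ) (k : ℕ) : ℂ :=
  (2 * Real.pi * Complex.I : ℂ)⁻¹ • ∮ z in C(0, ρ), z⁻¹ ^ k • z⁻¹ • f z

theorem norm_circleCoeff_le {f : ℂ → ℂ} {ρ B : ℝ} (hρ : 0 < ρ) (hf : ∀ z, ‖z‖ = ρ → ‖f z‖ ≤ B)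
    (k : ℕ) : ‖circleCoeff f ρ k‖ ≤ B * ρ⁻¹ ^ k := by
  refine (circleIntegral.norm_two_pi_i_inv_smul_integral_le_of_norm_le_const
    (C := ρ⁻¹ ^ k * (ρ⁻¹ * B)) hρ.le fun z hz => ?_).trans_eq ?_
  · rw [mem_sphere_zero_iff_norm] at hz
    rw [norm_smul, norm_smul, norm_pow, norm_inv, hz]
    gcongr
    exact hf z hz
  · field_simp

/-- Cauchy estimates and a geometric tail; |w| ≤ ρ/2 makes the ratio at most 1/2 and the sum at most
2. -/
theorem norm_sub_sum_circleCoeff_le {f : ℂ → ℂ} {ρ B : ℝ} (hρ : 0 < ρ)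
    (hd : DifferentiableOn ℂ f (Metric.closedBall 0 ρ)) (hf : ∀ z, ‖z‖ = ρ → ‖f z‖ ≤ B)
    {w : ℂ} (hw : ‖w‖ ≤ ρ / 2) (M : ℕ) :
    ‖f w - ∑ k ∈ Finset.range M, w ^ k * circleCoeff f ρ k‖ ≤ 2 * B * (‖w‖ / ρ) ^ M := by
  have hw' : ‖w‖ < ρ := by linarith
  have hc : CircleIntegrable f 0 ρ :=
    (hd.continuousOn.mono Metric.sphere_subset_closedBall).circleIntegrable hρ.le
  have hs : HasSum (fun k => w ^ k * circleCoeff f ρ k) (f w) := by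
    have h1 := hasSum_cauchyPowerSeries_integral hc hw'
    rw [zero_add, hd.circleIntegral_sub_inv_smul (mem_ball_zero_iff.2 hw'), smul_smul,
      inv_mul_cancel₀ Complex.two_pi_I_ne_zero, one_smul] at h1
    simp only [cauchyPowerSeries, ContinuousMultilinearMap.mkPiRing_apply, Fin.prod_const,
      sub_zero] at h1
    exact h1
  have hB : 0 ≤ B := by
    have := hf ρ (by rw [Complex.norm_real, Real.norm_of_nonneg hρ.le])
    exact (norm_nonneg _).trans this
  have hq : ‖w‖ / ρ ≤ 1 / 2 := by rw [div_le_iff₀ hρ]; linarith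
  have hq0 : 0 ≤ ‖w‖ / ρ := by positivity
  have ht := (hasSum_nat_add_iff' M).2 hs
  have hg : HasSum (fun k : ℕ => B * (‖w‖ / ρ) ^ M * (1 / 2) ^ k) (B * (‖w‖ / ρ) ^ M * 2) :=
    hasSum_geometric_two.mul_left _
  rw [show 2 * B * (‖w‖ / ρ) ^ M = B * (‖w‖ / ρ) ^ M * 2 by ring]
  refine ht.norm_le_of_bounded hg fun k => ?_
  rw [norm_mul, norm_pow]
  calc ‖w‖ ^ (k + M) * ‖circleCoeff f ρ (k + M)‖ ≤ ‖w‖ ^ (k + M) * (B * ρ⁻¹ ^ (k + M)) := by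
        gcongr
        exact norm_circleCoeff_le hρ hf _
    _ = B * (‖w‖ / ρ) ^ M * (‖w‖ / ρ) ^ k := by
        rw [div_eq_mul_inv, mul_pow, mul_pow, pow_add, pow_add]; ring
    _ ≤ _ := by gcongr

section Kernel

open Filter Topology Set FourierTransform SchwartzMap

variable {N : ℕ} {m : ℝ≥0}

/-- The kernel `mehler` continued to complex parameters. -/
def mehlerExt (σ : ℂ) (ξ y : Eucl N) : ℂ :=
  (4 * Real.pi * (1 - σ ^ 2)) ^ (((-(N / 2 : ℝ)) : ℝ) : ℂ) *
    Complex.exp (-((‖ξ‖ ^ 2 - 2 * σ * inner ℝ ξ y + σ ^ 2 * ‖y‖ ^ 2) / (4 * (1 - σ ^ 2))))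

theorem mehlerExt_ofReal {s : ℝ} (hs : s ∈ Ioo (0 : ℝ) 1) (ξ y : Eucl N) :
    mehlerExt s ξ y = mehlerC s ξ y := by
  have hτ := one_sub_sq_pos hs
  rw [mehlerExt, mehlerC, mehler, norm_sub_sq_real, norm_smul, inner_smul_right, mul_pow,
    Real.norm_eq_abs, sq_abs, Complex.ofReal_mul, Complex.ofReal_cpow (by positivity)]
  push_cast
  congr 4
  ring

theorem differentiableOn_mehlerExt {ρ : ℝ} (hρ : ρ ≤ 1 / 2) (ξ y : Eucl N) :
    DifferentiableOn ℂ (fun σ => mehlerExt σ ξ y) (Metric.closedBall 0 ρ) := by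
  intro σ hσ
  rw [mem_closedBall_zero_iff] at hσ
  have h1 : ‖σ ^ 2‖ ≤ 1 / 4 := by
    rw [norm_pow]
    nlinarith [norm_nonneg σ]
  have h2 : 0 < (1 - σ ^ 2).re := by
    have := (Complex.abs_re_le_norm (σ ^ 2)).trans h1
    rw [abs_le] at this
    rw [Complex.sub_re, Complex.one_re]
    linarith
  have h3 : 1 - σ ^ 2 ≠ 0 := fun h => by simp [h] at h2
  have h4 : 4 * Real.pi * (1 - σ ^ 2) ∈ Complex.slitPlane := by
    left
    rw [show (4 * Real.pi : ℂ) = ((4 * Real.pi : ℝ) : ℂ) by push_cast; ring, Complex.re_ofReal_mul]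
    positivity
  refine DifferentiableAt.differentiableWithinAt ?_
  unfold mehlerExt
  refine DifferentiableAt.mul (DifferentiableAt.cpow (by fun_prop) (by fun_prop) h4) ?_
  refine (DifferentiableAt.div (by fun_prop) (by fun_prop) ?_).fun_neg.cexp
  simpa using h3

/-- The radius shrinks with y so that |σ| and |σ||y| are at most 1/2. The cross term then costs only
O(|ξ|) in the exponent, and the quadratic term pays for it down to the rate 1/8. -/
theorem norm_mehlerExt_le {σ : ℂ} {ξ y : Eucl N} (hσ : ‖σ‖ ≤ 1 / (2 * (1 + ‖y‖))) :
    ‖mehlerExt σ ξ y‖ ≤ Real.exp 1 * Real.exp (-(‖ξ‖ ^ 2 / 8)) := by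
  have hy := norm_nonneg y
  have hσ0 := norm_nonneg σ
  have hσ1 : ‖σ‖ * ‖y‖ ≤ 1 / 2 ∧ ‖σ‖ ≤ 1 / 2 := by
    rw [le_div_iff₀ (by positivity)] at hσ
    constructor <;> nlinarith
  have h1 : ‖σ ^ 2‖ ≤ 1 / 4 := by
    rw [norm_pow]
    nlinarith
  have hre := Complex.abs_re_le_norm (σ ^ 2)
  rw [abs_le] at hre
  set v := 1 - σ ^ 2 with hv
  have hv1 : 3 / 4 ≤ ‖v‖ := by
    have := norm_sub_norm_le (1 : ℂ) (σ ^ 2)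
    rw [norm_one] at this
    linarith
  have hv2 : ‖v‖ ≤ 5 / 4 := by
    have := norm_sub_le (1 : ℂ) (σ ^ 2)
    rw [norm_one] at this
    linarith
  have hv0 : 0 < ‖v‖ := by linarith
  -- Inversion maps the disc |v - 1| ≤ 1/4 to the disc with real diameter [4/5, 4/3].
  have hvr : 4 / 5 ≤ (v⁻¹).re := by
    rw [Complex.inv_re, le_div_iff₀ (Complex.normSq_pos.2 (norm_pos_iff.1 hv0))]
    have e1 : Complex.normSq v = 1 - 2 * (σ ^ 2).re + ‖σ ^ 2‖ ^ 2 := by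
      rw [← Complex.normSq_eq_norm_sq, hv, Complex.normSq_sub, map_one, one_mul, Complex.conj_re]
      ring
    have e2 : v.re = 1 - (σ ^ 2).re := by rw [hv]; simp
    rw [e1, e2]
    nlinarith [norm_nonneg (σ ^ 2)]
  have hvi : ‖v⁻¹‖ ≤ 4 / 3 := by
    rw [norm_inv, inv_le_comm₀ hv0 (by norm_num)]
    linarith
  rw [mehlerExt, norm_mul, Complex.norm_exp, Complex.norm_cpow_real, ← Real.exp_add,
    ← one_mul (Real.exp (1 + _))]
  refine mul_le_mul ?_ (Real.exp_le_exp.2 ?_) (Real.exp_pos _).le zero_le_one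
  · refine Real.rpow_le_one_of_one_le_of_nonpos ?_ (by simp; positivity)
    rw [norm_mul, norm_mul, Complex.norm_real, Real.norm_of_nonneg Real.pi_pos.le]
    norm_num
    nlinarith [Real.pi_gt_three]
  · have e1 : -(((‖ξ‖ : ℂ) ^ 2 - 2 * σ * inner ℝ ξ y + σ ^ 2 * ‖y‖ ^ 2) / (4 * v)) =
        ((-(‖ξ‖ ^ 2 / 4) : ℝ) : ℂ) * v⁻¹ +
          (2 * σ * inner ℝ ξ y - σ ^ 2 * ‖y‖ ^ 2) / 4 * v⁻¹ := by
      push_cast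
      rw [div_eq_mul_inv, mul_inv]
      ring
    rw [e1, Complex.add_re, Complex.re_ofReal_mul]
    have h2 : ‖2 * σ * inner ℝ ξ y - σ ^ 2 * ‖y‖ ^ 2‖ ≤ ‖ξ‖ + 1 / 4 := by
      refine (norm_sub_le _ _).trans ?_
      simp only [norm_mul, norm_pow, Complex.norm_real, norm_norm, Complex.norm_ofNat]
      have := norm_inner_le_norm (𝕜 := ℝ) ξ y
      have h3 : ‖σ‖ ^ 2 * ‖y‖ ^ 2 ≤ 1 / 4 := by
        rw [← mul_pow]
        nlinarith [mul_nonneg hσ0 hy]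
      have h4 : ‖σ‖ * ‖inner ℝ ξ y‖ ≤ ‖ξ‖ / 2 := by
        calc ‖σ‖ * ‖inner ℝ ξ y‖ ≤ ‖σ‖ * (‖ξ‖ * ‖y‖) := by gcongr
          _ = ‖σ‖ * ‖y‖ * ‖ξ‖ := by ring
          _ ≤ 1 / 2 * ‖ξ‖ := by gcongr; exact hσ1.1
          _ = _ := by ring
      linarith
    have h3 : ((2 * σ * inner ℝ ξ y - σ ^ 2 * ‖y‖ ^ 2) / 4 * v⁻¹).re ≤ (‖ξ‖ + 1 / 4) / 4 * (4 / 3) := by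
      refine (Complex.re_le_norm _).trans ?_
      rw [norm_mul, norm_div, Complex.norm_ofNat]
      gcongr
    nlinarith [sq_nonneg ‖ξ‖, sq_nonneg (‖ξ‖ - 2), mul_nonneg (sq_nonneg ‖ξ‖) (sub_nonneg.2 hvr)]

/-- The Taylor coefficients at `s = 0` of the kernel `mehlerC s ξ y`. -/
def mehlerCoeff (k : ℕ) (ξ y : Eucl N) : ℂ :=
  circleCoeff (fun σ => mehlerExt σ ξ y) (1 / (2 * (1 + ‖y‖))) k

theorem measurable_mehlerCoeff (k : ℕ) :
    Measurable (Function.uncurry (mehlerCoeff k : Eucl N → Eucl N → ℂ)) := by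
  unfold mehlerCoeff circleCoeff circleIntegral Function.uncurry
  simp only [intervalIntegral.integral_of_le Real.two_pi_pos.le, deriv_circleMap]
  refine Measurable.const_smul (M := ℂ) (X := ℂ) ?_ _
  refine StronglyMeasurable.measurable ?_
  refine StronglyMeasurable.integral_prod_right' (f := fun p : (Eucl N × Eucl N) × ℝ =>
    (circleMap 0 (1 / (2 * (1 + ‖p.1.2‖))) p.2 * Complex.I) •
      (circleMap 0 (1 / (2 * (1 + ‖p.1.2‖))) p.2)⁻¹ ^ k •
        (circleMap 0 (1 / (2 * (1 + ‖p.1.2‖))) p.2)⁻¹ •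
          mehlerExt (circleMap 0 (1 / (2 * (1 + ‖p.1.2‖))) p.2) p.1.1 p.1.2) ?_
  refine Measurable.stronglyMeasurable ?_
  unfold mehlerExt circleMap
  fun_prop

theorem norm_mehlerCoeff_le (k : ℕ) (ξ y : Eucl N) :
    ‖mehlerCoeff k ξ y‖ ≤ Real.exp 1 * Real.exp (-(‖ξ‖ ^ 2 / 8)) * (2 * (1 + ‖y‖)) ^ k := by
  have := norm_circleCoeff_le (f := fun σ => mehlerExt σ ξ y) (ρ := 1 / (2 * (1 + ‖y‖)))
    (by positivity) (fun z hz => norm_mehlerExt_le hz.le) k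
  rw [one_div, inv_inv, ← one_div] at this
  exact this

/-- The remainder of the Taylor expansion of the kernel. -/
def mehlerRem (M : ℕ) (s : ℝ) (ξ y : Eucl N) : ℂ :=
  mehlerC s ξ y - ∑ k ∈ Finset.range M, (s : ℂ) ^ k * mehlerCoeff k ξ y

theorem measurable_mehlerRem (M : ℕ) (s : ℝ) :
    Measurable (Function.uncurry (mehlerRem M s : Eucl N → Eucl N → ℂ)) :=
  (measurable_uncurry_mehlerC s).sub <| Finset.measurable_fun_sum _ fun k _ =>
    (measurable_mehlerCoeff k).const_mul _

/-- With t = 4s(1 + |y|), the point s lies within half the radius of the Cauchy circle exactly when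
t ≤ 1; there the Taylor estimate gives (t/2)^M ≤ t^β, as β ≤ M. For t > 1 the kernel itself is kept,
and each Taylor term is at most a multiple of t^k ≤ t^β, as k ≤ β. -/
theorem norm_mehlerRem_le {M : ℕ} {β : ℝ} (hM : ∀ k < M, (k : ℝ) ≤ β) (hβ : β ≤ M)
    {s : ℝ} (hs : s ∈ Ioo (0 : ℝ) 1) (ξ y : Eucl N) :
    ‖mehlerRem M s ξ y‖ ≤
      (M + 2) * Real.exp 1 * (4 * s * (1 + ‖y‖)) ^ β * Real.exp (-(‖ξ‖ ^ 2 / 8)) +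
        {y : Eucl N | 1 < 4 * s * (1 + ‖y‖)}.indicator (mehler s ξ) y := by
  have hs0 := hs.1
  have hy := norm_nonneg y
  set e := Real.exp (-(‖ξ‖ ^ 2 / 8))
  set t := 4 * s * (1 + ‖y‖) with ht
  have ht0 : 0 < t := by positivity
  have hρ : (0 : ℝ) < 1 / (2 * (1 + ‖y‖)) := by positivity
  have hst : s / (1 / (2 * (1 + ‖y‖))) = t / 2 := by
    rw [ht]; field_simp; ring
  by_cases hc : 1 < t
  · rw [indicator_of_mem (by exact hc), mehlerRem, add_comm]
    refine (norm_sub_le _ _).trans (add_le_add ?_ ?_)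
    · rw [mehlerC, Complex.norm_real, Real.norm_of_nonneg (mehler_nonneg hs ξ y)]
    · have h1 : ∀ k ∈ Finset.range M, ‖(s : ℂ) ^ k * mehlerCoeff k ξ y‖ ≤
          Real.exp 1 * t ^ β * e := by
        intro k hk
        rw [norm_mul, norm_pow, Complex.norm_real, Real.norm_of_nonneg hs0.le]
        calc s ^ k * ‖mehlerCoeff k ξ y‖ ≤ s ^ k * (Real.exp 1 * e * (2 * (1 + ‖y‖)) ^ k) := by
              gcongr
              exact norm_mehlerCoeff_le k ξ y
          _ = Real.exp 1 * (s * (2 * (1 + ‖y‖))) ^ k * e := by rw [mul_pow s]; ring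
          _ ≤ Real.exp 1 * t ^ k * e := by
              gcongr
              rw [ht]
              nlinarith
          _ ≤ Real.exp 1 * t ^ β * e := by
              gcongr
              rw [← Real.rpow_natCast]
              exact Real.rpow_le_rpow_of_exponent_le hc.le (hM k (Finset.mem_range.1 hk))
      refine (norm_sum_le_of_le _ h1).trans ?_
      rw [Finset.sum_const, Finset.card_range, nsmul_eq_mul]
      have : 0 ≤ Real.exp 1 * t ^ β * e := by positivity
      nlinarith
  · rw [indicator_of_notMem (by exact hc), add_zero, mehlerRem, ← mehlerExt_ofReal hs]
    have h1 := norm_sub_sum_circleCoeff_le hρ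
      (differentiableOn_mehlerExt (by rw [div_le_div_iff₀] <;> linarith) ξ y)
      (fun z hz => norm_mehlerExt_le hz.le) (w := s) (M := M) (by
        rw [Complex.norm_real, Real.norm_of_nonneg hs0.le]
        rw [div_eq_iff hρ.ne'] at hst
        nlinarith [not_lt.1 hc])
    rw [Complex.norm_real, Real.norm_of_nonneg hs0.le, hst] at h1
    refine h1.trans ?_
    have h2 : (t / 2) ^ M ≤ t ^ β := by
      calc (t / 2) ^ M ≤ t ^ M := by gcongr; linarith
        _ = t ^ (M : ℝ) := (Real.rpow_natCast _ _).symm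
        _ ≤ t ^ β := Real.rpow_le_rpow_of_exponent_ge ht0 (not_lt.1 hc) hβ
    calc 2 * (Real.exp 1 * e) * (t / 2) ^ M ≤ 2 * (Real.exp 1 * e) * t ^ β := by gcongr
      _ ≤ (M + 2) * (Real.exp 1 * e) * t ^ β := by gcongr; linarith [Nat.cast_nonneg (α := ℝ) M]
      _ = _ := by ring

end Kernel


/-! ### Bounds for the Taylor expansion of the semigroup -/

section Expansion

open Filter Topology Set FourierTransform SchwartzMap

variable {N : ℕ} {m : ℝ≥0}

theorem lintegral_weight_mul_exp_lt_top :
    ∫⁻ ξ : Eucl N, weight N m ξ * ENNReal.ofReal (Real.exp (-(‖ξ‖ ^ 2 / 8))) ^ 2 < ∞ := by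
  obtain ⟨C, hC0, hC⟩ := exists_one_add_rpow_le_exp m
  have h1 : ∀ ξ : Eucl N, weight N m ξ * ENNReal.ofReal (Real.exp (-(‖ξ‖ ^ 2 / 8))) ^ 2 ≤
      ENNReal.ofReal (C * Real.exp (-(1 / 8 * ‖ξ‖ ^ 2))) := by
    intro ξ
    rw [weight, ← ENNReal.ofReal_pow (Real.exp_pos _).le, ← ENNReal.ofReal_mul (by positivity)]
    refine ENNReal.ofReal_le_ofReal ?_
    calc (1 + ‖ξ‖ ^ 2) ^ (m : ℝ) * Real.exp (-(‖ξ‖ ^ 2 / 8)) ^ 2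
        ≤ C * Real.exp (‖ξ‖ ^ 2 / 8) * Real.exp (-(‖ξ‖ ^ 2 / 8)) ^ 2 := by
          gcongr
          exact hC _ (by positivity)
      _ = C * Real.exp (-(1 / 8 * ‖ξ‖ ^ 2)) := by
          rw [mul_assoc, ← Real.exp_nat_mul, ← Real.exp_add]
          congr 2
          push_cast
          ring
  exact (lintegral_mono h1).trans_lt
    ((integrable_exp_neg_mul_norm_sq (by norm_num)).const_mul C).lintegral_lt_top

/-- The threshold γ enters here: (1 + |y|)^β pairs with L²(m) because 2(m - β) > N. -/
theorem lintegral_one_add_norm_rpow_lt_top {β : ℝ} (hβ : β < m - N / 2) :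
    ∫⁻ y : Eucl N, ENNReal.ofReal ((1 + ‖y‖) ^ β * (1 + ‖y‖ ^ 2) ^ (-(m / 2 : ℝ))) ^ 2 < ∞ := by
  have h1 : ∀ y : Eucl N, ENNReal.ofReal ((1 + ‖y‖) ^ β * (1 + ‖y‖ ^ 2) ^ (-(m / 2 : ℝ))) ^ 2 ≤
      ENNReal.ofReal (2 ^ (m : ℝ) * (1 + ‖y‖) ^ (-(2 * (m - β)))) := by
    intro y
    have hy := norm_nonneg y
    rw [← ENNReal.ofReal_pow (by positivity)]
    refine ENNReal.ofReal_le_ofReal ?_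
    have h2 : ((1 + ‖y‖ ^ 2) ^ (-(m / 2 : ℝ))) ^ 2 ≤ 2 ^ (m : ℝ) * (1 + ‖y‖) ^ (-(2 * m : ℝ)) := by
      rw [← Real.rpow_natCast, ← Real.rpow_mul (by positivity), Real.rpow_neg (by positivity),
        Real.rpow_mul (by positivity) 2 (m : ℝ), ← Real.inv_rpow (by positivity),
        ← Real.mul_rpow (by positivity) (by positivity),
        show -(m / 2 : ℝ) * ((2 : ℕ) : ℝ) = -m by push_cast; ring, Real.rpow_neg (by positivity),
        ← Real.inv_rpow (by positivity)]
      refine Real.rpow_le_rpow (by positivity) ?_ m.coe_nonneg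
      rw [Real.rpow_two, inv_le_iff_one_le_mul₀ (by positivity), ← div_eq_mul_inv,
        div_mul_eq_mul_div, le_div_iff₀ (by positivity)]
      nlinarith [sq_nonneg (‖y‖ - 1)]
    calc ((1 + ‖y‖) ^ β * (1 + ‖y‖ ^ 2) ^ (-(m / 2 : ℝ))) ^ 2
        = ((1 + ‖y‖) ^ β) ^ 2 * ((1 + ‖y‖ ^ 2) ^ (-(m / 2 : ℝ))) ^ 2 := mul_pow _ _ _
      _ ≤ ((1 + ‖y‖) ^ β) ^ 2 * (2 ^ (m : ℝ) * (1 + ‖y‖) ^ (-(2 * m : ℝ))) := by gcongr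
      _ = 2 ^ (m : ℝ) * ((1 + ‖y‖) ^ (β * 2) * (1 + ‖y‖) ^ (-(2 * m : ℝ))) := by
          rw [← Real.rpow_natCast, ← Real.rpow_mul (by positivity)]
          push_cast
          ring
      _ = _ := by
          rw [← Real.rpow_add (by positivity)]
          congr 2
          ring
  refine (lintegral_mono h1).trans_lt
    ((integrable_one_add_norm ?_).const_mul _).lintegral_lt_top
  rw [finrank_euclideanSpace_fin]
  linarith

theorem sq_lintegral_one_add_norm_rpow_mul_le (β : ℝ) {g : Eucl N → ℝ≥0∞} (hg : Measurable g) :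
    (∫⁻ y : Eucl N, ENNReal.ofReal ((1 + ‖y‖) ^ β) * g y) ^ 2 ≤
      (∫⁻ y : Eucl N, ENNReal.ofReal ((1 + ‖y‖) ^ β * (1 + ‖y‖ ^ 2) ^ (-(m / 2 : ℝ))) ^ 2) *
        ∫⁻ y, g y ^ 2 ∂weightMeasure N m := by
  have h3 := ENNReal.lintegral_mul_sq_le (μ := (volume : Measure (Eucl N)))
    (f := fun y => ENNReal.ofReal ((1 + ‖y‖) ^ β * (1 + ‖y‖ ^ 2) ^ (-(m / 2 : ℝ))))
    (g := fun y => ENNReal.ofReal ((1 + ‖y‖ ^ 2) ^ (m / 2 : ℝ)) * g y)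
    (by fun_prop) (by fun_prop)
  rw [lintegral_weightMeasure (hg.pow_const 2)]
  convert h3 using 2
  · refine lintegral_congr fun y => ?_
    rw [← mul_assoc, ← ENNReal.ofReal_mul (by positivity), mul_assoc,
      ← Real.rpow_add (by positivity), neg_add_cancel, Real.rpow_zero, mul_one]
  · refine lintegral_congr fun y => ?_
    rw [mul_pow, ← ENNReal.ofReal_pow (by positivity), weight,
      ← Real.rpow_mul_natCast (by positivity)]
    congr 3
    push_cast
    ring

/-- The kernel is a product, so its squared norm is the squared L²(m) norm of the Gaussian in ξ
times the squared dual norm of the growth in y. -/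
theorem exists_lintegral_rankOne_sq_le {β : ℝ} (hβ : β < m - N / 2) :
    ∃ C : ℝ≥0, ∀ g : Eucl N → ℝ≥0∞, Measurable g →
      ∫⁻ ξ : Eucl N, (∫⁻ y : Eucl N, ENNReal.ofReal ((1 + ‖y‖) ^ β * Real.exp (-(‖ξ‖ ^ 2 / 8))) *
          g y) ^ 2 ∂weightMeasure N m ≤ C * ∫⁻ y, g y ^ 2 ∂weightMeasure N m := by
  set A := ∫⁻ ξ : Eucl N, weight N m ξ * ENNReal.ofReal (Real.exp (-(‖ξ‖ ^ 2 / 8))) ^ 2 with hA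
  set B := ∫⁻ y : Eucl N,
    ENNReal.ofReal ((1 + ‖y‖) ^ β * (1 + ‖y‖ ^ 2) ^ (-(m / 2 : ℝ))) ^ 2 with hB
  have hA1 : A ≠ ∞ := lintegral_weight_mul_exp_lt_top.ne
  have hB1 : B ≠ ∞ := (lintegral_one_add_norm_rpow_lt_top hβ).ne
  refine ⟨(A * B).toNNReal, fun g hg => ?_⟩
  rw [ENNReal.coe_toNNReal (ENNReal.mul_ne_top hA1 hB1)]
  set J := ∫⁻ y : Eucl N, ENNReal.ofReal ((1 + ‖y‖) ^ β) * g y with hJ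
  have h1 : ∀ ξ : Eucl N, ∫⁻ y : Eucl N,
      ENNReal.ofReal ((1 + ‖y‖) ^ β * Real.exp (-(‖ξ‖ ^ 2 / 8))) * g y =
        ENNReal.ofReal (Real.exp (-(‖ξ‖ ^ 2 / 8))) * J := by
    intro ξ
    rw [hJ, ← lintegral_const_mul' _ _ ENNReal.ofReal_ne_top]
    refine lintegral_congr fun y => ?_
    rw [ENNReal.ofReal_mul (by positivity), ← mul_assoc]
    ring
  have h2 : J ^ 2 ≤ B * ∫⁻ y, g y ^ 2 ∂weightMeasure N m :=
    sq_lintegral_one_add_norm_rpow_mul_le β hg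
  simp only [h1]
  rw [lintegral_weightMeasure (by fun_prop)]
  simp only [mul_pow, ← mul_assoc]
  have hw : Measurable fun ξ : Eucl N =>
      weight N m ξ * ENNReal.ofReal (Real.exp (-(‖ξ‖ ^ 2 / 8))) ^ 2 :=
    measurable_weight.mul (by fun_prop)
  rw [lintegral_mul_const _ hw, mul_assoc]
  exact mul_le_mul_right h2 _

theorem KernelBound.of_norm_le {κ : Eucl N → Eucl N → ℂ} (hκ : Measurable (Function.uncurry κ))
    {β A : ℝ} (hβ : β < m - N / 2)
    (h : ∀ ξ y, ‖κ ξ y‖ ≤ A * ((1 + ‖y‖) ^ β * Real.exp (-(‖ξ‖ ^ 2 / 8)))) :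
    ∃ C, KernelBound m κ C := by
  obtain ⟨C, hC⟩ := exists_lintegral_rankOne_sq_le (N := N) hβ
  refine ⟨NNReal.sqrt (A.toNNReal ^ 2 * C), hκ, fun g hg => ?_⟩
  rw [← ENNReal.coe_pow, NNReal.sq_sqrt, ENNReal.coe_mul, ENNReal.coe_pow, mul_assoc]
  refine le_trans ?_ (mul_le_mul_right (hC g hg) _)
  rw [← lintegral_const_mul' _ _ (ENNReal.pow_ne_top ENNReal.coe_ne_top)]
  refine lintegral_mono fun ξ => ?_
  rw [← mul_pow, ← lintegral_const_mul' _ _ ENNReal.coe_ne_top]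
  refine ENNReal.pow_le_pow_left (lintegral_mono fun y => ?_)
  rw [← mul_assoc]
  refine mul_le_mul_left ?_ _
  rw [← ofReal_norm]
  refine (ENNReal.ofReal_le_ofReal (h ξ y)).trans_eq ?_
  rw [ENNReal.ofReal_mul' (by positivity)]
  rfl

theorem exists_kernelBound_mehlerCoeff {k : ℕ} (hk : (k : ℝ) < m - N / 2) :
    ∃ C, KernelBound m (mehlerCoeff k : Eucl N → Eucl N → ℂ) C := by
  refine KernelBound.of_norm_le (measurable_mehlerCoeff k) (A := Real.exp 1 * 2 ^ k) hk fun ξ y => ?_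
  refine (norm_mehlerCoeff_le k ξ y).trans_eq ?_
  rw [mul_pow, Real.rpow_natCast]
  ring

/-- Where 1 < 4s(1 + |y|), one has 1 ≤ 16 s²(1 + |y|)² ≤ 32 s²(1 + |y|²), so 1 + s²|y|² ≤ 33 s²(1 +
|y|²). Against the y-mass s^{-N} this gains s^{2m}, in all s^{2γ}. -/
theorem exists_lintegral_indicator_mehler_sq_le (N : ℕ) (m : ℝ≥0) :
    ∃ C : ℝ≥0, ∀ s ∈ Ioo (0 : ℝ) 1, ∀ g : Eucl N → ℝ≥0∞, Measurable g →
      ∫⁻ ξ, (∫⁻ y, ENNReal.ofReal ({y : Eucl N | 1 < 4 * s * (1 + ‖y‖)}.indicator (mehler s ξ) y) *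
        g y) ^ 2 ∂weightMeasure N m ≤
        C * ENNReal.ofReal (s ^ (m - N / 2 : ℝ)) ^ 2 * ∫⁻ y, g y ^ 2 ∂weightMeasure N m := by
  obtain ⟨C, hC⟩ := exists_lintegral_mehler_sq_le N m
  refine ⟨C * ((33 : ℝ) ^ (m : ℝ)).toNNReal, fun s hs g hg => ?_⟩
  have hs0 := hs.1
  set T := {y : Eucl N | 1 < 4 * s * (1 + ‖y‖)} with hT
  have hTm : MeasurableSet T := measurableSet_lt measurable_const (by fun_prop)
  have h1 : ∀ ξ y : Eucl N, ENNReal.ofReal (T.indicator (mehler s ξ) y) * g y =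
      ENNReal.ofReal (mehler s ξ y) * T.indicator g y := by
    intro ξ y
    by_cases hy : y ∈ T <;> simp [hy]
  simp only [h1]
  refine (hC s hs _ (hg.indicator hTm)).trans ?_
  rw [lintegral_weightMeasure (hg.pow_const 2)]
  have h2 : ∀ y : Eucl N, ENNReal.ofReal ((1 + s ^ 2 * ‖y‖ ^ 2) ^ (m : ℝ)) * T.indicator g y ^ 2 ≤
      ENNReal.ofReal (33 ^ (m : ℝ) * (s ^ 2) ^ (m : ℝ)) * (weight N m y * g y ^ 2) := by
    intro y
    have hy0 := norm_nonneg y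
    by_cases hy : y ∈ T
    · rw [indicator_of_mem hy, ← mul_assoc, weight, ← ENNReal.ofReal_mul (by positivity),
        ← Real.mul_rpow (by positivity) (by positivity),
        ← Real.mul_rpow (by positivity) (by positivity)]
      refine mul_le_mul_left (ENNReal.ofReal_le_ofReal
        (Real.rpow_le_rpow (by positivity) ?_ m.coe_nonneg)) _
      have h3 : 1 < 4 * s * (1 + ‖y‖) := hy
      have h4 : 1 ≤ (4 * s * (1 + ‖y‖)) ^ 2 := one_le_pow₀ h3.le
      nlinarith [mul_nonneg (sq_nonneg s) (sq_nonneg (1 - ‖y‖)), sq_nonneg s]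
    · rw [indicator_of_notMem hy]
      simp
  refine (mul_le_mul_right (lintegral_mono h2) _).trans_eq ?_
  rw [lintegral_const_mul' _ _ ENNReal.ofReal_ne_top, ENNReal.ofReal_mul (by positivity),
    ENNReal.coe_mul]
  change _ = ↑C * ENNReal.ofReal (33 ^ (m : ℝ)) * _ * _
  have h3 : ENNReal.ofReal ((s ^ N)⁻¹) * ENNReal.ofReal ((s ^ 2) ^ (m : ℝ)) =
      ENNReal.ofReal (s ^ (m - N / 2 : ℝ)) ^ 2 := by
    rw [← ENNReal.ofReal_mul (by positivity), ← ENNReal.ofReal_pow (by positivity),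
      ← Real.rpow_natCast, ← Real.rpow_natCast, ← Real.rpow_natCast, ← Real.rpow_mul hs0.le,
      ← Real.rpow_mul hs0.le, ← Real.rpow_neg hs0.le, ← Real.rpow_add hs0]
    congr 2
    push_cast
    ring
  rw [← h3]
  ring

theorem exists_kernelBound_mehlerRem {M : ℕ} {β : ℝ} (hβm : β < m - N / 2)
    (hM : ∀ k < M, (k : ℝ) ≤ β) (hβ : β ≤ M) :
    ∃ C : ℝ≥0, ∀ s ∈ Ioo (0 : ℝ) 1,
      KernelBound m (mehlerRem M s : Eucl N → Eucl N → ℂ) (C * (s ^ β).toNNReal) := by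
  obtain ⟨C₁, hC₁⟩ := exists_lintegral_rankOne_sq_le (N := N) hβm
  obtain ⟨C₂, hC₂⟩ := exists_lintegral_indicator_mehler_sq_le N m
  set A : ℝ≥0 := ((M + 2) * Real.exp 1 * 4 ^ β).toNNReal with hA
  refine ⟨NNReal.sqrt (2 * A ^ 2 * C₁ + 2 * C₂), fun s hs => ⟨measurable_mehlerRem M s,
    fun g hg => ?_⟩⟩
  have hs0 := hs.1
  set T := {y : Eucl N | 1 < 4 * s * (1 + ‖y‖)} with hT
  have hTm : MeasurableSet T := measurableSet_lt measurable_const (by fun_prop)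
  set σ : ℝ≥0∞ := ENNReal.ofReal (s ^ β) with hσ
  have h1 : ∀ ξ y : Eucl N, ‖mehlerRem M s ξ y‖ₑ * g y ≤
      A * σ * (ENNReal.ofReal ((1 + ‖y‖) ^ β * Real.exp (-(‖ξ‖ ^ 2 / 8))) * g y) +
        ENNReal.ofReal (T.indicator (mehler s ξ) y) * g y := by
    intro ξ y
    rw [← mul_assoc, ← add_mul, ← ofReal_norm]
    refine mul_le_mul_left ?_ _
    refine (ENNReal.ofReal_le_ofReal (norm_mehlerRem_le hM hβ hs ξ y)).trans ?_
    refine ENNReal.ofReal_add_le.trans (add_le_add (le_of_eq ?_) le_rfl)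
    change _ = ENNReal.ofReal _ * _ * _
    rw [hσ, ← ENNReal.ofReal_mul (by positivity), ← ENNReal.ofReal_mul (by positivity),
      Real.mul_rpow (by positivity) (by positivity), Real.mul_rpow (by positivity) (by positivity)]
    congr 1
    ring
  have h2 : ∀ ξ : Eucl N, (∫⁻ y, ‖mehlerRem M s ξ y‖ₑ * g y) ^ 2 ≤
      2 * (A * σ) ^ 2 * (∫⁻ y : Eucl N,
        ENNReal.ofReal ((1 + ‖y‖) ^ β * Real.exp (-(‖ξ‖ ^ 2 / 8))) * g y) ^ 2 +
      2 * (∫⁻ y, ENNReal.ofReal (T.indicator (mehler s ξ) y) * g y) ^ 2 := by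
    intro ξ
    refine (ENNReal.pow_le_pow_left (lintegral_mono (h1 ξ))).trans ?_
    rw [lintegral_add_left (by fun_prop), lintegral_const_mul _ (by fun_prop)]
    refine (ENNReal.add_sq_le _ _).trans_eq ?_
    rw [mul_pow]
    ring
  refine (lintegral_mono h2).trans ?_
  have hm1 : Measurable fun ξ : Eucl N => ∫⁻ y : Eucl N,
      ENNReal.ofReal ((1 + ‖y‖) ^ β * Real.exp (-(‖ξ‖ ^ 2 / 8))) * g y :=
    Measurable.lintegral_prod_right' (f := fun p : Eucl N × Eucl N =>
      ENNReal.ofReal ((1 + ‖p.2‖) ^ β * Real.exp (-(‖p.1‖ ^ 2 / 8))) * g p.2) (by fun_prop)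
  have hσtop : 2 * (A * σ) ^ 2 ≠ ∞ := by
    refine ENNReal.mul_ne_top (by simp) (ENNReal.pow_ne_top ?_)
    exact ENNReal.mul_ne_top ENNReal.coe_ne_top ENNReal.ofReal_ne_top
  rw [lintegral_add_left (by fun_prop), lintegral_const_mul' _ _ hσtop,
    lintegral_const_mul' _ _ (by simp)]
  refine (add_le_add (mul_le_mul_right (hC₁ g hg) _) (mul_le_mul_right (hC₂ s hs g hg) _)).trans ?_
  have h3 : ENNReal.ofReal (s ^ (m - N / 2 : ℝ)) ≤ σ :=
    ENNReal.ofReal_le_ofReal (Real.rpow_le_rpow_of_exponent_ge hs0 hs.2.le hβm.le)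
  rw [ENNReal.coe_mul, mul_pow (NNReal.sqrt _ : ℝ≥0∞), ← ENNReal.coe_pow (NNReal.sqrt _),
    NNReal.sq_sqrt, ENNReal.coe_add]
  change _ ≤ (_ + _) * σ ^ 2 * _
  set G := ∫⁻ y, g y ^ 2 ∂weightMeasure N m
  calc 2 * (A * σ) ^ 2 * (C₁ * G) + 2 * (C₂ * ENNReal.ofReal (s ^ (m - N / 2 : ℝ)) ^ 2 * G)
      ≤ 2 * (A * σ) ^ 2 * (C₁ * G) + 2 * (C₂ * σ ^ 2 * G) := by gcongr
    _ = _ := by push_cast; ring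

/-- The spectral projections of `ℒ`. -/
def projectionL (m : ℝ≥0) (k : ℕ) : WeightedL2 N m →L[ℂ] WeightedL2 N m :=
  kernelOp m (mehlerCoeff k)

theorem exists_norm_semigroupL_sub_sum_le {β : ℝ} (hβ : β < m - N / 2) :
    ∃ C, ∀ s ∈ Ioo (0 : ℝ) 1, ∀ x : WeightedL2 N m,
      ‖semigroupL m s x - ∑ k ∈ Finset.range ⌈(m - N / 2 : ℝ)⌉₊, (s : ℂ) ^ k • projectionL m k x‖ ≤
        C * s ^ β * ‖x‖ := by
  -- The kernel bound needs an exponent above every index k < γ. The estimate for β' > β implies the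
  -- one for β because s < 1.
  obtain ⟨β', h1, h2, h3⟩ := IsExpandingSemigroup.exists_exponent β hβ
  obtain ⟨C, hC⟩ := exists_kernelBound_mehlerRem (N := N) h1 (fun k hk => (h3 k hk).le)
    (h1.le.trans (Nat.le_ceil _))
  refine ⟨C, fun s hs x => ?_⟩
  obtain ⟨C', hC'⟩ := exists_kernelBound_mehlerC (N := N) m hs
  have h4 := kernelOp_sub_sum hC' (hC s hs) (I := Finset.range ⌈(m - N / 2 : ℝ)⌉₊)
    (a := mehlerCoeff) (c := fun k => (s : ℂ) ^ k)
    (fun k hk => exists_kernelBound_mehlerCoeff (Nat.lt_ceil.1 (Finset.mem_range.1 hk)))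
    (fun ξ y => rfl) x
  change ‖kernelOp m (mehlerC s) x - ∑ k ∈ Finset.range ⌈(m - N / 2 : ℝ)⌉₊,
    (s : ℂ) ^ k • kernelOp m (mehlerCoeff k) x‖ ≤ _
  rw [← h4]
  refine ((hC s hs).norm_kernelOp_apply_le x).trans ?_
  rw [NNReal.coe_mul, Real.coe_toNNReal _ (Real.rpow_nonneg hs.1.le _)]
  gcongr ?_ * _
  exact mul_le_mul_of_nonneg_left
    (Real.rpow_le_rpow_of_exponent_ge hs.1 hs.2.le h2.le) C.coe_nonneg

/-- A family in `L²(m)` that is given by a jointly measurable function is measurable. -/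
theorem aestronglyMeasurable_of_coeFn_eq {F : ℝ → Eucl N → ℂ}
    (hF : Measurable (Function.uncurry F)) {T : Set ℝ} (hT : MeasurableSet T)
    {u : ℝ → WeightedL2 N m} (hu : ∀ s ∈ T, u s =ᵐ[weightMeasure N m] F s) :
    AEStronglyMeasurable u (volume.restrict T) := by
  borelize (WeightedL2 N m)
  have : Fact ((2 : ℝ≥0∞) ≠ ∞) := ⟨by simp⟩
  -- The space is separable, so it suffices to treat preimages of balls; the squared distance to a
  -- fixed g is a parametric integral, measurable by Tonelli.
  have hball : ∀ (g : WeightedL2 N m) (r : ℝ≥0∞), MeasurableSet {s | s ∈ T ∧ edist (u s) g < r} := by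
    intro g r
    have h1 : Measurable fun s => ∫⁻ ξ, ‖F s ξ - g ξ‖ₑ ^ 2 ∂weightMeasure N m := by
      refine Measurable.lintegral_prod_right'
        (f := fun p : ℝ × Eucl N => ‖F p.1 p.2 - g p.2‖ₑ ^ 2) ?_
      exact ((hF.sub ((KernelBound.measurable_coe g).comp measurable_snd)).enorm).pow_const 2
    have h2 : {s | s ∈ T ∧ edist (u s) g < r} =
        T ∩ {s | ∫⁻ ξ, ‖F s ξ - g ξ‖ₑ ^ 2 ∂weightMeasure N m < r ^ 2} := by
      ext s
      refine and_congr_right fun hs => ?_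
      have h3 : edist (u s) g ^ 2 = ∫⁻ ξ, ‖F s ξ - g ξ‖ₑ ^ 2 ∂weightMeasure N m := by
        rw [Lp.edist_def, eLpNorm_two_sq]
        refine lintegral_congr_ae ?_
        filter_upwards [hu s hs] with ξ hξ
        rw [Pi.sub_apply, hξ]
      rw [mem_ofPred_eq, ← h3, ENNReal.pow_lt_pow_left_iff two_ne_zero]
    rw [h2]
    exact hT.inter (measurableSet_lt h1 measurable_const)
  have hopen : ∀ U : Set (WeightedL2 N m), IsOpen U → MeasurableSet (T ∩ u ⁻¹' U) := by
    intro U hU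
    obtain ⟨D, hDc, hD⟩ := TopologicalSpace.exists_countable_dense (WeightedL2 N m)
    have h1 : T ∩ u ⁻¹' U = ⋃ g ∈ D, ⋃ n : ℕ, ⋃ _ : Metric.ball g (1 / (n + 1)) ⊆ U,
        {s | s ∈ T ∧ edist (u s) g < ENNReal.ofReal (1 / (n + 1))} := by
      ext s
      simp only [mem_inter_iff, mem_preimage, mem_iUnion, mem_ofPred_eq, exists_prop, edist_lt_ofReal]
      constructor
      · rintro ⟨hs, hsU⟩
        obtain ⟨ε, hε, hεU⟩ := Metric.isOpen_iff.1 hU _ hsU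
        obtain ⟨n, hn⟩ := exists_nat_one_div_lt (half_pos hε)
        obtain ⟨g, hgD, hg⟩ := hD.exists_dist_lt (u s) (Nat.one_div_pos_of_nat (n := n))
        refine ⟨g, hgD, n, fun v hv => hεU ?_, hs, hg⟩
        rw [Metric.mem_ball] at hv ⊢
        linarith [dist_triangle_right v (u s) g]
      · rintro ⟨g, -, n, hn, hs, hg⟩
        exact ⟨hs, hn hg⟩
    rw [h1]
    exact MeasurableSet.biUnion hDc fun g _ => MeasurableSet.iUnion fun n =>
      MeasurableSet.iUnion fun _ => hball g _
  have hmeas : Measurable (T.indicator u) := by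
    refine measurable_of_isOpen fun U hU => ?_
    rw [indicator_preimage, Set.ite, inter_comm]
    refine (hopen U hU).union (MeasurableSet.diff ?_ hT)
    exact measurable_zero (hU.measurableSet)
  have := hmeas.stronglyMeasurable.aestronglyMeasurable (μ := volume.restrict T)
  refine this.congr ?_
  filter_upwards [ae_restrict_mem hT] with s hs
  exact indicator_of_mem hs u

theorem aestronglyMeasurable_semigroupL (x : WeightedL2 N m) :
    AEStronglyMeasurable (fun s => semigroupL m s x) (volume.restrict (Ioo 0 1)) := by
  refine aestronglyMeasurable_of_coeFn_eq (F := fun s ξ => ∫ y, mehlerC s ξ y * x y) ?_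
    measurableSet_Ioo fun s hs => coeFn_semigroupL hs x
  refine StronglyMeasurable.measurable (StronglyMeasurable.integral_prod_right'
    (f := fun p : (ℝ × Eucl N) × Eucl N => mehlerC p.1.1 p.1.2 p.2 * x p.2) ?_)
  refine (Measurable.mul ?_ ((KernelBound.measurable_coe x).comp measurable_snd)).stronglyMeasurable
  unfold mehlerC mehler
  fun_prop

/-- `e^{tℒ}` has an expansion with the operators `projectionL` as coefficients. -/
theorem isExpandingSemigroup_semigroupL (N : ℕ) (m : ℝ≥0) :
    IsExpandingSemigroup (opL N m) (semigroupL m) (projectionL m) (m - N / 2)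
      (testFunctional m) dualL where
  separating := eq_zero_of_testFunctional
  graph := opL_graph_iff
  hasDerivAt x ψ s hs := by
    have h1 := hasDerivAt_integral_dualS (𝓕 (WeightedL2.toL2 N m x)) ψ hs
    rw [← testFunctional_eq_integral_fourier, ← testFunctional_semigroupL hs] at h1
    refine h1.congr_of_eventuallyEq ?_
    filter_upwards [Ioo_mem_nhds hs.1 hs.2] with r hr
    rw [testFunctional_semigroupL hr, testFunctional_eq_integral_fourier]
  commute x w h s hs ψ := by
    have hs' : s ∈ Ioc (0 : ℝ) 1 := ⟨hs.1, hs.2.le⟩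
    rw [testFunctional_semigroupL hs, testFunctional_semigroupL hs, ← dualL_dualS hs', h]
  tendsto_one x ψ := by
    have h1 := tendsto_integral_dualS_one (𝓕 (WeightedL2.toL2 N m x)) ψ
    rw [← testFunctional_eq_integral_fourier] at h1
    refine h1.congr' ?_
    filter_upwards [Ioo_mem_nhdsLT (zero_lt_one (α := ℝ))] with r hr
    rw [testFunctional_semigroupL hr, testFunctional_eq_integral_fourier]
  comp x r hr s hs := by
    have hrs : r * s ∈ Ioo (0 : ℝ) 1 := ⟨mul_pos hr.1 hs.1, mul_lt_one_of_nonneg_of_lt_one_left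
      hr.1.le hr.2 hs.2.le⟩
    refine sub_eq_zero.1 (eq_zero_of_testFunctional _ fun ψ => ?_)
    rw [map_sub, testFunctional_semigroupL hr, testFunctional_semigroupL hs,
      testFunctional_semigroupL hrs, dualS_dualS ⟨hr.1, hr.2.le⟩ ⟨hs.1, hs.2.le⟩, sub_self]
  measurable := aestronglyMeasurable_semigroupL
  expansion β hβ := exists_norm_semigroupL_sub_sum_le hβ

end Expansion


/-! ### Schwartz functions in the weighted space -/

section SchwartzVec

open Filter Topology Set FourierTransform SchwartzMap

variable {N : ℕ} {m : ℝ≥0}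

/-- This choice of n makes (1 + |ξ|)^{2m - n} integrable. It places all Schwartz functions in L²(m).
-/
instance : (weightMeasure N m).HasTemperateGrowth := by
  set n := ⌈(2 * m : ℝ)⌉₊ + N + 1 with hn
  refine ⟨n, (Continuous.aestronglyMeasurable ?_), ?_⟩
  · exact Continuous.rpow_const (by fun_prop) fun x => Or.inl (by positivity)
  have h1 : ∀ ξ : Eucl N, weight N m ξ * ‖(1 + ‖ξ‖) ^ (-(n : ℝ))‖ₑ ≤
      ENNReal.ofReal ((1 + ‖ξ‖) ^ (-(n - 2 * m : ℝ))) := by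
    intro ξ
    have := norm_nonneg ξ
    rw [weight, Real.enorm_of_nonneg (by positivity), ← ENNReal.ofReal_mul (by positivity)]
    refine ENNReal.ofReal_le_ofReal ?_
    calc (1 + ‖ξ‖ ^ 2) ^ (m : ℝ) * (1 + ‖ξ‖) ^ (-(n : ℝ))
        ≤ ((1 + ‖ξ‖) ^ (2 : ℝ)) ^ (m : ℝ) * (1 + ‖ξ‖) ^ (-(n : ℝ)) := by
          gcongr
          rw [Real.rpow_two]
          nlinarith
      _ = _ := by
          rw [← Real.rpow_mul (by positivity), ← Real.rpow_add (by positivity)]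
          congr 1
          ring
  rw [hasFiniteIntegral_iff_enorm, lintegral_weightMeasure (by fun_prop)]
  refine (lintegral_mono h1).trans_lt (integrable_one_add_norm ?_).lintegral_lt_top
  rw [finrank_euclideanSpace_fin, hn]
  push_cast
  linarith [Nat.le_ceil (2 * m : ℝ)]

/-- A Schwartz function as an element of `L²(m)`. -/
def schwartzVec (m : ℝ≥0) (φ : 𝓢(Eucl N, ℂ)) : WeightedL2 N m :=
  φ.toLp 2 (weightMeasure N m)

theorem coeFn_schwartzVec (φ : 𝓢(Eucl N, ℂ)) : schwartzVec m φ =ᵐ[weightMeasure N m] φ :=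
  φ.coeFn_toLp 2 (weightMeasure N m)

theorem testFunctional_schwartzVec (ψ φ : 𝓢(Eucl N, ℂ)) :
    testFunctional m ψ (schwartzVec m φ) = ∫ p, ψ p * 𝓕 φ p := by
  have h1 : testFunctional m ψ (schwartzVec m φ) = ∫ y, 𝓕 ψ y * φ y := by
    rw [testFunctional_apply]
    refine integral_congr_ae ?_
    filter_upwards [volume_absolutelyContinuous_weightMeasure.ae_le (coeFn_schwartzVec (m := m) φ)]
      with y hy
    rw [hy]
  rw [h1]
  have := VectorFourier.integral_fourierIntegral_smul_eq_flip (L := innerₗ (Eucl N))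
    (μ := volume) (ν := volume) Real.continuous_fourierChar
    (show Continuous fun p : Eucl N × Eucl N => innerₗ (Eucl N) p.1 p.2 from continuous_inner)
    ψ.integrable φ.integrable
  simp only [flip_innerₗ] at this
  exact this

/-- The semigroup on Schwartz functions, on the Fourier side. -/
theorem semigroupL_schwartzVec {r : ℝ} (hr : r ∈ Ioo (0 : ℝ) 1) {φ φ' : 𝓢(Eucl N, ℂ)}
    (h : ∀ p, 𝓕 φ' p = Real.exp (-(4 * Real.pi ^ 2 * (1 - r ^ 2) * ‖p‖ ^ 2)) * 𝓕 φ (r • p)) :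
    semigroupL m r (schwartzVec m φ) = schwartzVec m φ' := by
  have hr' : r ∈ Ioc (0 : ℝ) 1 := ⟨hr.1, hr.2.le⟩
  have hr0 := hr.1
  refine sub_eq_zero.1 (eq_zero_of_testFunctional _ fun ψ => ?_)
  rw [map_sub, testFunctional_semigroupL hr, testFunctional_schwartzVec, testFunctional_schwartzVec,
    sub_eq_zero]
  have h2 := Measure.integral_comp_smul (volume : Measure (Eucl N))
    (fun q : Eucl N => dualS r ψ q * 𝓕 φ q) r
  rw [finrank_euclideanSpace_fin, abs_of_pos (by positivity)] at h2
  have h3 : ∫ q : Eucl N, dualS r ψ q * 𝓕 φ q =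
      (r ^ N : ℝ) • ∫ p : Eucl N, dualS r ψ (r • p) * 𝓕 φ (r • p) := by
    rw [h2, smul_smul, mul_inv_cancel₀ (by positivity), one_smul]
  rw [h3, ← integral_smul]
  refine integral_congr_ae (.of_forall fun p => ?_)
  have h4 : (Real.exp (-(4 * Real.pi ^ 2 * (r⁻¹ ^ 2 - 1) * (r * ‖p‖) ^ 2))) =
      Real.exp (-(4 * Real.pi ^ 2 * (1 - r ^ 2) * ‖p‖ ^ 2)) := by
    congr 1
    field_simp
  have hrN : ((r : ℂ) ^ N) ≠ 0 := pow_ne_zero _ (by exact_mod_cast hr0.ne')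
  simp only
  rw [h, dualS_apply hr', smul_smul, inv_mul_cancel₀ hr0.ne', one_smul, norm_smul,
    Real.norm_of_nonneg hr0.le, h4, Complex.real_smul, Complex.ofReal_pow]
  field_simp

/-- The dilation `φ(· / c)`. -/
def dilate (c : ℝ) (φ : 𝓢(Eucl N, ℂ)) : 𝓢(Eucl N, ℂ) :=
  if hc : c = 0 then 0 else
    compCLMOfContinuousLinearEquiv ℂ
      (ContinuousLinearEquiv.smulLeft (Units.mk0 c⁻¹ (inv_ne_zero hc)) : Eucl N ≃L[ℝ] Eucl N) φ

theorem dilate_apply {c : ℝ} (hc : c ≠ 0) (φ : 𝓢(Eucl N, ℂ)) (ξ : Eucl N) :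
    dilate c φ ξ = φ (c⁻¹ • ξ) := by
  rw [dilate, dif_neg hc]
  rfl

theorem fourier_dilate {c : ℝ} (hc : 0 < c) (φ : 𝓢(Eucl N, ℂ)) (p : Eucl N) :
    𝓕 (dilate c φ) p = (c : ℂ) ^ N * 𝓕 φ (c • p) := by
  rw [fourier_coe, fourier_coe, Real.fourier_eq', Real.fourier_eq']
  have h2 := Measure.integral_comp_smul (volume : Measure (Eucl N))
    (fun v : Eucl N => Complex.exp ((-2 * Real.pi * inner ℝ v p : ℝ) * Complex.I) • dilate c φ v) c
  rw [finrank_euclideanSpace_fin, abs_of_pos (by positivity)] at h2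
  have h3 : ∫ v : Eucl N, Complex.exp ((-2 * Real.pi * inner ℝ v p : ℝ) * Complex.I) • dilate c φ v
      = (c ^ N : ℝ) • ∫ v : Eucl N,
        Complex.exp ((-2 * Real.pi * inner ℝ (c • v) p : ℝ) * Complex.I) • dilate c φ (c • v) := by
    rw [h2, smul_smul, mul_inv_cancel₀ (by positivity), one_smul]
  rw [h3, Complex.real_smul, Complex.ofReal_pow]
  congr 1
  refine integral_congr_ae (.of_forall fun v => ?_)
  simp only
  rw [dilate_apply hc.ne', smul_smul, inv_mul_cancel₀ hc.ne', one_smul, real_inner_smul_left,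
    real_inner_smul_right]

theorem enorm_schwartzVec_sq (φ : 𝓢(Eucl N, ℂ)) :
    ‖schwartzVec m φ‖ₑ ^ 2 = ∫⁻ ξ, weight N m ξ * ‖φ ξ‖ₑ ^ 2 := by
  rw [← KernelBound.lintegral_enorm_sq,
    ← lintegral_weightMeasure (φ.continuous.measurable.enorm.pow_const 2)]
  refine lintegral_congr_ae ?_
  filter_upwards [coeFn_schwartzVec (m := m) φ] with ξ hξ
  rw [hξ]

/-- The Jacobian contributes c^{N/2}, and 1 + |cξ|² ≤ c²(1 + |ξ|²) contributes c^m. -/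
theorem norm_schwartzVec_dilate_le {c : ℝ} (hc : 1 ≤ c) (φ : 𝓢(Eucl N, ℂ)) :
    ‖schwartzVec m (dilate c φ)‖ ≤ c ^ (N / 2 + m : ℝ) * ‖schwartzVec m φ‖ := by
  have hc0 : 0 < c := by linarith
  have h0 : Measurable fun ξ : Eucl N => weight N m (c • ξ) * ‖φ ξ‖ₑ ^ 2 :=
    (measurable_weight.comp (measurable_const_smul c)).mul
      (φ.continuous.measurable.enorm.pow_const 2)
  have h1 : ‖schwartzVec m (dilate c φ)‖ₑ ^ 2 =
      ENNReal.ofReal (c ^ N) * ∫⁻ ξ : Eucl N, weight N m (c • ξ) * ‖φ ξ‖ₑ ^ 2 := by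
    rw [enorm_schwartzVec_sq]
    have h2 := lintegral_map h0 (measurable_const_smul (c⁻¹ : ℝ)) (μ := (volume : Measure (Eucl N)))
    rw [Measure.map_addHaar_smul _ (inv_ne_zero hc0.ne'), lintegral_smul_measure,
      finrank_euclideanSpace_fin, inv_pow, inv_inv, abs_of_pos (by positivity), smul_eq_mul] at h2
    rw [h2]
    refine lintegral_congr fun ξ => ?_
    rw [smul_smul, mul_inv_cancel₀ hc0.ne', one_smul, dilate_apply hc0.ne']
  have h2 : ∀ ξ : Eucl N, weight N m (c • ξ) ≤ ENNReal.ofReal ((c ^ 2) ^ (m : ℝ)) * weight N m ξ := by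
    intro ξ
    rw [weight, weight, ← ENNReal.ofReal_mul (by positivity),
      ← Real.mul_rpow (by positivity) (by positivity), norm_smul, Real.norm_of_nonneg hc0.le]
    refine ENNReal.ofReal_le_ofReal (Real.rpow_le_rpow (by positivity) ?_ m.coe_nonneg)
    nlinarith [sq_nonneg ‖ξ‖]
  have h3 : ‖schwartzVec m (dilate c φ)‖ₑ ^ 2 ≤
      (ENNReal.ofReal (c ^ (N / 2 + m : ℝ)) * ‖schwartzVec m φ‖ₑ) ^ 2 := by
    rw [h1, mul_pow, enorm_schwartzVec_sq]
    calc ENNReal.ofReal (c ^ N) * ∫⁻ ξ : Eucl N, weight N m (c • ξ) * ‖φ ξ‖ₑ ^ 2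
        ≤ ENNReal.ofReal (c ^ N) * ∫⁻ ξ : Eucl N,
          ENNReal.ofReal ((c ^ 2) ^ (m : ℝ)) * (weight N m ξ * ‖φ ξ‖ₑ ^ 2) := by
          refine mul_le_mul_right (lintegral_mono fun ξ => ?_) _
          rw [← mul_assoc]
          exact mul_le_mul_left (h2 ξ) _
      _ = _ := by
          rw [lintegral_const_mul' _ _ ENNReal.ofReal_ne_top, ← mul_assoc,
            ← ENNReal.ofReal_mul (by positivity), ← ENNReal.ofReal_pow (by positivity)]
          congr 2
          rw [← Real.rpow_natCast, ← Real.rpow_natCast, ← Real.rpow_natCast,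
            ← Real.rpow_mul hc0.le, ← Real.rpow_mul hc0.le, ← Real.rpow_add hc0]
          congr 1
          push_cast
          ring
  rw [ENNReal.pow_le_pow_left_iff two_ne_zero, ← ofReal_norm, ← ofReal_norm,
    ← ENNReal.ofReal_mul (by positivity), ENNReal.ofReal_le_ofReal_iff (by positivity)] at h3
  exact h3

end SchwartzVec


/-! ### Eigenvectors by Mellin transforms -/

section Mellin

open Filter Topology Set FourierTransform SchwartzMap

/-! ### Mellin transforms expressed through the beta function -/

theorem image_div_one_sub_Ioo : (fun x : ℝ => x / (1 - x)) '' Ioo 0 1 = Ioi 0 := by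
  ext t
  simp only [mem_image, mem_Ioo, mem_Ioi]
  constructor
  · rintro ⟨x, ⟨h0, h1⟩, rfl⟩
    exact div_pos h0 (by linarith)
  · intro ht
    refine ⟨t / (1 + t), ⟨by positivity, by rw [div_lt_one (by positivity)]; linarith⟩, ?_⟩
    field_simp
    ring

/-- The substitution t = x/(1 - x) maps (0,1) onto (0,∞). -/
theorem mellin_one_add_rpow_neg (M : ℝ) (a : ℂ) :
    mellin (fun t : ℝ => (((1 + t) ^ (-M) : ℝ) : ℂ)) a = Complex.betaIntegral a (M - a) := by
  have hd : ∀ x ∈ Ioo (0 : ℝ) 1,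
      HasDerivWithinAt (fun x : ℝ => x / (1 - x)) (1 / (1 - x) ^ 2) (Ioo 0 1) x := by
    intro x hx
    have h1 : 1 - x ≠ 0 := by linarith [hx.2]
    have := ((hasDerivAt_id x).div ((hasDerivAt_id x).const_sub 1) h1).hasDerivWithinAt
      (s := Ioo 0 1)
    refine this.congr_deriv ?_
    simp
  have hi : InjOn (fun x : ℝ => x / (1 - x)) (Ioo 0 1) := by
    intro x hx y hy h
    have h1 : 1 - x ≠ 0 := by linarith [hx.2]
    have h2 : 1 - y ≠ 0 := by linarith [hy.2]
    simp only [div_eq_div_iff h1 h2] at h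
    linarith
  rw [mellin, ← image_div_one_sub_Ioo,
    integral_image_eq_integral_abs_deriv_smul measurableSet_Ioo hd hi, Complex.betaIntegral,
    intervalIntegral.integral_of_le zero_le_one, integral_Ioc_eq_integral_Ioo]
  refine setIntegral_congr_fun measurableSet_Ioo fun x hx => ?_
  have hx0 := hx.1
  have hy : 0 < 1 - x := by linarith [hx.2]
  have e0 : (1 - (x : ℂ)) = ((1 - x : ℝ) : ℂ) := by push_cast; ring
  have e1 : 1 + x / (1 - x) = (1 - x)⁻¹ := by field_simp; ring
  rw [e0, e1]
  set y := 1 - x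
  have hyc : (y : ℂ) ≠ 0 := by exact_mod_cast hy.ne'
  rw [Real.inv_rpow hy.le, ← Real.rpow_neg hy.le, neg_neg, abs_of_pos (by positivity),
    div_eq_mul_inv x, Complex.ofReal_mul, Complex.mul_cpow_ofReal_nonneg hx0.le (by positivity),
    Complex.ofReal_inv, Complex.inv_cpow _ _ (by
      rw [Complex.arg_ofReal_of_nonneg hy.le]; exact Real.pi_pos.ne), ← Complex.cpow_neg,
    Complex.ofReal_cpow hy.le, Complex.real_smul, smul_eq_mul]
  have e2 : ((1 / y ^ 2 : ℝ) : ℂ) = (y : ℂ) ^ (-2 : ℂ) := by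
    rw [Complex.cpow_neg]
    push_cast
    rw [one_div, Complex.cpow_ofNat]
  rw [e2, show (M : ℂ) - a - 1 = -2 + (-(a - 1)) + M by ring, Complex.cpow_add _ _ hyc,
    Complex.cpow_add _ _ hyc]
  ring

theorem ContinuousLinearMap.map_mellin {X Y : Type*} [NormedAddCommGroup X] [NormedSpace ℂ X]
    [CompleteSpace X] [NormedAddCommGroup Y] [NormedSpace ℂ Y] [CompleteSpace Y] (L : X →L[ℂ] Y)
    {f : ℝ → X} {z : ℂ} (hf : MellinConvergent f z) :
    L (mellin f z) = mellin (fun t => L (f t)) z := by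
  have := L.integral_comp_comm hf
  simp only [map_smul] at this
  exact this.symm

/-- Rescaling and t = s² reduce to a beta integral, a quotient of Gamma values at points with
positive real part. This ensures that the eigenvectors constructed below are nonzero. -/
theorem mellin_two_add_sq_rpow_neg_ne_zero {M : ℝ} {w : ℂ} (h0 : 0 < w.re) (h1 : w.re < 2 * M) :
    mellin (fun s : ℝ => (((2 + s ^ 2) ^ (-M) : ℝ) : ℂ)) w ≠ 0 := by
  set f : ℝ → ℂ := fun t => (((1 + t) ^ (-M) : ℝ) : ℂ) with hf
  set g : ℝ → ℂ := fun t => f (2⁻¹ * t) with hg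
  have e : (fun s : ℝ => (((2 + s ^ 2) ^ (-M) : ℝ) : ℂ)) =
      fun s : ℝ => (((2 : ℝ) ^ (-M) : ℝ) : ℂ) • g (s ^ (2 : ℝ)) := by
    ext s
    rw [hg, hf]
    simp only [smul_eq_mul]
    rw [Real.rpow_two, ← Complex.ofReal_mul, ← Real.mul_rpow (by positivity) (by positivity)]
    congr 2
    ring
  rw [e, mellin_const_smul, mellin_comp_rpow, hg, mellin_comp_mul_left f _ (by norm_num), hf,
    mellin_one_add_rpow_neg]
  have hw : (w / ((2 : ℝ) : ℂ)).re = w.re / 2 := by rw [Complex.div_ofReal_re]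
  have hr1 : 0 < (w / ((2 : ℝ) : ℂ)).re := by rw [hw]; linarith
  have hr2 : 0 < (M - w / ((2 : ℝ) : ℂ)).re := by
    rw [Complex.sub_re, hw, Complex.ofReal_re]; linarith
  refine smul_ne_zero ?_ (smul_ne_zero (by positivity) (smul_ne_zero ?_ ?_))
  · exact_mod_cast (by positivity : (0 : ℝ) < 2 ^ (-M)).ne'
  · rw [Ne, Complex.cpow_eq_zero_iff]
    simp
  · rw [Complex.betaIntegral_eq_Gamma_mul_div _ _ hr1 hr2]
    refine div_ne_zero (mul_ne_zero (Complex.Gamma_ne_zero_of_re_pos hr1)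
      (Complex.Gamma_ne_zero_of_re_pos hr2)) (Complex.Gamma_ne_zero_of_re_pos ?_)
    rw [Complex.add_re]
    exact add_pos hr1 hr2

theorem mellinConvergent_one_add_sq_rpow {e : ℝ} {w : ℂ} (h0 : 0 < w.re) (h1 : w.re < -(2 * e)) :
    MellinConvergent (fun s : ℝ => (((1 + s ^ 2) ^ e : ℝ) : ℂ)) w := by
  have hc : Continuous fun s : ℝ => (((1 + s ^ 2) ^ e : ℝ) : ℂ) :=
    Complex.continuous_ofReal.comp
      (Continuous.rpow_const (by fun_prop) fun s => Or.inl (by positivity))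
  have he : e ≤ 0 := by linarith
  refine mellinConvergent_of_isBigO_rpow (a := -(2 * e)) (b := 0)
    (hc.locallyIntegrable.locallyIntegrableOn _) ?_ h1 ?_ h0
  · refine Asymptotics.IsBigO.of_bound 1 ?_
    filter_upwards [eventually_gt_atTop (0 : ℝ)] with s hs
    rw [Complex.norm_real, Real.norm_of_nonneg (by positivity), Real.norm_of_nonneg (by positivity),
      one_mul, neg_neg, Real.rpow_mul hs.le, Real.rpow_two]
    exact Real.rpow_le_rpow_of_nonpos (by positivity) (by linarith) he
  · refine Asymptotics.IsBigO.of_bound 1 ?_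
    filter_upwards with s
    rw [Complex.norm_real, Real.norm_of_nonneg (by positivity), neg_zero, Real.rpow_zero, norm_one,
      one_mul]
    exact Real.rpow_le_one_of_one_le_of_nonpos (by nlinarith [sq_nonneg s]) he

variable {N : ℕ} {m : ℝ≥0}

theorem schwartzVec_smul (c : ℂ) (φ : 𝓢(Eucl N, ℂ)) :
    schwartzVec m (c • φ) = c • schwartzVec m φ :=
  map_smul (toLpCLM ℂ ℂ 2 (weightMeasure N m)) c φ

theorem four_pi_sq_pos : 0 < 4 * Real.pi ^ 2 := by positivity

/-! ### An orbit of the semigroup extended to all s > 0 -/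

/-- The Schwartz function with Fourier transform `|p|^{2j} exp (-4π²|p|²)`. -/
def radialProfile (N j : ℕ) : 𝓢(Eucl N, ℂ) :=
  𝓕⁻ (smulLeftCLM ℂ (fun p : Eucl N => ((‖p‖ ^ 2 : ℝ) : ℂ) ^ j)
    (gaussianSchwartz N (4 * Real.pi ^ 2) four_pi_sq_pos))

theorem fourier_radialProfile (j : ℕ) (p : Eucl N) :
    𝓕 (radialProfile N j) p =
      ((‖p‖ ^ 2 : ℝ) : ℂ) ^ j * Real.exp (-(4 * Real.pi ^ 2 * ‖p‖ ^ 2)) := by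
  have h : Function.HasTemperateGrowth fun p : Eucl N => ((‖p‖ ^ 2 : ℝ) : ℂ) ^ j :=
    hasTemperateGrowth_ofReal_norm_sq.pow j
  rw [radialProfile, FourierTransform.fourier_fourierInv_eq, smulLeftCLM_apply_apply h,
    gaussianSchwartz_apply, smul_eq_mul]

/-- The Schwartz function with Fourier transform `(s|p|)^{2j} exp (-4π²(1 + s²)|p|²)`. -/
def spreadProfile (N j : ℕ) (s : ℝ) : 𝓢(Eucl N, ℂ) :=
  ((s ^ (2 * j) * (√(1 + s ^ 2) ^ (2 * j + N))⁻¹ : ℝ) : ℂ) •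
    dilate √(1 + s ^ 2) (radialProfile N j)

theorem fourier_spreadProfile (j : ℕ) (s : ℝ) (p : Eucl N) :
    𝓕 (spreadProfile N j s) p = ((s ^ 2 * ‖p‖ ^ 2 : ℝ) : ℂ) ^ j *
      Real.exp (-(4 * Real.pi ^ 2 * (1 + s ^ 2) * ‖p‖ ^ 2)) := by
  have hc : 0 < √(1 + s ^ 2) := Real.sqrt_pos.2 (by positivity)
  have hc2 : √(1 + s ^ 2) ^ 2 = 1 + s ^ 2 := Real.sq_sqrt (by positivity)
  rw [spreadProfile, FourierTransform.fourier_smul, smul_apply, fourier_dilate hc,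
    fourier_radialProfile, norm_smul, Real.norm_of_nonneg hc.le, mul_pow, hc2, smul_eq_mul]
  rw [← mul_assoc (4 * Real.pi ^ 2)]
  set c := √(1 + s ^ 2)
  rw [← hc2]
  have hcc : (c : ℂ) ≠ 0 := by exact_mod_cast hc.ne'
  push_cast
  field_simp
  ring

theorem measurable_spreadProfile (j : ℕ) :
    Measurable (Function.uncurry fun (s : ℝ) (ξ : Eucl N) => spreadProfile N j s ξ) := by
  have h1 : (Function.uncurry fun (s : ℝ) (ξ : Eucl N) => spreadProfile N j s ξ) = fun p =>
      ((p.1 ^ (2 * j) * (√(1 + p.1 ^ 2) ^ (2 * j + N))⁻¹ : ℝ) : ℂ) *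
        radialProfile N j ((√(1 + p.1 ^ 2))⁻¹ • p.2) := by
    ext p
    have hc : √(1 + p.1 ^ 2) ≠ 0 := (Real.sqrt_pos.2 (by positivity)).ne'
    rw [Function.uncurry, spreadProfile, smul_apply, dilate_apply hc, smul_eq_mul]
  rw [h1]
  refine Measurable.mul (by fun_prop) ((radialProfile N j).continuous.measurable.comp ?_)
  fun_prop

/-- The bound is of order s^{2j} at 0 and s^{m - N/2} at infinity, so the Mellin transform at 2z
converges for -j < Re z < N/4 - m/2. -/
theorem norm_schwartzVec_spreadProfile_le (j : ℕ) {s : ℝ} (hs : 0 < s) :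
    ‖schwartzVec m (spreadProfile N j s)‖ ≤
      s ^ (2 * j) * (1 + s ^ 2) ^ (-j - N / 4 + m / 2 : ℝ) * ‖schwartzVec m (radialProfile N j)‖ := by
  have hc : 0 < √(1 + s ^ 2) := Real.sqrt_pos.2 (by positivity)
  have hc1 : 1 ≤ √(1 + s ^ 2) := Real.one_le_sqrt.2 (by nlinarith)
  have hc2 : √(1 + s ^ 2) ^ 2 = 1 + s ^ 2 := Real.sq_sqrt (by positivity)
  rw [spreadProfile, schwartzVec_smul, norm_smul, Complex.norm_real,
    Real.norm_of_nonneg (by positivity)]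
  refine (mul_le_mul_of_nonneg_left (norm_schwartzVec_dilate_le hc1 _) (by positivity)).trans_eq ?_
  set c := √(1 + s ^ 2)
  rw [← hc2, ← mul_assoc, mul_assoc (s ^ _)]
  congr 2
  rw [← Real.rpow_natCast, ← Real.rpow_natCast, ← Real.rpow_mul hc.le, ← Real.rpow_neg hc.le,
    ← Real.rpow_add hc]
  congr 1
  push_cast
  ring

/-- (1 - r²) + (1 + s²) r² = 1 + (rs)². The parameter s is not confined to (0,1), so S(r) acts on a
Mellin transform over the whole half-line as a change of scale. -/
theorem semigroupL_spreadProfile (j : ℕ) {r : ℝ} (hr : r ∈ Ioo (0 : ℝ) 1) (s : ℝ) :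
    semigroupL m r (schwartzVec m (spreadProfile N j s)) =
      schwartzVec m (spreadProfile N j (r * s)) := by
  refine semigroupL_schwartzVec hr fun p => ?_
  rw [fourier_spreadProfile, fourier_spreadProfile, norm_smul, Real.norm_of_nonneg hr.1.le,
    mul_left_comm, ← Complex.ofReal_mul, ← Real.exp_add]
  congr 1
  · congr 2
    ring
  · congr 2
    ring

theorem mellinConvergent_spreadProfile {j : ℕ} {z : ℂ} (h0 : -(j : ℝ) < z.re)
    (h1 : z.re < N / 4 - m / 2) :
    MellinConvergent (fun s => schwartzVec m (spreadProfile N j s)) (2 * z) := by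
  have hz : (2 * z).re = 2 * z.re := by simp
  have h2 : MellinConvergent (fun s : ℝ => (s : ℂ) ^ ((2 * j : ℕ) : ℂ) •
      (((1 + s ^ 2) ^ (-j - N / 4 + m / 2 : ℝ) : ℝ) : ℂ)) (2 * z) := by
    rw [MellinConvergent.cpow_smul]
    refine mellinConvergent_one_add_sq_rpow ?_ ?_ <;> rw [Complex.add_re, hz, Complex.natCast_re]
      <;> push_cast <;> linarith
  have h3 : AEStronglyMeasurable (fun s => schwartzVec m (spreadProfile N j s))
      (volume.restrict (Ioi 0)) :=
    aestronglyMeasurable_of_coeFn_eq (measurable_spreadProfile j) measurableSet_Ioi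
      fun s _ => coeFn_schwartzVec _
  have h4 : AEStronglyMeasurable (fun t : ℝ => (t : ℂ) ^ (2 * z - 1)) (volume.restrict (Ioi 0)) := by
    refine Measurable.aestronglyMeasurable ?_
    fun_prop
  refine (h2.norm.mul_const ‖schwartzVec m (radialProfile N j)‖).mono' (h4.smul h3) ?_
  filter_upwards [ae_restrict_mem measurableSet_Ioi] with s hs
  have hs0 : (0 : ℝ) < s := hs
  rw [norm_smul, norm_smul, norm_smul, mul_assoc]
  gcongr
  refine (norm_schwartzVec_spreadProfile_le j hs0).trans_eq ?_
  rw [Complex.cpow_natCast, norm_pow, Complex.norm_real, Complex.norm_real,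
    Real.norm_of_nonneg hs0.le, Real.norm_of_nonneg (by positivity)]

theorem exists_integral_gaussian_mul_spreadProfile (hN : 1 ≤ N) (j : ℕ) :
    ∃ C : ℂ, C ≠ 0 ∧ ∀ s : ℝ,
      ∫ p : Eucl N, gaussianSchwartz N (4 * Real.pi ^ 2) four_pi_sq_pos p *
        𝓕 (spreadProfile N j s) p =
        C * ((s : ℂ) ^ (2 * j) * (((2 + s ^ 2) ^ (-(j + N / 2 : ℝ)) : ℝ) : ℂ)) := by
  set f : Eucl N → ℝ := fun p => (‖p‖ ^ 2) ^ j * Real.exp (-(4 * Real.pi ^ 2 * ‖p‖ ^ 2)) with hf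
  have hfc : Continuous f := by fun_prop
  have hf0 : 0 ≤ f := fun p => by positivity
  have hfi : Integrable f := by
    refine (𝓕 (radialProfile N j)).integrable.re.congr (.of_forall fun p => ?_)
    simp only [fourier_radialProfile]
    rw [← Complex.ofReal_pow, ← Complex.ofReal_mul]
    exact Complex.ofReal_re _
  have hpos : 0 < ∫ p, f p := by
    rw [integral_pos_iff_support_of_nonneg hf0 hfi]
    -- A unit vector lies in the support; for N = 0 and j > 0 the function would vanish identically.
    refine (hfc.isOpen_support).measure_pos _ ⟨EuclideanSpace.single ⟨0, hN⟩ 1, ?_⟩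
    rw [Function.mem_support, hf]
    simp
  refine ⟨((∫ p, f p : ℝ) : ℂ), by exact_mod_cast hpos.ne', fun s => ?_⟩
  -- The two Gaussians have total rate 4π²(2 + s²), so dilation by c extracts the whole dependence
  -- on s.
  set c := √(2 + s ^ 2) with hcdef
  have hc : 0 < c := Real.sqrt_pos.2 (by positivity)
  have hc2 : c ^ 2 = 2 + s ^ 2 := Real.sq_sqrt (by positivity)
  have h1 : ∀ p : Eucl N, gaussianSchwartz N (4 * Real.pi ^ 2) four_pi_sq_pos p *
      𝓕 (spreadProfile N j s) p = ((s ^ (2 * j) * (c ^ (2 * j))⁻¹ * f (c • p) : ℝ) : ℂ) := by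
    intro p
    rw [gaussianSchwartz_apply, fourier_spreadProfile, hf]
    simp only
    rw [norm_smul, Real.norm_of_nonneg hc.le, mul_left_comm, ← Complex.ofReal_mul, ← Real.exp_add,
      ← Complex.ofReal_pow, ← Complex.ofReal_mul]
    congr 1
    rw [show -(4 * Real.pi ^ 2 * ‖p‖ ^ 2) + -(4 * Real.pi ^ 2 * (1 + s ^ 2) * ‖p‖ ^ 2) =
      -(4 * Real.pi ^ 2 * (c * ‖p‖) ^ 2) by rw [mul_pow c, hc2]; ring]
    field_simp
    ring
  simp only [h1]
  rw [integral_complex_ofReal, integral_const_mul, Measure.integral_comp_smul, finrank_euclideanSpace_fin,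
    abs_of_pos (by positivity), ← hc2, smul_eq_mul]
  have h2 : (c ^ 2) ^ (-(j + N / 2 : ℝ)) = (c ^ (2 * j))⁻¹ * (c ^ N)⁻¹ := by
    rw [← Real.rpow_natCast, ← Real.rpow_natCast, ← Real.rpow_natCast, ← Real.rpow_mul hc.le,
      ← Real.rpow_neg hc.le, ← Real.rpow_neg hc.le, ← Real.rpow_add hc]
    congr 1
    push_cast
    ring
  rw [h2]
  push_cast
  ring

/-- Every point of the open half-plane is an eigenvalue. -/
theorem isEigenvalue_of_re_lt (hN : 1 ≤ N) {z : ℂ} (hz : z.re < N / 4 - m / 2) :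
    UnboundedOp.IsEigenvalue (opL N m) z := by
  -- Vanishing of order 2j at p = 0 secures convergence of the Mellin integral at s = 0.
  obtain ⟨j, hj⟩ := exists_nat_gt (-z.re)
  have hj' : -(j : ℝ) < z.re := by linarith
  have hconv := mellinConvergent_spreadProfile hj' hz
  set u := mellin (fun s => schwartzVec m (spreadProfile N j s)) (2 * z) with hu
  have hmem : u ∈ UnboundedOp.eigenspace (opL N m) z := by
    rw [(isExpandingSemigroup_semigroupL N m).mem_eigenspace_iff]
    intro r hr
    rw [show -2 * z = -(2 * z) by ring, hu, ← mellin_comp_mul_left _ _ hr.1,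
      ContinuousLinearMap.map_mellin _ hconv]
    simp only [semigroupL_spreadProfile j hr]
  -- Pairing with a Gaussian reduces u ≠ 0 to a nonvanishing scalar Mellin transform.
  have hne : u ≠ 0 := by
    obtain ⟨C, hC, h⟩ := exists_integral_gaussian_mul_spreadProfile hN j
    intro hu0
    have h1 : testFunctional m (gaussianSchwartz N (4 * Real.pi ^ 2) four_pi_sq_pos) u =
        C * mellin (fun s : ℝ => (((2 + s ^ 2) ^ (-(j + N / 2 : ℝ)) : ℝ) : ℂ))
          (2 * z + (2 * j : ℕ)) := by
      rw [← mellin_cpow_smul, ← smul_eq_mul C, ← mellin_const_smul, hu,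
        ContinuousLinearMap.map_mellin _ hconv]
      simp only [testFunctional_schwartzVec, h, Complex.cpow_natCast, smul_eq_mul]
    rw [hu0, map_zero] at h1
    refine mul_ne_zero hC (mellin_two_add_sq_rpow_neg_ne_zero ?_ ?_) h1.symm
    · simp
      linarith
    · have := m.coe_nonneg
      simp
      have : (0 : ℝ) ≤ N := N.cast_nonneg
      linarith
  intro hbot
  rw [hbot] at hmem
  exact hne hmem

end Mellin


/-! ### The dimension of the eigenspaces -/

section Dimension

open Filter Topology Set FourierTransform SchwartzMap

variable {N : ℕ} {m : ℝ≥0} {k : ℕ}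

/-- The monomial of degree `k` with the exponents `α`. -/
def evalMonomial (α : Sym (Fin N) k) (p : Eucl N) : ℂ :=
  ((α : Multiset (Fin N)).map fun i => (p i : ℂ)).prod

theorem evalMonomial_smul (α : Sym (Fin N) k) (r : ℝ) (p : Eucl N) :
    evalMonomial α (r • p) = (r : ℂ) ^ k * evalMonomial α p := by
  have h1 : (fun i => ((r • p) i : ℂ)) = fun i => (r : ℂ) * (p i : ℂ) := by
    ext i
    simp
  rw [evalMonomial, evalMonomial, h1, Multiset.prod_map_mul, Multiset.map_const',
    Multiset.prod_replicate, α.card_coe]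

theorem hasTemperateGrowth_multiset_prod (α : Multiset (Fin N)) :
    Function.HasTemperateGrowth fun p : Eucl N => (α.map fun i => (p i : ℂ)).prod := by
  induction α using Multiset.induction_on with
  | empty => simp
  | cons i α ih =>
    simp only [Multiset.map_cons, Multiset.prod_cons]
    exact (hasTemperateGrowth_coord i).mul ih

theorem norm_evalMonomial_le (α : Sym (Fin N) k) (p : Eucl N) : ‖evalMonomial α p‖ ≤ ‖p‖ ^ k := by
  have h : ∀ s : Multiset (Fin N), ‖(s.map fun i => (p i : ℂ)).prod‖ ≤ ‖p‖ ^ s.card := by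
    intro s
    induction s using Multiset.induction_on with
    | empty => simp
    | cons i s ih =>
      rw [Multiset.map_cons, Multiset.prod_cons, norm_mul, Multiset.card_cons, pow_succ',
        Complex.norm_real]
      gcongr
      exact PiLp.norm_apply_le p i
  have := h (α : Multiset (Fin N))
  rwa [α.card_coe] at this

/-- A complex polynomial vanishing at all real points is zero, since ℝ is infinite. -/
theorem eq_zero_of_sum_mul_evalMonomial {c : Sym (Fin N) k → ℂ}
    (h : ∀ p : Eucl N, ∑ α, c α * evalMonomial α p = 0) : c = 0 := by
  classical
  set Q : MvPolynomial (Fin N) ℂ :=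
    ∑ α : Sym (Fin N) k, MvPolynomial.monomial (Multiset.toFinsupp (α : Multiset (Fin N))) (c α)
    with hQ
  have hQ0 : Q = 0 := by
    refine MvPolynomial.funext_set (fun _ => Set.range ((↑) : ℝ → ℂ))
      (fun _ => Set.infinite_range_of_injective Complex.ofReal_injective) fun x hx => ?_
    choose p hp using fun i => hx i (mem_univ i)
    rw [map_zero, hQ, map_sum, ← h (WithLp.toLp 2 p)]
    refine Finset.sum_congr rfl fun α _ => ?_
    rw [MvPolynomial.eval_monomial, evalMonomial, Finset.prod_multiset_map_count, Finsupp.prod,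
      Multiset.toFinsupp_support]
    simp only [Multiset.toFinsupp_apply, hp]
  ext α
  have h1 : MvPolynomial.coeff (Multiset.toFinsupp (α : Multiset (Fin N))) Q = c α := by
    rw [hQ, MvPolynomial.coeff_sum, Finset.sum_eq_single α]
    · rw [MvPolynomial.coeff_monomial, if_pos rfl]
    · intro β _ hβ
      rw [MvPolynomial.coeff_monomial, if_neg]
      intro h2
      exact hβ (Sym.coe_injective (Multiset.toFinsupp.injective h2))
    · simp
  rw [← h1, hQ0]
  simp

/-- The Schwartz function with Fourier transform `p^α exp (-4π²|p|²)`. -/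
def hermite (α : Sym (Fin N) k) : 𝓢(Eucl N, ℂ) :=
  𝓕⁻ (smulLeftCLM ℂ (evalMonomial α) (gaussianSchwartz N (4 * Real.pi ^ 2) four_pi_sq_pos))

theorem fourier_hermite (α : Sym (Fin N) k) (p : Eucl N) :
    𝓕 (hermite α) p = evalMonomial α p * Real.exp (-(4 * Real.pi ^ 2 * ‖p‖ ^ 2)) := by
  have h : Function.HasTemperateGrowth (evalMonomial α) :=
    hasTemperateGrowth_multiset_prod (α : Multiset (Fin N))
  rw [hermite, FourierTransform.fourier_fourierInv_eq, smulLeftCLM_apply_apply h,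
    gaussianSchwartz_apply, smul_eq_mul]

theorem mem_eigenspace_opL_iff {u : WeightedL2 N m} :
    u ∈ UnboundedOp.eigenspace (opL N m) (-(k : ℂ) / 2) ↔
      ∀ s ∈ Ioo (0 : ℝ) 1, semigroupL m s u = (s : ℂ) ^ k • u := by
  rw [(isExpandingSemigroup_semigroupL N m).mem_eigenspace_iff,
    show -2 * (-(k : ℂ) / 2) = k by ring]
  simp only [Complex.cpow_natCast]

/-- The Gaussian rates combine as (1 - r²) + r² = 1, and homogeneity of p^α leaves the factor r^k.
-/
theorem schwartzVec_hermite_mem (α : Sym (Fin N) k) :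
    schwartzVec m (hermite α) ∈ UnboundedOp.eigenspace (opL N m) (-(k : ℂ) / 2) := by
  rw [mem_eigenspace_opL_iff]
  intro r hr
  rw [← schwartzVec_smul]
  refine semigroupL_schwartzVec hr fun p => ?_
  rw [FourierTransform.fourier_smul, smul_apply, fourier_hermite, fourier_hermite,
    evalMonomial_smul, norm_smul, Real.norm_of_nonneg hr.1.le, mul_left_comm, ← Complex.ofReal_mul,
    ← Real.exp_add, smul_eq_mul, ← mul_assoc (_ ^ k)]
  congr 3
  ring

theorem linearIndependent_hermite (m : ℝ≥0) :
    LinearIndependent ℂ fun α : Sym (Fin N) k => schwartzVec m (hermite α) := by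
  rw [Fintype.linearIndependent_iff]
  intro c hc
  have : (weightMeasure N m).IsOpenPosMeasure := (volume_le_weightMeasure N m).isOpenPosMeasure
  have h1 : schwartzVec m (∑ α, c α • hermite α) = schwartzVec m (0 : 𝓢(Eucl N, ℂ)) := by
    have h2 := map_sum (toLpCLM ℂ ℂ 2 (weightMeasure N m)) (fun α => c α • hermite α) Finset.univ
    simp only [map_smul] at h2
    exact (h2.trans hc).trans (map_zero (toLpCLM ℂ ℂ 2 (weightMeasure N m))).symm
  have h2 := injective_toLp 2 (weightMeasure N m) h1
  have h3 : c = 0 := by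
    refine eq_zero_of_sum_mul_evalMonomial fun p => ?_
    have h4 : 𝓕 (∑ α, c α • hermite α) p = 0 := by
      rw [h2, FourierTransform.fourier_zero]
      rfl
    rw [FourierTransform.fourier_sum] at h4
    simp only [FourierTransform.fourier_smul, sum_apply, smul_apply, fourier_hermite, smul_eq_mul,
      ← mul_assoc, ← Finset.sum_mul] at h4
    refine (mul_eq_zero.1 h4).resolve_right ?_
    exact_mod_cast (Real.exp_pos _).ne'
  exact fun α => congrFun h3 α

/-! ### Eigenvectors are determined by their moments of degree k -/

theorem WeightedL2.integrable_one_add_norm_rpow_mul {β : ℝ} (hβ : β < m - N / 2)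
    (u : WeightedL2 N m) : Integrable fun y : Eucl N => (1 + ‖y‖) ^ β * ‖u y‖ := by
  have hm : Measurable fun y : Eucl N => (1 + ‖y‖) ^ β * ‖u y‖ :=
    Measurable.mul (by fun_prop) (KernelBound.measurable_coe u).norm
  refine ⟨hm.aestronglyMeasurable, ?_⟩
  rw [hasFiniteIntegral_iff_enorm]
  have h1 := sq_lintegral_one_add_norm_rpow_mul_le (m := m) β (KernelBound.measurable_coe u).enorm
  rw [KernelBound.lintegral_enorm_sq] at h1
  have h2 := h1.trans_lt (ENNReal.mul_lt_top (lintegral_one_add_norm_rpow_lt_top hβ) (by simp))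
  have h3 : ∀ y : Eucl N, ‖(1 + ‖y‖) ^ β * ‖u y‖‖ₑ =
      ENNReal.ofReal ((1 + ‖y‖) ^ β) * ‖u y‖ₑ := by
    intro y
    rw [enorm_mul, enorm_norm, Real.enorm_of_nonneg (by positivity)]
  simp only [h3]
  by_contra htop
  rw [not_lt, top_le_iff] at htop
  rw [htop] at h2
  simp at h2

theorem WeightedL2.integrable_mul_of_norm_le {β C : ℝ} (hβ : β < m - N / 2) {f : Eucl N → ℂ}
    (hf : Measurable f) (hfb : ∀ y, ‖f y‖ ≤ C * (1 + ‖y‖) ^ β) (u : WeightedL2 N m) :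
    Integrable fun y => f y * u y := by
  refine ((u.integrable_one_add_norm_rpow_mul hβ).const_mul C).mono'
    (hf.mul (KernelBound.measurable_coe u)).aestronglyMeasurable (.of_forall fun y => ?_)
  rw [norm_mul, ← mul_assoc]
  gcongr
  exact hfb y

theorem measurable_evalMonomial (α : Sym (Fin N) k) : Measurable (evalMonomial α) :=
  (hasTemperateGrowth_multiset_prod (α : Multiset (Fin N))).1.continuous.measurable

theorem WeightedL2.integrable_evalMonomial_mul (hk : (k : ℝ) < m - N / 2) (α : Sym (Fin N) k)
    (u : WeightedL2 N m) : Integrable fun y => evalMonomial α y * u y := by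
  refine u.integrable_mul_of_norm_le (C := 1) hk (measurable_evalMonomial α) fun y => ?_
  rw [one_mul, Real.rpow_natCast]
  refine (norm_evalMonomial_le α y).trans ?_
  gcongr
  linarith

theorem WeightedL2.integrable (hm : (0 : ℝ) < m - N / 2) (u : WeightedL2 N m) :
    Integrable (u : Eucl N → ℂ) := by
  have := u.integrable_mul_of_norm_le (β := 0) (C := 1) hm (f := fun _ => 1) measurable_const
    (by simp)
  simpa using this

/-- The moments of degree `k`. -/
def momentMap (hk : (k : ℝ) < m - N / 2) : WeightedL2 N m →ₗ[ℂ] (Sym (Fin N) k → ℂ) where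
  toFun u α := ∫ y, evalMonomial α y * u y
  map_add' u v := by
    ext α
    rw [Pi.add_apply, ← integral_add (u.integrable_evalMonomial_mul hk α)
      (v.integrable_evalMonomial_mul hk α)]
    refine integral_congr_ae ?_
    filter_upwards [volume_absolutelyContinuous_weightMeasure.ae_le (Lp.coeFn_add u v)] with y hy
    rw [hy, Pi.add_apply, mul_add]
  map_smul' c u := by
    ext α
    rw [Pi.smul_apply, RingHom.id_apply, ← integral_smul]
    refine integral_congr_ae ?_
    filter_upwards [volume_absolutelyContinuous_weightMeasure.ae_le (Lp.coeFn_smul c u)] with y hy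
    rw [hy, Pi.smul_apply, smul_eq_mul, smul_eq_mul]
    ring

/-- Elements of L²(m) need not have moments of order k + 1, so the Taylor error is measured by
|x|^β: for |x| ≤ 1 by the next power, for |x| > 1 term by term. -/
theorem norm_cexp_sub_sum_le {β : ℝ} (h1 : (k : ℝ) ≤ β) (h2 : β ≤ k + 1) (x : ℝ) :
    ‖Complex.exp (x * Complex.I) - ∑ j ∈ Finset.range (k + 1),
      (x * Complex.I) ^ j / (j.factorial : ℂ)‖ ≤ (k + 2) * |x| ^ β := by
  have hx : ‖(x : ℂ) * Complex.I‖ = |x| := by simp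
  have hk0 : (0 : ℝ) ≤ k := k.cast_nonneg
  rcases le_or_gt |x| 1 with h | h
  · refine (Complex.exp_bound (by rwa [hx]) k.succ_pos).trans ?_
    rw [hx, mul_comm]
    refine mul_le_mul ?_ ?_ (by positivity) (by positivity)
    · rw [← div_eq_mul_inv, div_le_iff₀ (by positivity)]
      have : (1 : ℝ) ≤ (k + 1).factorial := by exact_mod_cast Nat.one_le_iff_ne_zero.2 (Nat.factorial_ne_zero _)
      push_cast
      nlinarith [mul_nonneg hk0 hk0, mul_nonneg (sub_nonneg.2 this) (by positivity : (0 : ℝ) ≤ (k + 2) * (k + 1))]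
    · rw [← Real.rpow_natCast]
      refine Real.rpow_le_rpow_of_exponent_ge' (abs_nonneg x) h (by linarith) ?_
      push_cast
      linarith
  · have h3 : ∀ j ∈ Finset.range (k + 1), ‖(x * Complex.I) ^ j / (j.factorial : ℂ)‖ ≤ |x| ^ β := by
      intro j hj
      rw [norm_div, norm_pow, hx, Complex.norm_natCast]
      have hj1 : (1 : ℝ) ≤ j.factorial := by exact_mod_cast Nat.one_le_iff_ne_zero.2 (Nat.factorial_ne_zero _)
      refine (div_le_self (by positivity) hj1).trans ?_
      rw [← Real.rpow_natCast]
      refine Real.rpow_le_rpow_of_exponent_le h.le (le_trans ?_ h1)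
      exact_mod_cast Nat.lt_succ_iff.1 (Finset.mem_range.1 hj)
    have h4 : (1 : ℝ) ≤ |x| ^ β := Real.one_le_rpow h.le (by linarith)
    refine (norm_sub_le _ _).trans ?_
    rw [Complex.norm_exp_ofReal_mul_I]
    refine (add_le_add h4 (norm_sum_le_of_le _ h3)).trans_eq ?_
    rw [Finset.sum_const, Finset.card_range, nsmul_eq_mul]
    push_cast
    ring

theorem fourier_semigroupL {s : ℝ} (hs : s ∈ Ioo (0 : ℝ) 1) {u : WeightedL2 N m}
    (hu : Integrable (u : Eucl N → ℂ)) (p : Eucl N) :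
    𝓕 (semigroupL m s u : Eucl N → ℂ) p =
      Real.exp (-(4 * Real.pi ^ 2 * (1 - s ^ 2) * ‖p‖ ^ 2)) * 𝓕 (u : Eucl N → ℂ) (s • p) := by
  rw [Real.fourier_eq', Real.fourier_eq']
  have h1 : ∫ ξ, Complex.exp ((-2 * Real.pi * inner ℝ ξ p : ℝ) * Complex.I) •
      (semigroupL m s u : Eucl N → ℂ) ξ = ∫ ξ, ∫ y,
        Complex.exp ((-2 * Real.pi * inner ℝ ξ p : ℝ) * Complex.I) * (mehlerC s ξ y * u y) := by
    refine integral_congr_ae ?_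
    filter_upwards [volume_absolutelyContinuous_weightMeasure.ae_le (coeFn_semigroupL hs u)]
      with ξ hξ
    rw [hξ, smul_eq_mul, integral_const_mul]
  have hm : Measurable fun q : Eucl N × Eucl N =>
      Complex.exp ((-2 * Real.pi * inner ℝ q.1 p : ℝ) * Complex.I) *
        (mehlerC s q.1 q.2 * u q.2) := by
    refine Measurable.mul (by fun_prop) ((measurable_uncurry_mehlerC s).mul
      ((KernelBound.measurable_coe u).comp measurable_snd))
  have hint : Integrable (fun q : Eucl N × Eucl N =>
      Complex.exp ((-2 * Real.pi * inner ℝ q.1 p : ℝ) * Complex.I) *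
        (mehlerC s q.1 q.2 * u q.2)) (volume.prod volume) := by
    -- With weight exponent 0 this bounds the ξ-mass of the kernel, which suffices for Fubini when u
    -- is integrable.
    obtain ⟨C, hC⟩ := exists_lintegral_weight_mul_mehler_le N 0
    refine ⟨hm.aestronglyMeasurable, ?_⟩
    rw [hasFiniteIntegral_iff_enorm, lintegral_prod_symm' _ hm.enorm]
    have h2 : ∀ y : Eucl N, ∫⁻ ξ : Eucl N,
        ‖Complex.exp ((-2 * Real.pi * inner ℝ ξ p : ℝ) * Complex.I) * (mehlerC s ξ y * u y)‖ₑ ≤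
          C * ‖u y‖ₑ := by
      intro y
      have h3 : ∀ ξ : Eucl N,
          ‖Complex.exp ((-2 * Real.pi * inner ℝ ξ p : ℝ) * Complex.I) * (mehlerC s ξ y * u y)‖ₑ =
            weight N 0 ξ * ENNReal.ofReal (mehler s ξ y) * ‖u y‖ₑ := by
        intro ξ
        have h4 : ‖Complex.exp ((-2 * Real.pi * inner ℝ ξ p : ℝ) * Complex.I)‖ₑ = 1 := by
          rw [← ofReal_norm, Complex.norm_exp_ofReal_mul_I, ENNReal.ofReal_one]
        rw [enorm_mul, enorm_mul, h4, enorm_mehlerC hs, weight]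
        simp
      simp only [h3]
      rw [lintegral_mul_const' _ _ enorm_ne_top]
      refine mul_le_mul_left ((hC s hs y).trans_eq ?_) _
      simp
    refine (lintegral_mono h2).trans_lt ?_
    rw [lintegral_const_mul' _ _ ENNReal.coe_ne_top]
    exact ENNReal.mul_lt_top ENNReal.coe_lt_top hu.2
  rw [h1, integral_integral_swap hint, ← integral_const_mul]
  refine integral_congr_ae (.of_forall fun y => ?_)
  have h2 : ∫ ξ : Eucl N, Complex.exp ((-2 * Real.pi * inner ℝ ξ p : ℝ) * Complex.I) *
      mehlerC s ξ y = 𝓕 (fun ξ : Eucl N => mehlerC s ξ y) p := by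
    rw [Real.fourier_eq']
    rfl
  simp only [← mul_assoc]
  rw [integral_mul_const, h2, fourier_mehlerC hs, inner_smul_right, real_inner_comm, smul_eq_mul,
    ← mul_assoc]
  rw [mul_comm (Complex.exp _)]
  congr 3
  push_cast
  ring

/-- The exponent of the Fourier transform. -/
def phase (p y : Eucl N) : ℝ := -2 * Real.pi * inner ℝ y p

theorem abs_phase_le (p y : Eucl N) : |phase p y| ≤ 2 * Real.pi * ‖p‖ * (1 + ‖y‖) := by
  rw [phase, abs_mul, abs_mul, abs_neg, abs_of_pos Real.pi_pos, abs_two]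
  have h1 := abs_real_inner_le_norm y p
  have h2 : |inner ℝ y p| ≤ ‖p‖ * (1 + ‖y‖) := by nlinarith [norm_nonneg p]
  rw [mul_assoc (2 * Real.pi)]
  gcongr

theorem measurable_phase (p : Eucl N) : Measurable (phase p) := by
  unfold phase
  fun_prop

theorem integrable_phase_pow_mul {β : ℝ} (hβ : β < m - N / 2) {j : ℕ} (hj : (j : ℝ) ≤ β)
    (p : Eucl N) (u : WeightedL2 N m) :
    Integrable fun y => (phase p y * Complex.I) ^ j / (j.factorial : ℂ) * u y := by
  have hm := measurable_phase p
  refine u.integrable_mul_of_norm_le (C := (2 * Real.pi * ‖p‖) ^ j) hβ (by fun_prop) fun y => ?_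
  have hj1 : (1 : ℝ) ≤ j.factorial := by exact_mod_cast j.factorial_pos
  rw [norm_div, norm_pow, norm_mul, Complex.norm_real, Complex.norm_I, mul_one, Real.norm_eq_abs,
    Complex.norm_natCast]
  refine (div_le_self (by positivity) hj1).trans ?_
  calc |phase p y| ^ j ≤ (2 * Real.pi * ‖p‖ * (1 + ‖y‖)) ^ j := by
        gcongr
        exact abs_phase_le p y
    _ = (2 * Real.pi * ‖p‖) ^ j * (1 + ‖y‖) ^ (j : ℝ) := by rw [mul_pow, Real.rpow_natCast]
    _ ≤ _ := by
        gcongr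
        linarith [norm_nonneg y]

theorem exists_norm_fourier_sub_sum_le {β : ℝ} (hβ : β < m - N / 2) (h1 : (k : ℝ) ≤ β)
    (h2 : β ≤ k + 1) (p : Eucl N) (u : WeightedL2 N m) :
    ∃ C, ∀ s ∈ Ioo (0 : ℝ) 1, ‖𝓕 (u : Eucl N → ℂ) (s • p) - ∑ j ∈ Finset.range (k + 1),
      (s : ℂ) ^ j * ∫ y, (phase p y * Complex.I) ^ j / (j.factorial : ℂ) * u y‖ ≤ C * s ^ β := by
  have hk0 : (0 : ℝ) ≤ k := k.cast_nonneg
  have hui := u.integrable (by linarith)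
  refine ⟨(k + 2) * (2 * Real.pi * ‖p‖) ^ β * ∫ y : Eucl N, (1 + ‖y‖) ^ β * ‖u y‖,
    fun s hs => ?_⟩
  have hs0 := hs.1
  have hj : ∀ j ∈ Finset.range (k + 1), (j : ℝ) ≤ β := fun j hj =>
    le_trans (by exact_mod_cast Nat.lt_succ_iff.1 (Finset.mem_range.1 hj)) h1
  have e1 : 𝓕 (u : Eucl N → ℂ) (s • p) =
      ∫ y, Complex.exp ((s * phase p y : ℝ) * Complex.I) * u y := by
    rw [Real.fourier_eq']
    refine integral_congr_ae (.of_forall fun y => ?_)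
    simp only [smul_eq_mul, inner_smul_right, phase]
    congr 4
    ring
  have e2 : ∑ j ∈ Finset.range (k + 1),
      (s : ℂ) ^ j * ∫ y, (phase p y * Complex.I) ^ j / (j.factorial : ℂ) * u y =
      ∫ y, (∑ j ∈ Finset.range (k + 1),
        ((s * phase p y : ℝ) * Complex.I) ^ j / (j.factorial : ℂ)) * u y := by
    simp only [← integral_const_mul]
    rw [← integral_finsetSum _ fun j hjm =>
      (integrable_phase_pow_mul hβ (hj j hjm) p u).const_mul _]
    refine integral_congr_ae (.of_forall fun y => ?_)
    simp only [Finset.sum_mul]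
    refine Finset.sum_congr rfl fun j _ => ?_
    push_cast
    rw [mul_assoc (s : ℂ), mul_pow (s : ℂ)]
    ring
  have hm := measurable_phase p
  have i1 : Integrable fun y => Complex.exp ((s * phase p y : ℝ) * Complex.I) * u y := by
    refine u.integrable_mul_of_norm_le (β := 0) (C := 1) (by linarith) (by fun_prop) fun y => ?_
    rw [Complex.norm_exp_ofReal_mul_I]
    simp
  have i2 : Integrable fun y => (∑ j ∈ Finset.range (k + 1),
        ((s * phase p y : ℝ) * Complex.I) ^ j / (j.factorial : ℂ)) * u y := by
    simp only [Finset.sum_mul]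
    refine integrable_finsetSum _ fun j hjm => ?_
    refine ((integrable_phase_pow_mul hβ (hj j hjm) p u).const_mul ((s : ℂ) ^ j)).congr
      (.of_forall fun y => ?_)
    push_cast
    rw [mul_assoc (s : ℂ), mul_pow (s : ℂ)]
    ring
  rw [e1, e2, ← integral_sub i1 i2, mul_right_comm, ← integral_const_mul]
  refine norm_integral_le_of_norm_le ((u.integrable_one_add_norm_rpow_mul hβ).const_mul _)
    (.of_forall fun y => ?_)
  rw [← sub_mul, norm_mul, ← mul_assoc]
  gcongr ?_ * _
  refine (norm_cexp_sub_sum_le h1 h2 _).trans ?_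
  rw [mul_assoc, mul_assoc]
  gcongr
  rw [← Real.mul_rpow hs0.le (by positivity), mul_comm, ← Real.mul_rpow (by positivity) (by positivity)]
  refine Real.rpow_le_rpow (abs_nonneg _) ?_ (by linarith)
  rw [abs_mul, abs_of_pos hs0]
  nlinarith [mul_le_mul_of_nonneg_left (abs_phase_le p y) hs0.le]

/-- The Fourier transform of an eigenvector is a polynomial times a Gaussian. -/
theorem fourier_of_mem_eigenspace (hk : (k : ℝ) < m - N / 2) {u : WeightedL2 N m}
    (hu : u ∈ UnboundedOp.eigenspace (opL N m) (-(k : ℂ) / 2)) (p : Eucl N) :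
    ∫ y, (phase p y * Complex.I) ^ k / (k.factorial : ℂ) * u y =
      Real.exp (4 * Real.pi ^ 2 * ‖p‖ ^ 2) * 𝓕 (u : Eucl N → ℂ) p := by
  have hk0 : (0 : ℝ) ≤ k := k.cast_nonneg
  rw [mem_eigenspace_opL_iff] at hu
  -- k < β < γ is needed for the moments, and β < k + 1 so that degree k is the last one expanded.
  obtain ⟨β, hβ1, hβ2⟩ := exists_between (lt_min hk (lt_add_one (k : ℝ)))
  have hβγ := hβ2.trans_le (min_le_left _ _)
  have hβk := hβ2.trans_le (min_le_right _ _)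
  have hui := u.integrable (by linarith)
  set a := 4 * Real.pi ^ 2 * ‖p‖ ^ 2 with ha
  have ha0 : 0 ≤ a := by positivity
  set F := 𝓕 (u : Eucl N → ℂ) with hF
  set μ : ℕ → ℂ := fun j => ∫ y, (phase p y * Complex.I) ^ j / (j.factorial : ℂ) * u y with hμ
  obtain ⟨C, hC⟩ := exists_norm_fourier_sub_sum_le hβγ hβ1.le hβk.le p u
  -- The eigenvalue equation for S(s), read on the Fourier side.
  have hscale : ∀ s ∈ Ioo (0 : ℝ) 1, F (s • p) = (s : ℂ) ^ k * (Real.exp (a * (1 - s ^ 2)) * F p) := by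
    intro s hs
    have h1 := fourier_semigroupL hs hui p
    have h2 : 𝓕 (semigroupL m s u : Eucl N → ℂ) p = (s : ℂ) ^ k * F p := by
      rw [hu s hs, hF, Real.fourier_eq', Real.fourier_eq', ← integral_const_mul]
      refine integral_congr_ae ?_
      filter_upwards [volume_absolutelyContinuous_weightMeasure.ae_le
        (Lp.coeFn_smul ((s : ℂ) ^ k) u)] with y hy
      rw [hy, Pi.smul_apply, smul_eq_mul, smul_eq_mul, smul_eq_mul]
      ring
    rw [h2] at h1
    rw [mul_left_comm, h1, ← mul_assoc, ← Complex.ofReal_mul, ← Real.exp_add, ha]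
    rw [show 4 * Real.pi ^ 2 * ‖p‖ ^ 2 * (1 - s ^ 2) + -(4 * Real.pi ^ 2 * (1 - s ^ 2) * ‖p‖ ^ 2) = 0
      by ring, Real.exp_zero, Complex.ofReal_one, one_mul]
  -- By scaling, F(sp) = s^k e^a F(p) + O(s^{k+2}). Comparison with the moment expansion of F(sp)
  -- identifies the coefficient of s^k as e^a F(p).
  have hc := eq_zero_of_norm_sum_pow_smul_le (M := k + 1) (β := β)
    (C := C + Real.exp a * a * ‖F p‖)
    (c := fun j => μ j - if j = k then Real.exp a * F p else 0)
    (fun j hj => lt_of_le_of_lt (by exact_mod_cast Nat.lt_succ_iff.1 hj) hβ1) fun s hs => by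
      have hs0 := hs.1
      have e1 : ∑ j ∈ Finset.range (k + 1), (s : ℂ) ^ j •
          (μ j - if j = k then Real.exp a * F p else 0) =
          ∑ j ∈ Finset.range (k + 1), (s : ℂ) ^ j * μ j - (s : ℂ) ^ k * (Real.exp a * F p) := by
        simp only [smul_eq_mul, mul_sub, Finset.sum_sub_distrib, mul_ite, mul_zero,
          Finset.sum_ite_eq', Finset.mem_range, lt_add_one, if_true]
      have e2 : ∑ j ∈ Finset.range (k + 1), (s : ℂ) ^ j * μ j - (s : ℂ) ^ k * (Real.exp a * F p) =
          -(F (s • p) - ∑ j ∈ Finset.range (k + 1), (s : ℂ) ^ j * μ j) +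
            (s : ℂ) ^ k * (Real.exp a * ((Real.exp (-(a * s ^ 2)) - 1 : ℝ) * F p)) := by
        rw [hscale s hs, mul_sub, mul_one, sub_eq_add_neg a, Real.exp_add]
        push_cast
        ring
      rw [e1, e2]
      refine (norm_add_le _ _).trans ?_
      rw [norm_neg, add_mul]
      refine add_le_add (hC s hs) ?_
      rw [norm_mul, norm_mul, norm_mul, norm_pow, Complex.norm_real, Complex.norm_real,
        Complex.norm_real, Real.norm_of_nonneg hs0.le, Real.norm_of_nonneg (Real.exp_pos _).le]
      have h3 : ‖Real.exp (-(a * s ^ 2)) - 1‖ ≤ a * s ^ 2 := by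
        rw [Real.norm_eq_abs, abs_le]
        constructor
        · linarith [Real.add_one_le_exp (-(a * s ^ 2))]
        · have : Real.exp (-(a * s ^ 2)) ≤ 1 := Real.exp_le_one_iff.2 (by nlinarith [mul_nonneg ha0 (sq_nonneg s)])
          nlinarith [mul_nonneg ha0 (sq_nonneg s)]
      have h4 : s ^ (k + 2) ≤ s ^ β := by
        rw [← Real.rpow_natCast]
        refine Real.rpow_le_rpow_of_exponent_ge hs0 hs.2.le ?_
        push_cast
        linarith
      calc s ^ k * (Real.exp a * (‖Real.exp (-(a * s ^ 2)) - 1‖ * ‖F p‖))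
          ≤ s ^ k * (Real.exp a * (a * s ^ 2 * ‖F p‖)) := by gcongr
        _ = Real.exp a * a * ‖F p‖ * s ^ (k + 2) := by ring
        _ ≤ _ := by gcongr
  have := hc k (lt_add_one k)
  simp only [if_true] at this
  exact sub_eq_zero.1 this

/-- Multinomial expansion of (y·p)^k, which expresses the k-th Taylor coefficient through the
moments of degree k. -/
theorem phase_pow_eq_sum (p y : Eucl N) :
    (phase p y * Complex.I) ^ k / (k.factorial : ℂ) =
      ∑ α : Sym (Fin N) k, (-2 * Real.pi * Complex.I) ^ k / (k.factorial : ℂ) *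
        ((α : Multiset (Fin N)).countPerms * evalMonomial α p) * evalMonomial α y := by
  have h1 : (phase p y : ℂ) * Complex.I =
      (-2 * Real.pi * Complex.I) * ∑ i : Fin N, (p i : ℂ) * (y i : ℂ) := by
    rw [phase, PiLp.inner_apply]
    push_cast
    simp only [RCLike.inner_apply, conj_trivial, Complex.ofReal_mul]
    ring
  rw [h1, mul_pow, Finset.sum_pow, Finset.sym_univ, mul_div_right_comm, Finset.mul_sum]
  refine Finset.sum_congr rfl fun α _ => ?_
  rw [Multiset.prod_map_mul, evalMonomial, evalMonomial]
  simp only [Sym.val_eq_coe]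
  ring

theorem eq_zero_of_momentMap_eq_zero (hk : (k : ℝ) < m - N / 2) {u : WeightedL2 N m}
    (hu : u ∈ UnboundedOp.eigenspace (opL N m) (-(k : ℂ) / 2)) (h : momentMap hk u = 0) :
    u = 0 := by
  have hk0 : (0 : ℝ) ≤ k := k.cast_nonneg
  have hui := u.integrable (by linarith)
  have hF : ∀ p, 𝓕 (u : Eucl N → ℂ) p = 0 := by
    intro p
    have h1 := fourier_of_mem_eigenspace hk hu p
    simp only [phase_pow_eq_sum, Finset.sum_mul, mul_assoc] at h1
    rw [integral_finsetSum _ fun α _ => by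
      simp only [← mul_assoc]
      simp only [mul_assoc _ (evalMonomial α _) (u _)]
      exact (u.integrable_evalMonomial_mul hk α).const_mul _] at h1
    have h2 : ∀ α : Sym (Fin N) k, ∫ y, evalMonomial α y * u y = 0 := fun α => congrFun h α
    simp only [integral_const_mul, h2, mul_zero, Finset.sum_const_zero] at h1
    refine (mul_eq_zero.1 h1.symm).resolve_left ?_
    exact_mod_cast (Real.exp_pos _).ne'
  refine eq_zero_of_testFunctional u fun ψ => ?_
  rw [testFunctional_apply]
  have := VectorFourier.integral_fourierIntegral_smul_eq_flip (L := innerₗ (Eucl N))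
    (μ := volume) (ν := volume) Real.continuous_fourierChar
    (show Continuous fun p : Eucl N × Eucl N => innerₗ (Eucl N) p.1 p.2 from continuous_inner)
    ψ.integrable hui
  simp only [flip_innerₗ] at this
  refine Eq.trans this ?_
  refine integral_eq_zero_of_ae (.of_forall fun p => ?_)
  change ψ p • 𝓕 (u : Eucl N → ℂ) p = 0
  rw [hF, smul_zero]

/-- Both bounds are indexed by the multisets of size k in N letters: the moments embed the
eigenspace, and the vectors `hermite` are independent in it. -/
theorem rank_eigenspace_opL (hk : (k : ℝ) < m - N / 2) :
    Module.rank ℂ (UnboundedOp.eigenspace (opL N m) (-(k : ℂ) / 2)) =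
      ((N + k - 1).choose k : ℕ) := by
  have hcard : Fintype.card (Sym (Fin N) k) = (N + k - 1).choose k := by
    rw [Sym.card_sym_eq_choose, Fintype.card_fin]
  refine le_antisymm ?_ ?_
  · have h1 := LinearMap.rank_le_of_injective
      ((momentMap hk).comp (UnboundedOp.eigenspace (opL N m) (-(k : ℂ) / 2)).subtype) ?_
    · rwa [rank_fun', hcard] at h1
    · refine (injective_iff_map_eq_zero _).2 fun u hu => ?_
      exact Subtype.ext (eq_zero_of_momentMap_eq_zero hk u.2 hu)
  · have h1 : LinearIndependent ℂ fun α : Sym (Fin N) k =>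
        (⟨schwartzVec m (hermite α), schwartzVec_hermite_mem α⟩ :
          UnboundedOp.eigenspace (opL N m) (-(k : ℂ) / 2)) :=
      LinearIndependent.of_comp (Submodule.subtype _) (linearIndependent_hermite m)
    have h2 := h1.cardinal_le_rank
    rwa [Cardinal.mk_fintype, hcard] at h2

end Dimension


/-! ### The spectrum of `ℒ` -/

section Spectrum

open Set

variable {N : ℕ} {m : ℝ≥0} {k : ℕ}

theorem isEigenvalue_opL (hN : 1 ≤ N) (hk : (k : ℝ) < m - N / 2) :
    UnboundedOp.IsEigenvalue (opL N m) (-(k : ℂ) / 2) := by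
  intro hbot
  have h1 := rank_eigenspace_opL hk
  rw [hbot, rank_bot] at h1
  have h2 : 0 < (N + k - 1).choose k := Nat.choose_pos (by omega)
  exact h2.ne (by exact_mod_cast h1)

theorem spectrum_opL (hN : 1 ≤ N) :
    UnboundedOp.spectrum (opL N m) =
      {z : ℂ | z.re ≤ (N : ℝ) / 4 - (m : ℝ) / 2} ∪ {z : ℂ | ∃ k : ℕ, z = -(k : ℂ) / 2} := by
  have hhalf : {z : ℂ | z.re ≤ (N : ℝ) / 4 - (m : ℝ) / 2} ⊆ UnboundedOp.spectrum (opL N m) := by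
    rw [← Complex.closure_setOfPred_re_lt]
    exact fun z hz => UnboundedOp.mem_spectrum_of_mem_closure_eigenvalues
      (closure_mono (fun w hw => isEigenvalue_of_re_lt hN hw) hz)
  refine Subset.antisymm (fun z hz => ?_) (union_subset hhalf ?_)
  · by_contra hcon
    rw [mem_union, not_or] at hcon
    have h1 : (N : ℝ) / 4 - (m : ℝ) / 2 < z.re := not_le.1 hcon.1
    refine hz ⟨_, (isExpandingSemigroup_semigroupL N m).isResolventAt ?_ fun j _ hj =>
      hcon.2 ⟨j, hj⟩⟩
    have : (2 * z).re = 2 * z.re := by simp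
    rw [this]
    linarith
  · rintro _ ⟨k, rfl⟩
    by_cases hk : (k : ℝ) < m - N / 2
    -- For k < γ the point is an eigenvalue; for k ≥ γ it already lies in the half-plane.
    · exact UnboundedOp.mem_spectrum_of_mem_closure_eigenvalues
        (subset_closure (isEigenvalue_opL hN hk))
    · refine hhalf ?_
      have : (-(k : ℂ) / 2).re = -k / 2 := by simp
      change (-(k : ℂ) / 2).re ≤ _
      rw [this]
      linarith [not_lt.1 hk]

theorem isIsolatedInSpectrum_opL (hN : 1 ≤ N) (hk : (k : ℝ) < m - N / 2) :
    UnboundedOp.IsIsolatedInSpectrum (opL N m) (-(k : ℂ) / 2) := by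
  have hre : (-(k : ℂ) / 2).re = -k / 2 := by simp
  -- The spacing of the points -j/2, and the distance to the half-plane.
  refine ⟨min (1 / 2) (-k / 2 - (N / 4 - m / 2)), lt_min (by norm_num) (by linarith), ?_⟩
  rw [spectrum_opL hN]
  refine Subset.antisymm ?_ ?_
  · rintro z ⟨hz, hzb⟩
    rw [Metric.mem_ball, dist_comm, Complex.dist_eq, lt_min_iff] at hzb
    rcases hz with hz | ⟨j, rfl⟩
    · have h1 := (Complex.re_le_norm (-(k : ℂ) / 2 - z)).trans_lt hzb.2
      rw [Complex.sub_re, hre] at h1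
      have h2 : z.re ≤ (N : ℝ) / 4 - (m : ℝ) / 2 := hz
      linarith
    · have h1 : -(k : ℂ) / 2 - -(j : ℂ) / 2 = (((j : ℝ) - k) / 2 : ℝ) := by push_cast; ring
      have h2 := hzb.1
      rw [h1, Complex.norm_real, Real.norm_eq_abs, abs_lt] at h2
      have h3 : j < k + 1 := by exact_mod_cast (by linarith : (j : ℝ) < k + 1)
      have h4 : k < j + 1 := by exact_mod_cast (by linarith : (k : ℝ) < j + 1)
      rw [mem_singleton_iff, show j = k by omega]
  · rintro _ rfl
    exact ⟨Or.inr ⟨k, rfl⟩, Metric.mem_ball_self (lt_min (by norm_num) (by linarith))⟩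

theorem hasAlgebraicMultiplicity_opL (hN : 1 ≤ N) (hk : (k : ℝ) < m - N / 2) :
    UnboundedOp.HasAlgebraicMultiplicity (opL N m) (-(k : ℂ) / 2) ((N + k - 1).choose k) := by
  intro r hr hsep
  have hre : (-(k : ℂ) / 2).re = -k / 2 := by simp
  have hS := isExpandingSemigroup_semigroupL N m
  -- Separation forces the closed disc off the half-plane and off the other points -j/2, as
  -- `rieszProjection_eq` requires.
  have hmem : ∀ z ∈ Metric.closedBall (-(k : ℂ) / 2) r, z ∈ UnboundedOp.spectrum (opL N m) →
      z = -(k : ℂ) / 2 := fun z hz hzs => by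
    have : z ∈ UnboundedOp.spectrum (opL N m) ∩ Metric.closedBall (-(k : ℂ) / 2) r := ⟨hzs, hz⟩
    rwa [hsep] at this
  rw [hS.rieszProjection_eq hk hr, ← hS.eigenspace_eq_range hk]
  · exact rank_eigenspace_opL hk
  · intro z hz
    by_contra hcon
    have h2 : (2 * z).re = 2 * z.re := by simp
    rw [h2, not_lt] at hcon
    have h1 : z.re ≤ (N : ℝ) / 4 - (m : ℝ) / 2 := by linarith
    have h3 := hmem z hz (by rw [spectrum_opL hN]; exact Or.inl h1)
    rw [h3, hre] at h1
    linarith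
  · intro j _ hjk hj
    have h3 := hmem _ hj (by rw [spectrum_opL hN]; exact Or.inr ⟨j, rfl⟩)
    refine hjk ?_
    rw [div_left_inj' two_ne_zero, neg_inj] at h3
    exact_mod_cast h3

end Spectrum

end

theorem mainTheorem9 (N : ℕ) (hN : 1 ≤ N) (m : ℝ≥0) :
    UnboundedOp.spectrum (opL N m) =
        {z : ℂ | z.re ≤ (N : ℝ) / 4 - (m : ℝ) / 2} ∪ {z : ℂ | ∃ k : ℕ, z = -(k : ℂ) / 2} ∧
    ∀ k : ℕ, (k : ℝ) + (N : ℝ) / 2 < (m : ℝ) →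
      UnboundedOp.IsEigenvalue (opL N m) (-(k : ℂ) / 2) ∧
      UnboundedOp.IsIsolatedInSpectrum (opL N m) (-(k : ℂ) / 2) ∧
      Module.rank ℂ (UnboundedOp.eigenspace (opL N m) (-(k : ℂ) / 2)) =
        ((N + k - 1).choose k : ℕ) ∧
      UnboundedOp.HasAlgebraicMultiplicity (opL N m) (-(k : ℂ) / 2)
        ((N + k - 1).choose k) := by
  refine ⟨spectrum_opL hN, fun k hk => ?_⟩
  have hk' : (k : ℝ) < m - N / 2 := by linarith
  exact ⟨isEigenvalue_opL hN hk', isIsolatedInSpectrum_opL hN hk', rank_eigenspace_opL hk',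
    hasAlgebraicMultiplicity_opL hN hk'⟩
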